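/- **Setting.** Let $n,N,p\ge 1$ be integers, $\gamma\in(1/3,1]$, $\varepsilon>0$, $T>0$, and write $\mathcal B_q=L^q(\mathbb R^n)$ (real-valued functions; for $q<1$ with the usual quasi-norm). Let $S_0=\mathrm{id}$, $S_t\varphi=g_t*\varphi$ with $g_t(\xi)=(2\pi t)^{-n/2}e^{-|\xi|^2/2t}$ for $t>0$, and $a_{ts}=S_{t-s}-\mathrm{id}$ for $s\le t$. Let $\mathcal B_{1,p}=(\mathrm{id}-\Delta)^{-1}(L^p(\mathbb R^n))$ with norm $\|\varphi\|_{L^p}+\|\Delta\varphi\|_{L^p}$. For continuous increments on the simplices of $[0,T]$ put $(\delta y)_{ts}=y_t-y_s$, $(\hat\delta y)_{ts}=(\delta y)_{ts}-a_{ts}y_s$, $(\hat\delta z)_{tus}=z_{ts}-z_{tu}-z_{us}-a_{tu}z_{us}$, and $(\hat\delta h)_{tuvs}=-h_{uvs}+h_{tvs}-h_{tus}+h_{tuv}-a_{tu}h_{uvs}$. For a normed space $V$: $y\in\mathcal C_1^0(V)$ if $y$ is continuous and bounded; $y\in\mathcal C_1^\kappa(V)$ (resp. $\hat{\mathcal C}_1^\kappa(V)$)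 if $y$ is continuous and $\|(\delta y)_{ts}\|\lesssim|t-s|^\kappa$ (resp. $\|(\hat\delta y)_{ts}\|\lesssim|t-s|^\kappa$); $z\in\mathcal C_2^\kappa(V)$ if $z$ is continuous and $\|z_{ts}\|\lesssim|t-s|^\kappa$; and $h\in\mathcal C_3^\mu(V)$ if $h$ is a finite sum of continuous $h^k$ with $\|h^k_{tus}\|\lesssim|t-u|^{\rho_k}|u-s|^{\mu-\rho_k}$, $0<\rho_k<\mu$. For $h\in\mathcal C_3^\mu(\mathcal B_{1,p})$ with $\mu>1$ and $\hat\delta h=0$, $\hat\Lambda h$ denotes the unique element of $\mathcal C_2^\mu(\mathcal B_{1,p})$ with $\hat\delta(\hat\Lambda h)=h$. Repeated indices $i,j\in\{1,\dots,N\}$ are summed in products. **Hypothesis on the noise.** $x=(x^1,\dots,x^N):[0,T]\to\mathbb R^N$, and $X^{x,i}_{ts},X^{ax,i}_{ts},X^{xx,ij}_{ts}$ ($0\le s\le t\le T$, $1\le i,j\le N$) are linear operators such that $$\hat\delta X^{x,i}=0,\qquad X^{x,i}=X^{ax,i}+\delta x^i,\qquad (\hat\delta X^{xx,ij})_{tus}=X^{x,i}_{tu}(\delta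 x^j)_{us},$$ $X^{x,i}$ and $X^{xx,ij}$ commute with $S_\varepsilon$, and $$X^{x,i}\in\mathcal C_2^\gamma(\mathcal L(\mathcal B_p,\mathcal B_p))\cap\mathcal C_2^\gamma(\mathcal L(\mathcal B_{1,p},\mathcal B_{1,p}))\cap\mathcal C_2^{\gamma-n/(2p)}(\mathcal L(\mathcal B_{p/2},\mathcal B_p)),$$ $$X^{ax,i}\in\mathcal C_2^{1+\gamma}(\mathcal L(\mathcal B_{1,p},\mathcal B_p)),\qquad X^{xx,ij}\in\mathcal C_2^{2\gamma}(\mathcal L(\mathcal B_p,\mathcal B_p))\cap\mathcal C_2^{2\gamma}(\mathcal L(\mathcal B_{1,p},\mathcal B_{1,p})).$$ **Nonlinearity.** $f_i(\varphi)(\xi)=\sigma_i(\xi,\varphi(\xi))$ with $f_i\in\mathcal X_3$, i.e. $\sigma_i:\mathbb R^n\times\mathbb R\to\mathbb R$ vanishes for $\xi$ outside a ball independent of $\eta$, $\sigma_i(\xi,\cdot)$ is $C^3$, $\partial_\eta^m\sigma_i$ is differentiable in $\xi$ for $m\le2$, and $\partial_\eta^m\sigma_i$ ($m\le3$), $\nabla_\xi\partial_\eta^m\sigma_i$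 ($m\le2$) are bounded. Write $f_i'(\varphi)(\xi)=\partial_\eta\sigma_i(\xi,\varphi(\xi))$, and $\cdot$ for the pointwise product. **Controlled processes and integral.** $\tilde Q_{\kappa,p}([0,T])$ is the set of controlled processes $(y,(y^{x,i})_i)$ with $y\in\hat{\mathcal C}_1^\gamma(\mathcal B_{1,p})$, $y^{x,i}\in\mathcal C_1^0(\mathcal B_{1,p})\cap\mathcal C_1^\kappa(\mathcal B_{1,p})$, and $y^\sharp_{ts}:=(\hat\delta y)_{ts}-X^{x,i}_{ts}y^{x,i}_s\in\mathcal C_2^{2\kappa}(\mathcal B_{1,p})$. For such a process set $$f_i(y)^\sharp_{ts}=a_{ts}y_s\cdot f_i'(y_s)+y^\sharp_{ts}\cdot f_i'(y_s)+(X^{ax,j}_{ts}y^{x,j}_s)\cdot f_i'(y_s)+\int_0^1[f_i'(y_s+r(\delta y)_{ts})-f_i'(y_s)]\cdot(\delta y)_{ts}\,dr,$$ $$\mathcal J_{ts}(\hat dx^{(i)}\,S_\varepsilon f_i(y))=X^{x,i}_{ts}S_\varepsilon f_i(y_s)+X^{xx,ij}_{ts}S_\varepsilon\big(y^{x,j}_s\cdot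 f_i'(y_s)\big)+\hat\Lambda_{ts}\Big(X^{x,i}S_\varepsilon f_i(y)^\sharp+X^{xx,ij}S_\varepsilon\,\delta\big(y^{x,j}\cdot f_i'(y)\big)\Big),$$ where the argument of $\hat\Lambda$ at $(t,u,s)$ is $X^{x,i}_{tu}S_\varepsilon f_i(y)^\sharp_{us}+X^{xx,ij}_{tu}S_\varepsilon\,\delta(y^{x,j}\cdot f_i'(y))_{us}$. A process $z$ with $\hat\delta z=\mathcal J(\hat dx^{(i)}S_\varepsilon f_i(y))$ is regarded as a controlled process with derivative $z^{x,i}=S_\varepsilon f_i(y)$. **Theorem.** Let $\kappa\in(1/3,\gamma)$ with $\gamma-\kappa>n/(2p)$, and $\psi\in\mathcal B_{1,p}$. Then the system $$(\hat\delta y)_{ts}=\mathcal J_{ts}(\hat dx^{(i)}\,S_\varepsilon f_i(y))\quad(0\le s\le t\le T),\qquad y_0=\psi,$$ has a unique global solution in $\tilde Q_{\kappa,p}([0,T])$: there is exactly one controlled process $(y,y^x)\in\tilde Q_{\kappa,p}([0,T])$ with $y_0=\psi$, $y^{x,i}=S_\varepsilon f_i(y)$, for which the argument of $\hat\Lambda$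 lies in $\mathcal C_3^\mu(\mathcal B_{1,p})\cap\operatorname{Ker}\hat\delta$ for some $\mu>1$ and the equation holds on $[0,T]$. -/

import Mathlib

open MeasureTheory Filter Topology Set
open scoped ENNReal NNReal SchwartzMap Laplacian

noncomputable section

namespace RoughHeat

/-! ## Lebesgue and Bessel potential spaces, heat semigroup -/

/-- The physical space `ℝⁿ`. -/
abbrev Space (n : ℕ) : Type := EuclideanSpace ℝ (Fin n)

/-- `𝓑_p = L^p(ℝⁿ)` (real valued functions modulo a.e. equality). -/
abbrev LpSpace (n p : ℕ) : Type := Lp ℝ (p : ℝ≥0∞) (volume : Measure (Space n))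

/-- The class in `L^p` of a function. It is only used for functions in `L^p` (Young's inequality
for `g_t * φ`; boundedness and compact support of `σ` for `f(φ)`; boundedness of `∂_η σ` for
`χ · f'(φ)` and for the Taylor remainder); the value for other functions is irrelevant. -/
def classOf {n : ℕ} (p : ℕ) (g : Space n → ℝ) : LpSpace n p :=
  open Classical in if h : MemLp g (p : ℝ≥0∞) volume then h.toLp g else 0

/-- The heat kernel `g_t(ξ) = (2πt)^{-n/2} exp(-|ξ|²/(2t))`. -/
def heatKernel (n : ℕ) (t : ℝ) (ξ : Space n) : ℝ :=
  (2 * Real.pi * t) ^ (-(n : ℝ) / 2) * Real.exp (-‖ξ‖ ^ 2 / (2 * t))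

/-- The convolution `g_t * φ`. -/
def heatConv {n : ℕ} (t : ℝ) (φ : Space n → ℝ) (ξ : Space n) : ℝ :=
  ∫ η, heatKernel n t (ξ - η) * φ η

/-- The heat semigroup on `L^p`: `S_0 = id` and `S_t φ = g_t * φ` for `t > 0`. -/
def heat {n p : ℕ} (t : ℝ) (φ : LpSpace n p) : LpSpace n p :=
  if t = 0 then φ else classOf p (heatConv t φ)

/-- `ψ` is the Laplacian of `φ` in the sense of tempered distributions. -/
def HasWeakLaplacian {n p : ℕ} (φ ψ : LpSpace n p) : Prop :=
  ∀ u : 𝓢(Space n, ℝ), ∫ ξ, φ ξ * (Δ u) ξ = ∫ ξ, ψ ξ * u ξ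

/-- The norm of `𝓑_{1,p} = (id - Δ)^{-1}(L^p) = {φ ∈ L^p : Δφ ∈ L^p}`, that is
`‖φ‖_{L^p} + ‖Δφ‖_{L^p}`; it is `∞` exactly when `φ ∉ 𝓑_{1,p}`. (The weak Laplacian is unique,
so that the infimum runs over at most one `ψ`.) -/
def besselNorm {n p : ℕ} (φ : LpSpace n p) : ℝ≥0∞ :=
  ⨅ (ψ : LpSpace n p) (_ : HasWeakLaplacian φ ψ), ‖φ‖ₑ + ‖ψ‖ₑ

/-- The norm of `𝓑_p = L^p`. -/
def lebNorm {n p : ℕ} (φ : LpSpace n p) : ℝ≥0∞ := ‖φ‖ₑ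

/-- The norm of `𝓑_{p/2} = L^{p/2}`, evaluated on elements of `L^p`; it is `∞` exactly when
`φ ∉ L^{p/2}`. -/
def lebHalfNorm {n p : ℕ} (φ : LpSpace n p) : ℝ≥0∞ :=
  eLpNorm φ ((p : ℝ≥0∞) / 2) volume

/-! ## Nonlinearities -/

/-- The class `𝒳_k`, for the vector field `f(φ)(ξ) = σ(ξ, φ(ξ))`. -/
structure ClassX {n : ℕ} (k : ℕ) (σ : Space n → ℝ → ℝ) : Prop where
  /-- `σ(·, η)` vanishes outside a ball which does not depend on `η`. -/
  support : ∃ M : ℝ, ∀ ξ, M < ‖ξ‖ → ∀ η, σ ξ η = 0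
  /-- `σ(ξ, ·)` is of class `C^k`. -/
  smooth : ∀ ξ, ContDiff ℝ k (σ ξ)
  /-- `∂_η^m σ` is differentiable in `ξ` for `m ≤ k - 1`. -/
  diff : ∀ m < k, ∀ η, Differentiable ℝ fun ξ => iteratedDeriv m (σ ξ) η
  /-- All these derivatives are bounded. -/
  bound : ∃ C : ℝ, ∀ ξ η, (∀ m ≤ k, |iteratedDeriv m (σ ξ) η| ≤ C) ∧
    ∀ m < k, ‖fderiv ℝ (fun ζ => iteratedDeriv m (σ ζ) η) ξ‖ ≤ C

/-- The vector field `f(φ)(ξ) = σ(ξ, φ(ξ))`. -/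
def field {n p : ℕ} (σ : Space n → ℝ → ℝ) (φ : LpSpace n p) : LpSpace n p :=
  classOf p fun ξ => σ ξ (φ ξ)

/-- The pointwise product `χ · f'(φ)`, where `f'(φ)(ξ) = ∂_η σ(ξ, φ(ξ))`. -/
def mulDeriv {n p : ℕ} (σ : Space n → ℝ → ℝ) (χ φ : LpSpace n p) : LpSpace n p :=
  classOf p fun ξ => χ ξ * deriv (σ ξ) (φ ξ)

/-- The Taylor remainder `∫₀¹ [f'(φ + rχ) - f'(φ)] · χ dr`. -/
def taylorRem {n p : ℕ} (σ : Space n → ℝ → ℝ) (φ χ : LpSpace n p) : LpSpace n p :=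
  classOf p fun ξ =>
    ∫ r in (0 : ℝ)..1, (deriv (σ ξ) (φ ξ + r * χ ξ) - deriv (σ ξ) (φ ξ)) * χ ξ

/-! ## Increments. Time variables are written in decreasing order `t ≥ u ≥ v ≥ s`. -/

/-- The time interval `[0,T]`. -/
abbrev Time (T : ℝ) : Type := Set.Icc (0 : ℝ) T

section Increments

variable {n p : ℕ} {T : ℝ}

/-- `a_{ts} φ = S_{t-s} φ - φ`. -/
def aOp (t s : Time T) (φ : LpSpace n p) : LpSpace n p := heat ((t : ℝ) - s) φ - φ

/-- `(δ̂y)_{ts} = (δy)_{ts} - a_{ts} y_s`. -/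
def deltaHat1 (y : Time T → LpSpace n p) (t s : Time T) : LpSpace n p :=
  (y t - y s) - aOp t s (y s)

/-- `(δ̂z)_{tus} = (δz)_{tus} - a_{tu} z_{us}`, with `(δz)_{tus} = z_{ts} - z_{tu} - z_{us}`. -/
def deltaHat2 (z : Time T → Time T → LpSpace n p) (t u s : Time T) : LpSpace n p :=
  (z t s - z t u - z u s) - aOp t u (z u s)

/-- `(δ̂h)_{tuvs} = (δh)_{tuvs} - a_{tu} h_{uvs}`, with
`(δh)_{tuvs} = -h_{uvs} + h_{tvs} - h_{tus} + h_{tuv}`. -/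
def deltaHat3 (h : Time T → Time T → Time T → LpSpace n p) (t u v s : Time T) : LpSpace n p :=
  (-h u v s + h t v s - h t u s + h t u v) - aOp t u (h u v s)

/-! ## Hölder spaces of increments

`ν` is one of the norms above, with value `∞` outside the space. -/

/-- `g` is continuous on `A` with values in the space of norm `ν`. -/
def ContIn {α : Type} [TopologicalSpace α] (ν : LpSpace n p → ℝ≥0∞) (A : Set α)
    (g : α → LpSpace n p) : Prop :=
  ∀ a ∈ A, ν (g a) ≠ ∞ ∧ Tendsto (fun b => ν (g b - g a)) (𝓝[A] a) (𝓝 0)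

/-- The simplex of pairs `(t,s)` with `s ≤ t`. -/
def simplex2 (T : ℝ) : Set (Time T × Time T) := {q | q.2 ≤ q.1}

/-- The simplex of triples `(t,u,s)` with `s ≤ u ≤ t`. -/
def simplex3 (T : ℝ) : Set (Time T × Time T × Time T) := {q | q.2.2 ≤ q.2.1 ∧ q.2.1 ≤ q.1}

/-- `y ∈ 𝒞_1^0`: continuous and bounded. -/
def MemC1Zero (ν : LpSpace n p → ℝ≥0∞) (y : Time T → LpSpace n p) : Prop :=
  ContIn ν univ y ∧ ∃ C : ℝ≥0, ∀ t, ν (y t) ≤ C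

/-- `y ∈ 𝒞_1^κ`. -/
def MemC1 (ν : LpSpace n p → ℝ≥0∞) (κ : ℝ) (y : Time T → LpSpace n p) : Prop :=
  ContIn ν univ y ∧
    ∃ C : ℝ≥0, ∀ t s : Time T, s < t →
      ν (y t - y s) ≤ C * ENNReal.ofReal (((t : ℝ) - s) ^ κ)

/-- `y ∈ 𝒞̂_1^κ`: Hölder continuity with respect to `δ̂`. -/
def MemC1Hat (ν : LpSpace n p → ℝ≥0∞) (κ : ℝ) (y : Time T → LpSpace n p) : Prop :=
  ContIn ν univ y ∧
    ∃ C : ℝ≥0, ∀ t s : Time T, s < t →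
      ν (deltaHat1 y t s) ≤ C * ENNReal.ofReal (((t : ℝ) - s) ^ κ)

/-- `z ∈ 𝒞_2^κ`. -/
def MemC2 (ν : LpSpace n p → ℝ≥0∞) (κ : ℝ) (z : Time T → Time T → LpSpace n p) : Prop :=
  ContIn ν (simplex2 T) (fun q => z q.1 q.2) ∧
    ∃ C : ℝ≥0, ∀ t s : Time T, s < t →
      ν (z t s) ≤ C * ENNReal.ofReal (((t : ℝ) - s) ^ κ)

/-- `h ∈ 𝒞_3^{κ,ρ}`. -/
def MemC3Pair (ν : LpSpace n p → ℝ≥0∞) (κ ρ : ℝ)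
    (h : Time T → Time T → Time T → LpSpace n p) : Prop :=
  ContIn ν (simplex3 T) (fun q => h q.1 q.2.1 q.2.2) ∧
    ∃ C : ℝ≥0, ∀ t u s : Time T, s < u → u < t →
      ν (h t u s) ≤
        C * ENNReal.ofReal (((t : ℝ) - u) ^ κ) * ENNReal.ofReal (((u : ℝ) - s) ^ ρ)

/-- `h ∈ 𝒞_3^μ`: a finite sum of elements of `𝒞_3^{ρ,μ-ρ}`, `0 < ρ < μ`. -/
def MemC3 (ν : LpSpace n p → ℝ≥0∞) (μ : ℝ)
    (h : Time T → Time T → Time T → LpSpace n p) : Prop :=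
  ∃ (m : ℕ) (ρ : Fin m → ℝ) (g : Fin m → Time T → Time T → Time T → LpSpace n p),
    (∀ k, 0 < ρ k ∧ ρ k < μ ∧ MemC3Pair ν (ρ k) (μ - ρ k) (g k)) ∧
      ∀ t u s : Time T, s ≤ u → u ≤ t → h t u s = ∑ k, g k t u s

/-- `R = Λ̂ h` in `𝓑_{1,p}`: for some `μ > 1`, `h ∈ 𝒞_3^μ(𝓑_{1,p}) ∩ Ker δ̂`, and `R` is the
element of `𝒞_2^μ(𝓑_{1,p})` such that `δ̂R = h`. There is at most one such `R`, so that no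
further spatial regularity is needed to single it out. -/
def IsLambdaHat (h : Time T → Time T → Time T → LpSpace n p)
    (R : Time T → Time T → LpSpace n p) : Prop :=
  ∃ μ : ℝ, 1 < μ ∧ MemC3 besselNorm μ h ∧
    (∀ t u v s : Time T, s ≤ v → v ≤ u → u ≤ t → deltaHat3 h t u v s = 0) ∧
    MemC2 besselNorm μ R ∧
    ∀ t u s : Time T, s ≤ u → u ≤ t → deltaHat2 R t u s = h t u s

/-! ## The rough path above `x` associated with the heat equation -/

/-- `M ∈ 𝒞_2^γ(𝓛(V,W))`, where `V` and `W` have norms `ν` and `ν'`. The operators are given on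
`L^p`, and act on the elements of `L^p` which belong to `V` (for `V = L^{p/2}` these are dense,
and the bound is the one that extends the operator to all of `L^{p/2}`). -/
def MemC2Op (ν ν' : LpSpace n p → ℝ≥0∞) (γ : ℝ)
    (M : Time T → Time T → LpSpace n p → LpSpace n p) : Prop :=
  (∀ q₀ ∈ simplex2 T, ∀ r : ℝ≥0, 0 < r → ∀ᶠ q in 𝓝[simplex2 T] q₀,
      ∀ φ, ν φ ≠ ∞ → ν' (M q.1 q.2 φ - M q₀.1 q₀.2 φ) ≤ r * ν φ) ∧
    ∃ C : ℝ≥0, ∀ t s : Time T, s < t → ∀ φ, ν φ ≠ ∞ →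
      ν' (M t s φ) ≤ C * ENNReal.ofReal (((t : ℝ) - s) ^ γ) * ν φ

variable [Fact (1 ≤ (p : ℝ≥0∞))] {N : ℕ}

/-- The simplified rough-path hypothesis on `x` and on the operators
`X^{x,i}`, `X^{ax,i}`, `X^{xx,ij}`. -/
structure HeatRoughPath (γ ε : ℝ) (x : Fin N → Time T → ℝ)
    (X Xa : Fin N → Time T → Time T → LpSpace n p →L[ℝ] LpSpace n p)
    (XX : Fin N → Fin N → Time T → Time T → LpSpace n p →L[ℝ] LpSpace n p) : Prop where
  /-- `δ̂ X^{x,i} = 0` -/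
  delta_X : ∀ i, ∀ t u s : Time T, s ≤ u → u ≤ t → ∀ φ,
    deltaHat2 (fun t s => X i t s φ) t u s = 0
  /-- `X^{x,i} = X^{ax,i} + δx^i` -/
  X_eq : ∀ i, ∀ t s : Time T, s ≤ t → ∀ φ, X i t s φ = Xa i t s φ + (x i t - x i s) • φ
  /-- `δ̂ X^{xx,ij} = X^{x,i} (δx^j)` -/
  delta_XX : ∀ i j, ∀ t u s : Time T, s ≤ u → u ≤ t → ∀ φ,
    deltaHat2 (fun t s => XX i j t s φ) t u s = X i t u ((x j u - x j s) • φ)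
  /-- `X^{x,i}` commutes with `S_ε` -/
  comm_X : ∀ i, ∀ t s : Time T, s ≤ t → ∀ φ, X i t s (heat ε φ) = heat ε (X i t s φ)
  /-- `X^{xx,ij}` commutes with `S_ε` -/
  comm_XX : ∀ i j, ∀ t s : Time T, s ≤ t → ∀ φ,
    XX i j t s (heat ε φ) = heat ε (XX i j t s φ)
  X_leb : ∀ i, MemC2Op lebNorm lebNorm γ (fun t s => X i t s)
  X_bessel : ∀ i, MemC2Op besselNorm besselNorm γ (fun t s => X i t s)
  X_half : ∀ i, MemC2Op lebHalfNorm lebNorm (γ - n / (2 * p)) (fun t s => X i t s)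
  Xa_bessel : ∀ i, MemC2Op besselNorm lebNorm (1 + γ) (fun t s => Xa i t s)
  XX_leb : ∀ i j, MemC2Op lebNorm lebNorm (2 * γ) (fun t s => XX i j t s)
  XX_bessel : ∀ i j, MemC2Op besselNorm besselNorm (2 * γ) (fun t s => XX i j t s)

/-! ## Controlled processes, the integral and the equation -/

/-- The remainder `y^♯ = δ̂y - X^{x,i} y^{x,i}`. -/
def sharp (X : Fin N → Time T → Time T → LpSpace n p →L[ℝ] LpSpace n p)
    (y : Time T → LpSpace n p) (yx : Fin N → Time T → LpSpace n p)
    (t s : Time T) : LpSpace n p :=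
  deltaHat1 y t s - ∑ i, X i t s (yx i s)

/-- `y`, with the derivative `y^x`, is a controlled process: an element of `Q̃_{κ,p}([0,T])`. -/
structure IsControlled (γ κ : ℝ)
    (X : Fin N → Time T → Time T → LpSpace n p →L[ℝ] LpSpace n p)
    (y : Time T → LpSpace n p) (yx : Fin N → Time T → LpSpace n p) : Prop where
  path : MemC1Hat besselNorm γ y
  deriv_zero : ∀ i, MemC1Zero besselNorm (yx i)
  deriv_holder : ∀ i, MemC1 besselNorm κ (yx i)
  remainder : MemC2 besselNorm (2 * κ) (sharp X y yx)

/-- The remainder `f(y)^♯` of `δ(f(y))_{ts} = (δx^j)_{ts} y^{x,j}_s · f'(y_s) + f(y)^♯_{ts}`. -/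
def fieldSharp (X Xa : Fin N → Time T → Time T → LpSpace n p →L[ℝ] LpSpace n p)
    (σ : Space n → ℝ → ℝ)
    (y : Time T → LpSpace n p) (yx : Fin N → Time T → LpSpace n p)
    (t s : Time T) : LpSpace n p :=
  mulDeriv σ (aOp t s (y s)) (y s) + mulDeriv σ (sharp X y yx t s) (y s)
    + ∑ j, mulDeriv σ (Xa j t s (yx j s)) (y s) + taylorRem σ (y s) (y t - y s)

/-- The argument of `Λ̂` in the integral:
`X^{x,i} S_ε f_i(y)^♯ + X^{xx,ij} S_ε δ(y^{x,j} · f_i'(y))`. -/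
def lambdaArg (ε : ℝ) (X Xa : Fin N → Time T → Time T → LpSpace n p →L[ℝ] LpSpace n p)
    (XX : Fin N → Fin N → Time T → Time T → LpSpace n p →L[ℝ] LpSpace n p)
    (σ : Fin N → Space n → ℝ → ℝ)
    (y : Time T → LpSpace n p) (yx : Fin N → Time T → LpSpace n p)
    (t u s : Time T) : LpSpace n p :=
  ∑ i, X i t u (heat ε (fieldSharp X Xa (σ i) y yx u s))
    + ∑ i, ∑ j, XX i j t u
        (heat ε (mulDeriv (σ i) (yx j u) (y u) - mulDeriv (σ i) (yx j s) (y s)))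

/-- `J = 𝒥(d̂x^{(i)} S_ε f_i(y))` is the rough integral along the controlled process `(y, y^x)`:
`J_{ts} = X^{x,i}_{ts} S_ε f_i(y_s) + X^{xx,ij}_{ts} S_ε(y^{x,j}_s · f_i'(y_s)) + Λ̂_{ts}(…)`. -/
def IsIntegral (ε : ℝ) (X Xa : Fin N → Time T → Time T → LpSpace n p →L[ℝ] LpSpace n p)
    (XX : Fin N → Fin N → Time T → Time T → LpSpace n p →L[ℝ] LpSpace n p)
    (σ : Fin N → Space n → ℝ → ℝ)
    (y : Time T → LpSpace n p) (yx : Fin N → Time T → LpSpace n p)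
    (J : Time T → Time T → LpSpace n p) : Prop :=
  ∃ R : Time T → Time T → LpSpace n p,
    IsLambdaHat (lambdaArg ε X Xa XX σ y yx) R ∧
    ∀ t s : Time T, s ≤ t →
      J t s = ∑ i, X i t s (heat ε (field (σ i) (y s)))
        + ∑ i, ∑ j, XX i j t s (heat ε (mulDeriv (σ i) (yx j s) (y s))) + R t s

/-- `(y, y^x)` solves `δ̂y = 𝒥(d̂x^{(i)} S_ε f_i(y))`, `y_0 = ψ`, on `[0,T]`, in the space of
controlled processes. As a controlled process the right-hand side has the derivative
`S_ε f_i(y)`, which therefore is `y^{x,i}`. -/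
structure IsSolution (hT : 0 ≤ T) (γ κ ε : ℝ)
    (X Xa : Fin N → Time T → Time T → LpSpace n p →L[ℝ] LpSpace n p)
    (XX : Fin N → Fin N → Time T → Time T → LpSpace n p →L[ℝ] LpSpace n p)
    (σ : Fin N → Space n → ℝ → ℝ) (ψ : LpSpace n p)
    (y : Time T → LpSpace n p) (yx : Fin N → Time T → LpSpace n p) : Prop where
  controlled : IsControlled γ κ X y yx
  init : y ⟨0, le_refl 0, hT⟩ = ψ
  deriv_eq : ∀ i s, yx i s = heat ε (field (σ i) (y s))
  equation : ∃ J : Time T → Time T → LpSpace n p, IsIntegral ε X Xa XX σ y yx J ∧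
    ∀ t s : Time T, s ≤ t → deltaHat1 y t s = J t s

end Increments

end RoughHeat

end

/-! Write a solution as y_t = S_t ψ + S_ε z_t. Since S_ε commutes with the heat semigroup and with
the operators X and XX, the equation becomes one for z: up to an error of order larger than one, z_t
equals S_{t-s} z_s plus the second order expansion X_{ts} f_i(y_s) + XX_{ts}(S_ε f_j(y_s) ·
f_i'(y_s)). The unknown z lives in L^p alone. The smoothing S_ε does two things: it sends L^p into
the Bessel space, which restores the regularity required of y, and it sends L^p into L^∞, which
controls products of increments.

The one-step map z_s ↦ z_t (`scheme`) is an almost flow on L^p: the steps over [s,u] and [u,t]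
compose to the step over [s,t] up to |t-s|^{κ+ρ}, with ρ = min(1, 2κ), and κ + ρ > 1 because κ >
1/3. In the defect (`RoughBounds.expansion_defect`) the relation δ̂XX = X δx cancels the first order
part of f(y_u) - f(y_s). There remain X, of order κ, applied to a Taylor remainder of order ρ, and
XX, of order ρ, applied to an increment of order κ. For the remainder to be small in L^p, the
increment of the state is split into `lead`, of order κ also in sup norm and expanded to second
order, and `rest`, of order ρ in L^p and treated by the Lipschitz bound alone.

The abstract part shows that an almost flow on a Banach space has exactly one trajectory from each
point. Bisection of a partition (`exists_discrete_sewing_constants`) bounds the distance between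
many small steps and one long step, because two halves contribute 2 · 2^{-μ} < 1 times the bound for
the whole. One step adds at most a bounded amount to the norm and the defect grows at most linearly,
so Euler schemes stay bounded on all of [0,T] and the solution is global at once. The same bisection
applied to the difference of two schemes gives Lipschitz dependence on the initial value, hence
stability under small errors at each step. Stability yields convergence of the dyadic schemes
(`AlmostFlow.exists_trajectory`) and convergence of Euler schemes to any given trajectory
(`AlmostFlow.tendsto_euler`), which is uniqueness.

To return to the equation: for a trajectory z, the smoothed error S_ε(z_t - scheme(z_s)) has the
argument of Λ̂ as its δ̂, so it is the sewing term and y is a solution. Conversely, sewing the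
expansions along a given solution y produces some z, and y_t - S_t ψ - S_ε z_t is then a trajectory
of the heat flow issued from 0, up to an error of order larger than one; so it vanishes. Every
solution therefore comes from the unique trajectory of the scheme. -/

namespace RoughHeat

/-! ## Discrete sewing -/

/-- The last time of a partition which is at distance at most `c` from its beginning. -/
theorem exists_last_le {τ : ℕ → ℝ} {c : ℝ} (hc : 0 ≤ c) {j k : ℕ} (hjk : j < k) :
    ∃ l, j ≤ l ∧ l < k ∧ τ l - τ j ≤ c ∧ (l + 1 = k ∨ c < τ (l + 1) - τ j) := by
  classical
  have hex : ∃ m, j ≤ m ∧ (m + 1 = k ∨ c < τ (m + 1) - τ j) := ⟨k - 1, by omega, Or.inl (by omega)⟩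
  obtain ⟨h1, h2⟩ := Nat.find_spec hex
  have hmk : Nat.find hex ≤ k - 1 := Nat.find_min' hex ⟨by omega, Or.inl (by omega)⟩
  refine ⟨Nat.find hex, h1, by omega, ?_, h2⟩
  rcases eq_or_lt_of_le h1 with h | h
  · rw [← h]; simpa using hc
  · by_contra hcon
    obtain ⟨l, hl⟩ : ∃ l, Nat.find hex = l + 1 := ⟨Nat.find hex - 1, by omega⟩
    refine Nat.find_min hex (m := l) (by omega) ⟨by omega, Or.inr ?_⟩
    rw [← hl]; exact not_le.1 hcon

/-- A partition of `[τ j, τ k]` splits into two parts of at most half its length and one step. -/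
theorem exists_half_split {τ : ℕ → ℝ} (hτ : Monotone τ) {j k : ℕ} (hjk : j < k) :
    ∃ l, j ≤ l ∧ l < k ∧ τ l - τ j ≤ (τ k - τ j) / 2 ∧ τ k - τ (l + 1) ≤ (τ k - τ j) / 2 := by
  have hd : 0 ≤ τ k - τ j := sub_nonneg.2 (hτ hjk.le)
  obtain ⟨l, h1, h2, h3, h4⟩ := exists_last_le (τ := τ) (c := (τ k - τ j) / 2) (by linarith) hjk
  refine ⟨l, h1, h2, h3, ?_⟩
  rcases h4 with h | h
  · rw [h]; simp only [sub_self]; linarith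
  · linarith

/-- As δ → 0 the bracket tends to 2, and 2a < 1 leaves a gap 1 - 2a. Taking δ as a tenth of the gap
keeps half of it, and C = 6 / gap then absorbs 2 + δ ≤ 3. -/
theorem exists_contraction_constants {a : ℝ} (ha0 : 0 < a) (ha2 : 2 * a < 1) :
    ∃ δ C : ℝ, 0 < δ ∧ δ ≤ 1 ∧ 0 ≤ C ∧ (1 + δ) * a ≤ 1 ∧
      C * a * ((1 + 2 * δ) + (1 + δ) ^ 2) + (2 + δ) ≤ C := by
  have hC0 : 0 ≤ 6 / (1 - 2 * a) := by apply div_nonneg <;> linarith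
  have hCa : 6 / (1 - 2 * a) * (1 - 2 * a) = 6 := by
    field_simp [show (1 - 2 * a) ≠ 0 by linarith]
  refine ⟨(1 - 2 * a) / 10, 6 / (1 - 2 * a), by linarith, by linarith, hC0, by nlinarith, ?_⟩
  set C := 6 / (1 - 2 * a)
  have h2 : a * ((1 + 2 * ((1 - 2 * a) / 10)) + (1 + (1 - 2 * a) / 10) ^ 2) ≤
      1 - (1 - 2 * a) / 2 := by nlinarith
  have h3 := mul_le_mul_of_nonneg_left h2 hC0
  nlinarith

/-- Here e j k stands for the error between the scheme and one long step, and w for the size of the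
state. A partition is cut into a left half, a single step and a right half; the single step costs
nothing because e j (j+1) = 0, so the mesh is irrelevant. The bound reproduces itself since 2 ·
2^{-μ} < 1. The constants δ and C depend on μ only, so that η can be chosen after them. -/
theorem exists_discrete_sewing_constants {μ : ℝ} (hμ : 1 < μ) :
    ∃ δ : ℝ, 0 < δ ∧ δ ≤ 1 ∧ ∃ C : ℝ, 0 ≤ C ∧
      ∀ (B η : ℝ), 0 ≤ B → (C * B + B) * η ^ μ ≤ δ →
      ∀ (τ w : ℕ → ℝ) (e : ℕ → ℕ → ℝ), Monotone τ → (∀ j, 0 ≤ w j) → (∀ j, e j j = 0) →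
      (∀ j, e j (j + 1) = 0) →
      (∀ j l k, j ≤ l → l ≤ k → τ k - τ j ≤ η →
        e j k ≤ e l k + (1 + δ) * e j l + B * w j * (τ k - τ j) ^ μ) →
      (∀ j l, j ≤ l → τ l - τ j ≤ η → w l ≤ (1 + δ) * w j + e j l) →
      ∀ j k, j ≤ k → τ k - τ j ≤ η → e j k ≤ C * B * w j * (τ k - τ j) ^ μ := by
  set a : ℝ := ((2 : ℝ) ^ μ)⁻¹ with ha
  have h2 : (2 : ℝ) < 2 ^ μ := by
    calc (2 : ℝ) = 2 ^ (1 : ℝ) := by simp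
      _ < 2 ^ μ := Real.rpow_lt_rpow_of_exponent_lt (by norm_num) hμ
  have ha0 : 0 < a := by positivity
  have ha2 : 2 * a < 1 := by
    rw [ha, ← div_eq_mul_inv, div_lt_one (by positivity)]; exact h2
  obtain ⟨δ, C, hδ0, hδ1, hC0, hδa, hkey⟩ := exists_contraction_constants ha0 ha2
  refine ⟨δ, hδ0, hδ1, C, hC0, ?_⟩
  intro B η hB hη τ w e hτ hw he0 he1 hjoin hwt j k
  induction hn : k - j using Nat.strong_induction_on generalizing j k with
  | _ n ih =>
    intro hjk hd
    rcases eq_or_lt_of_le hjk with rfl | hlt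
    · rw [he0]
      have := hw j
      have : 0 ≤ (τ j - τ j) ^ μ := Real.rpow_nonneg (by simp) _
      positivity
    obtain ⟨l, hjl, hlk, hl1, hl2⟩ := exists_half_split hτ hlt
    set d := τ k - τ j with hdd
    have hd0 : 0 ≤ d := sub_nonneg.2 (hτ hjk)
    have hjl' : 0 ≤ τ l - τ j := sub_nonneg.2 (hτ hjl)
    have hlk' : 0 ≤ τ k - τ (l + 1) := sub_nonneg.2 (hτ hlk)
    have hjl1 : 0 ≤ τ (l + 1) - τ j := sub_nonneg.2 (hτ (by omega))
    have hdl : τ (l + 1) - τ j ≤ d := by linarith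
    have hhalf : (d / 2) ^ μ = a * d ^ μ := by
      rw [Real.div_rpow hd0 (by norm_num), ha, div_eq_inv_mul]
    set D := d ^ μ with hD
    have hD0 : 0 ≤ D := Real.rpow_nonneg hd0 _
    have hDη : D ≤ η ^ μ := Real.rpow_le_rpow hd0 hd (by linarith)
    have hwj := hw j
    -- the left part
    have E1 : e j l ≤ C * B * w j * (a * D) := by
      refine (ih (l - j) (by omega) j l rfl hjl (by linarith)).trans ?_
      rw [← hhalf]
      exact mul_le_mul_of_nonneg_left (Real.rpow_le_rpow hjl' hl1 (by linarith)) (by positivity)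
    have E2 : e j (l + 1) ≤ (1 + δ) * (C * B * w j * (a * D)) + B * w j * D := by
      refine (hjoin j l (l + 1) hjl (by omega) (by linarith)).trans ?_
      rw [he1, zero_add]
      refine add_le_add (mul_le_mul_of_nonneg_left E1 (by linarith)) ?_
      exact mul_le_mul_of_nonneg_left (Real.rpow_le_rpow hjl1 hdl (by linarith)) (by positivity)
    -- Smallness of η makes the error up to the end of the single step a δ-fraction of the weight,
    -- so the weight at the start of the right part has grown by a factor of at most 1 + 2δ.
    have E2' : e j (l + 1) ≤ δ * w j := by
      refine E2.trans ?_
      have h2 : (C * B + B) * D ≤ δ :=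
        (mul_le_mul_of_nonneg_left hDη (by positivity)).trans hη
      have h3 : (1 + δ) * (C * B * w j * (a * D)) ≤ C * B * w j * D := by
        have : (1 + δ) * (C * B * w j * (a * D)) = ((1 + δ) * a) * (C * B * w j * D) := by ring
        rw [this]
        exact mul_le_of_le_one_left (by positivity) hδa
      have h4 : C * B * w j * D + B * w j * D = (C * B + B) * D * w j := by ring
      have h5 := mul_le_mul_of_nonneg_right h2 hwj
      linarith
    have W : w (l + 1) ≤ (1 + 2 * δ) * w j := by
      have := hwt j (l + 1) (by omega) (by linarith)
      linarith
    have E3 : e (l + 1) k ≤ C * B * ((1 + 2 * δ) * w j) * (a * D) := by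
      refine (ih (k - (l + 1)) (by omega) (l + 1) k rfl hlk (by linarith)).trans ?_
      rw [← hhalf]
      have hw' := hw (l + 1)
      refine mul_le_mul (mul_le_mul_of_nonneg_left W (by positivity))
        (Real.rpow_le_rpow hlk' hl2 (by linarith)) (Real.rpow_nonneg hlk' _) (by positivity)
    have E4 := hjoin j (l + 1) k (by omega) hlk hd
    have E5 := mul_le_mul_of_nonneg_left E2 (show 0 ≤ 1 + δ by linarith)
    have hBwD : 0 ≤ B * w j * D := by positivity
    have E6 := mul_le_mul_of_nonneg_right hkey hBwD
    calc e j k ≤ C * B * ((1 + 2 * δ) * w j) * (a * D) +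
          (1 + δ) * ((1 + δ) * (C * B * w j * (a * D)) + B * w j * D) + B * w j * D := by
          linarith
      _ = (C * a * ((1 + 2 * δ) + (1 + δ) ^ 2) + (2 + δ)) * (B * w j * D) := by ring
      _ ≤ C * (B * w j * D) := E6
      _ = _ := by ring

/-- Chaining of a bound which holds across short pieces and across single steps. -/
theorem chain_bound {τ w : ℕ → ℝ} (hw : ∀ j, 0 ≤ w j) {η Q : ℝ}
    (hη : 0 ≤ η) (hQ : 1 ≤ Q) (hstep : ∀ j, w (j + 1) ≤ Q * w j)
    (hshort : ∀ j k, j ≤ k → τ k - τ j ≤ η → w k ≤ Q * w j) (m : ℕ) :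
    ∀ j k, j ≤ k → τ k - τ j ≤ m * η → w k ≤ Q ^ (2 * m + 1) * w j := by
  have hQ0 : 0 ≤ Q := by linarith
  induction m with
  | zero =>
    intro j k hjk hd
    simpa using hshort j k hjk (by simp at hd; linarith)
  | succ m ih =>
    intro j k hjk hd
    rcases eq_or_lt_of_le hjk with rfl | hlt
    · exact le_mul_of_one_le_left (hw j) (one_le_pow₀ hQ)
    obtain ⟨l, h1, h2, h3, h4⟩ := exists_last_le (τ := τ) (c := m * η) (by positivity) hlt
    have h5 : w k ≤ Q * w (l + 1) := by
      rcases h4 with rfl | h4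
      · exact le_mul_of_one_le_left (hw _) hQ
      · refine hshort _ _ (by omega) ?_
        push_cast at hd; linarith
    have h6 := ih j l h1 h3
    calc w k ≤ Q * (Q * (Q ^ (2 * m + 1) * w j)) :=
          h5.trans (mul_le_mul_of_nonneg_left
            ((hstep l).trans (mul_le_mul_of_nonneg_left h6 hQ0)) hQ0)
      _ = _ := by ring

/-! ## Almost flows -/

theorem exists_pos_le_one_mul_rpow_le {κ : ℝ} (hκ : 0 < κ) (b : ℝ) {δ : ℝ} (hδ : 0 < δ) :
    ∃ η : ℝ, 0 < η ∧ η ≤ 1 ∧ b * η ^ κ ≤ δ := by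
  have h1 : Tendsto (fun η : ℝ => b * η ^ κ) (𝓝[>] 0) (𝓝 0) := by
    have h2 : Tendsto (fun η : ℝ => b * η ^ κ) (𝓝 0) (𝓝 (b * (0 : ℝ) ^ κ)) :=
      ((Real.continuousAt_rpow_const 0 κ (Or.inr hκ.le)).tendsto).const_mul b
    rw [Real.zero_rpow hκ.ne', mul_zero] at h2
    exact h2.mono_left nhdsWithin_le_nhds
  have h3 : ∀ᶠ η : ℝ in 𝓝[>] 0, b * η ^ κ ≤ δ := h1.eventually (eventually_le_nhds hδ)
  have h4 : ∀ᶠ η : ℝ in 𝓝[>] 0, η ≤ 1 :=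
    nhdsWithin_le_nhds (eventually_le_nhds (by norm_num))
  have h5 : ∀ᶠ η : ℝ in 𝓝[>] 0, 0 < η := eventually_mem_nhdsWithin
  obtain ⟨η, a, b, c⟩ := (h3.and (h4.and h5)).exists
  exact ⟨η, c, b, a⟩

variable {E : Type*} [NormedAddCommGroup E] {T : ℝ}

/-- Maps `m t s` on `E` which form a flow up to a defect of order `(t - s) ^ μ`. -/
structure AlmostFlow (m : Time T → Time T → E → E) (κ μ c : ℝ) : Prop where
  exp_pos : 0 < κ
  exp_le : κ ≤ μ
  exp_gt : 1 < μ
  nonneg : 0 ≤ c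
  self : ∀ t a, m t t a = a
  lip : ∀ t s : Time T, s ≤ t → ∀ a b,
    ‖m t s a - m t s b‖ ≤ (1 + c * ((t : ℝ) - s) ^ κ) * ‖a - b‖
  lip4 : ∀ t s : Time T, s ≤ t → ∀ x x' w w',
    ‖(m t s x - m t s x') - (m t s w - m t s w')‖ ≤
      (1 + c * ((t : ℝ) - s) ^ κ) * ‖(x - x') - (w - w')‖
        + c * ((t : ℝ) - s) ^ κ * (‖x - w‖ + ‖x' - w'‖) * ‖x - x'‖
  growth : ∀ t s : Time T, s ≤ t → ∀ a, ‖m t s a‖ ≤ ‖a‖ + c * ((t : ℝ) - s) ^ κ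
  defect : ∀ t u s : Time T, s ≤ u → u ≤ t → ∀ a,
    ‖m t u (m u s a) - m t s a‖ ≤ c * (1 + ‖a‖) * ((t : ℝ) - s) ^ μ
  defect4 : ∀ t u s : Time T, s ≤ u → u ≤ t → ∀ a b,
    ‖(m t u (m u s a) - m t s a) - (m t u (m u s b) - m t s b)‖ ≤
      c * (1 + ‖a‖ + ‖b‖) * ‖a - b‖ * ((t : ℝ) - s) ^ μ

/-- The Euler scheme of `m` along the times `τ`. -/
def euler {E : Type*} {T : ℝ} (m : Time T → Time T → E → E) (τ : ℕ → Time T) (a : E) : ℕ → E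
  | 0 => a
  | k + 1 => m (τ (k + 1)) (τ k) (euler m τ a k)

/-- The recursion adds a last step; removing the first step instead allows an induction that
restarts at the second time from another initial value. -/
theorem euler_succ' {E : Type*} {T : ℝ} (m : Time T → Time T → E → E) (τ : ℕ → Time T) (a : E) (k : ℕ) :
    euler m τ a (k + 1) = euler m (fun i => τ (i + 1)) (m (τ 1) (τ 0) a) k := by
  induction k with
  | zero => rfl
  | succ k ih => rw [euler, ih, euler]

namespace AlmostFlow

variable {m : Time T → Time T → E → E} {κ μ c : ℝ}

theorem time_sub_le (t s : Time T) : (t : ℝ) - s ≤ T := by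
  have := t.2.2; have := s.2.1; linarith

theorem time_nonneg (t : Time T) : 0 ≤ T := t.2.1.trans t.2.2

/-- Discrete sewing with weight 1 + ‖euler‖. The weight carries the linear growth of the defect, so
that no prior bound on the scheme is required; the bound is deduced from this estimate afterwards.
-/
theorem exists_euler_close (hm : AlmostFlow m κ μ c) :
    ∃ η : ℝ, 0 < η ∧ η ≤ 1 ∧ ∃ C : ℝ, 0 ≤ C ∧ ∀ τ : ℕ → Time T, Monotone τ → ∀ a, ∀ j k, j ≤ k →
      (τ k : ℝ) - τ j ≤ η →
      ‖euler m τ a k - m (τ k) (τ j) (euler m τ a j)‖ ≤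
        C * (1 + ‖euler m τ a j‖) * ((τ k : ℝ) - τ j) ^ μ := by
  obtain ⟨δ, hδ0, hδ1, C, hC0, hC⟩ := exists_discrete_sewing_constants hm.exp_gt
  have hc := hm.nonneg
  -- One η meets both requirements: (C c + c) η^μ ≤ δ for the sewing and c η^κ ≤ δ for the Lipschitz
  -- and growth factors.
  obtain ⟨η, hη0, hη1, hη⟩ := exists_pos_le_one_mul_rpow_le hm.exp_pos (C * c + c + c) hδ0
  have hημ : η ^ μ ≤ η ^ κ := Real.rpow_le_rpow_of_exponent_ge hη0 hη1 hm.exp_le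
  have hp0 : 0 ≤ η ^ κ := by positivity
  have hp1 : 0 ≤ C * c * η ^ κ := by positivity
  have hp2 : 0 ≤ c * η ^ κ := by positivity
  refine ⟨η, hη0, hη1, C * c, by positivity, ?_⟩
  intro τ hτ a j k hjk hd
  have hsmall : (C * c + c) * η ^ μ ≤ δ := by
    have := mul_le_mul_of_nonneg_left hημ (show 0 ≤ C * c + c by positivity)
    nlinarith
  have hcκ : ∀ j l, j ≤ l → (τ l : ℝ) - τ j ≤ η → c * ((τ l : ℝ) - τ j) ^ κ ≤ δ := by
    intro j l hjl h
    have h0 : (0 : ℝ) ≤ (τ l : ℝ) - τ j := sub_nonneg.2 (hτ hjl)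
    have := mul_le_mul_of_nonneg_left (Real.rpow_le_rpow h0 h hm.exp_pos.le) hc
    nlinarith
  refine hC c η hc hsmall (fun i => (τ i : ℝ)) (fun i => 1 + ‖euler m τ a i‖)
    (fun j k => ‖euler m τ a k - m (τ k) (τ j) (euler m τ a j)‖) (fun i j h => hτ h)
    (fun j => by positivity) (fun j => by simp [hm.self]) (fun j => by simp [euler]) ?_ ?_
    j k hjk hd
  · intro j l k hjl hlk hd
    have h1 := hm.lip (τ k) (τ l) (hτ hlk) (euler m τ a l) (m (τ l) (τ j) (euler m τ a j))
    have h2 := hm.defect (τ k) (τ l) (τ j) (hτ hjl) (hτ hlk) (euler m τ a j)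
    have h3 : (τ k : ℝ) - τ l ≤ η := by
      have : (τ j : ℝ) ≤ τ l := hτ hjl
      linarith
    have h4 := mul_le_mul_of_nonneg_right (add_le_add_right (hcκ l k hlk h3) 1)
      (norm_nonneg (euler m τ a l - m (τ l) (τ j) (euler m τ a j)))
    have h5 : euler m τ a k - m (τ k) (τ j) (euler m τ a j) =
        (euler m τ a k - m (τ k) (τ l) (euler m τ a l)) +
        (m (τ k) (τ l) (euler m τ a l) - m (τ k) (τ l) (m (τ l) (τ j) (euler m τ a j))) +
        (m (τ k) (τ l) (m (τ l) (τ j) (euler m τ a j)) - m (τ k) (τ j) (euler m τ a j)) := by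
      abel
    change ‖euler m τ a k - m (τ k) (τ j) (euler m τ a j)‖ ≤ _
    rw [h5]
    refine (norm_add₃_le).trans ?_
    linarith
  · intro j l hjl hd
    have h1 := hm.growth (τ l) (τ j) (hτ hjl) (euler m τ a j)
    have h2 := hcκ j l hjl hd
    have h3 : ‖euler m τ a l‖ ≤ ‖euler m τ a l - m (τ l) (τ j) (euler m τ a j)‖ +
        ‖m (τ l) (τ j) (euler m τ a j)‖ := by
      simpa using norm_add_le (euler m τ a l - m (τ l) (τ j) (euler m τ a j))
        (m (τ l) (τ j) (euler m τ a j))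
    change 1 + ‖euler m τ a l‖ ≤ (1 + δ) * (1 + ‖euler m τ a j‖) + _
    nlinarith [mul_nonneg hδ0.le (norm_nonneg (euler m τ a j))]

theorem exists_chain (T : ℝ) {η : ℝ} (hη : 0 < η) : ∃ M : ℕ, T ≤ M * η := by
  obtain ⟨M, hM⟩ := exists_nat_ge (T / η)
  exact ⟨M, (div_le_iff₀ hη).1 hM⟩

/-- On an interval of length η the quantity 1 + ‖euler‖ grows by a bounded factor, and about T / η
such intervals cover [0,T]. The number of partition points never enters. -/
theorem exists_euler_bound (hm : AlmostFlow m κ μ c) (R : ℝ) :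
    ∃ K : ℝ, 0 ≤ K ∧ ∀ τ : ℕ → Time T, Monotone τ → ∀ a, ‖a‖ ≤ R → ∀ k, ‖euler m τ a k‖ ≤ K := by
  obtain ⟨η, hη0, hη1, C, hC0, hC⟩ := hm.exists_euler_close
  obtain ⟨M, hM⟩ := exists_chain T hη0
  have hc := hm.nonneg
  -- Q bounds the growth factor both across one step of arbitrary length and across a block of
  -- length at most η ≤ 1.
  set Q : ℝ := 1 + c * T ^ κ + c + C with hQ
  -- For T < 0 there is no time at all and the claim is vacuous.
  by_cases hT : 0 ≤ T
  swap
  · exact ⟨0, le_rfl, fun τ => absurd (time_nonneg (τ 0)) hT⟩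
  have hTκ : 0 ≤ c * T ^ κ := by positivity
  have hQ1 : 1 ≤ Q := by linarith
  refine ⟨Q ^ (2 * M + 1) * (1 + |R|), by positivity, fun τ hτ a ha k => ?_⟩
  have key := chain_bound (τ := fun i => (τ i : ℝ)) (w := fun i => 1 + ‖euler m τ a i‖)
    (fun j => by positivity) hη0.le hQ1 ?_ ?_ M 0 k (Nat.zero_le _)
    ((time_sub_le _ _).trans hM)
  · have h1 : ‖a‖ ≤ |R| := ha.trans (le_abs_self R)
    have h2 : Q ^ (2 * M + 1) * (1 + ‖a‖) ≤ Q ^ (2 * M + 1) * (1 + |R|) :=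
      mul_le_mul_of_nonneg_left (by linarith) (by positivity)
    have h3 : euler m τ a 0 = a := rfl
    simp only [h3] at key
    linarith
  · intro j
    have h1 := hm.growth (τ (j + 1)) (τ j) (hτ (Nat.le_succ j)) (euler m τ a j)
    have h2 : ((τ (j + 1) : ℝ) - τ j) ^ κ ≤ T ^ κ :=
      Real.rpow_le_rpow (sub_nonneg.2 (hτ (Nat.le_succ j))) (time_sub_le _ _) hm.exp_pos.le
    have h3 := mul_le_mul_of_nonneg_left h2 hc
    have h4 := norm_nonneg (euler m τ a j)
    change 1 + ‖m (τ (j + 1)) (τ j) (euler m τ a j)‖ ≤ Q * (1 + ‖euler m τ a j‖)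
    nlinarith [mul_nonneg hTκ h4, mul_nonneg hc h4, mul_nonneg hC0 h4]
  · intro j l hjl hd
    have h0 : (0 : ℝ) ≤ (τ l : ℝ) - τ j := sub_nonneg.2 (hτ hjl)
    have h1 := hm.growth (τ l) (τ j) (hτ hjl) (euler m τ a j)
    have h2 := hC τ hτ a j l hjl hd
    have h3 : ‖euler m τ a l‖ ≤ ‖euler m τ a l - m (τ l) (τ j) (euler m τ a j)‖ +
        ‖m (τ l) (τ j) (euler m τ a j)‖ := by
      simpa using norm_add_le (euler m τ a l - m (τ l) (τ j) (euler m τ a j))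
        (m (τ l) (τ j) (euler m τ a j))
    have h4 : ((τ l : ℝ) - τ j) ^ κ ≤ 1 := Real.rpow_le_one h0 (hd.trans hη1) hm.exp_pos.le
    have h5 : ((τ l : ℝ) - τ j) ^ μ ≤ 1 :=
      Real.rpow_le_one h0 (hd.trans hη1) (by linarith [hm.exp_gt])
    have h6 := norm_nonneg (euler m τ a j)
    have h7 := mul_le_mul_of_nonneg_left h4 hc
    have h8 := mul_le_mul_of_nonneg_left h5 (show 0 ≤ C * (1 + ‖euler m τ a j‖) by positivity)
    change 1 + ‖euler m τ a l‖ ≤ Q * (1 + ‖euler m τ a j‖)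
    nlinarith [mul_nonneg hTκ h6, mul_nonneg hc h6]

-- Sewing again, now for the difference F of the errors of two schemes, weighted by the distance D
-- of the schemes. Plain Lipschitz bounds would not make F proportional to D; the four-point
-- conditions `lip4` and `defect4` do, once both schemes are confined to a ball of radius K.
set_option maxHeartbeats 1600000 in
theorem exists_euler_lipschitz (hm : AlmostFlow m κ μ c) (R : ℝ) :
    ∃ L : ℝ, 0 ≤ L ∧ ∀ τ : ℕ → Time T, Monotone τ → ∀ a b, ‖a‖ ≤ R → ‖b‖ ≤ R → ∀ k,
      ‖euler m τ a k - euler m τ b k‖ ≤ L * ‖a - b‖ := by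
  obtain ⟨K, hK0, hK⟩ := hm.exists_euler_bound R
  obtain ⟨η₁, hη10, hη11, C₁, hC10, hC₁⟩ := hm.exists_euler_close
  obtain ⟨δ, hδ0, hδ1, C, hC0, hC⟩ := exists_discrete_sewing_constants hm.exp_gt
  have hc := hm.nonneg
  by_cases hT : 0 ≤ T
  swap
  · exact ⟨0, le_rfl, fun τ => absurd (time_nonneg (τ 0)) hT⟩
  set A : ℝ := c * (C₁ * (1 + K)) with hA
  have hA0 : 0 ≤ A := by positivity
  -- The source terms of the sewing: 4A comes from the cross term of `lip4`, the rest from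
  -- `defect4`.
  set B : ℝ := 4 * A + c * (1 + K + K) with hB
  have hB0 : 0 ≤ B := by positivity
  obtain ⟨η, hη0, hη1, hη⟩ := exists_pos_le_one_mul_rpow_le hm.exp_pos (C * B + B + c + A) hδ0
  have hημ : η ^ μ ≤ η ^ κ := Real.rpow_le_rpow_of_exponent_ge hη0 hη1 hm.exp_le
  have hp0 : 0 ≤ η ^ κ := by positivity
  have hp1 : 0 ≤ (C * B + B) * η ^ κ := by positivity
  have hp2 : 0 ≤ c * η ^ κ := by positivity
  have hp3 : 0 ≤ A * η ^ κ := by positivity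
  have hsmall : (C * B + B) * η ^ μ ≤ δ := by
    have := mul_le_mul_of_nonneg_left hημ (show 0 ≤ C * B + B by positivity)
    nlinarith
  have hcA : c * η ^ κ + A * η ^ κ ≤ δ := by nlinarith
  set η' := min η η₁ with hη'
  have hη'0 : 0 < η' := lt_min hη0 hη10
  obtain ⟨M, hM⟩ := exists_chain T hη'0
  have hTκ : 0 ≤ c * T ^ κ := by positivity
  set Q : ℝ := 3 + c * T ^ κ with hQ
  refine ⟨Q ^ (2 * M + 1), by positivity, fun τ hτ a b ha hb k => ?_⟩
  set D : ℕ → E := fun i => euler m τ a i - euler m τ b i with hD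
  set F : ℕ → ℕ → E := fun j k => (euler m τ a k - m (τ k) (τ j) (euler m τ a j)) -
    (euler m τ b k - m (τ k) (τ j) (euler m τ b j)) with hF
  have hη'μ : (C * B + B) * η' ^ μ ≤ δ :=
    (mul_le_mul_of_nonneg_left (Real.rpow_le_rpow hη'0.le (min_le_left _ _)
      (by linarith [hm.exp_gt])) (by positivity)).trans hsmall
  have hpow : ∀ j l, j ≤ l → (τ l : ℝ) - τ j ≤ η' → ((τ l : ℝ) - τ j) ^ κ ≤ η ^ κ :=
    fun j l hjl h => Real.rpow_le_rpow (sub_nonneg.2 (hτ hjl)) (h.trans (min_le_left _ _))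
      hm.exp_pos.le
  have hcκ : ∀ j l, j ≤ l → (τ l : ℝ) - τ j ≤ η' → c * ((τ l : ℝ) - τ j) ^ κ ≤ c * η ^ κ :=
    fun j l hjl h => mul_le_mul_of_nonneg_left (hpow j l hjl h) hc
  have hmD : ∀ j l, j ≤ l → (τ l : ℝ) - τ j ≤ η' →
      ‖m (τ l) (τ j) (euler m τ a j) - m (τ l) (τ j) (euler m τ b j)‖ ≤
        (1 + c * η ^ κ) * ‖D j‖ := fun j l hjl h =>
    (hm.lip (τ l) (τ j) (hτ hjl) _ _).trans
      (mul_le_mul_of_nonneg_right (add_le_add_right (hcκ j l hjl h) 1) (norm_nonneg _))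
  have hDl : ∀ j l, j ≤ l → (τ l : ℝ) - τ j ≤ η' → ‖D l‖ ≤ ‖F j l‖ + (1 + c * η ^ κ) * ‖D j‖ := by
    intro j l hjl h
    have : D l = F j l + (m (τ l) (τ j) (euler m τ a j) - m (τ l) (τ j) (euler m τ b j)) := by
      simp only [hD, hF]; abel
    rw [this]
    exact (norm_add_le _ _).trans (add_le_add_right (hmD j l hjl h) _)
  -- the error of the differences is small on short intervals
  have hmain : ∀ ι : ℝ, 0 < ι → ∀ j k, j ≤ k → (τ k : ℝ) - τ j ≤ η' →
      ‖F j k‖ ≤ C * B * (‖D j‖ + ι) * ((τ k : ℝ) - τ j) ^ μ := by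
    intro ι hι
    refine hC B η' hB0 hη'μ (fun i => (τ i : ℝ)) (fun i => ‖D i‖ + ι)
      (fun j k => ‖F j k‖) (fun i j h => hτ h)
      (fun j => by positivity) (fun j => by simp [hF, hm.self]) (fun j => by simp [hF, euler]) ?_ ?_
    · intro j l k hjl hlk hd
      have hlk' : (τ k : ℝ) - τ l ≤ η' := by
        have : (τ j : ℝ) ≤ τ l := hτ hjl
        linarith
      have hjl' : (τ l : ℝ) - τ j ≤ η' := by
        have : (τ l : ℝ) ≤ τ k := hτ hlk
        linarith
      have h0 : (0 : ℝ) ≤ (τ l : ℝ) - τ j := sub_nonneg.2 (hτ hjl)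
      have h1 := hm.lip4 (τ k) (τ l) (hτ hlk) (euler m τ a l) (m (τ l) (τ j) (euler m τ a j))
        (euler m τ b l) (m (τ l) (τ j) (euler m τ b j))
      have h2 := hm.defect4 (τ k) (τ l) (τ j) (hτ hjl) (hτ hlk) (euler m τ a j) (euler m τ b j)
      have h3 := hC₁ τ hτ a j l hjl (hjl'.trans (min_le_right _ _))
      have h4 := hcκ l k hlk hlk'
      have h5 := hmD j l hjl hjl'
      have h6 := hDl j l hjl hjl'
      have hKa := hK τ hτ a ha j
      have hKb := hK τ hτ b hb j
      set d : ℝ := ((τ k : ℝ) - τ j) ^ μ with hdd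
      have hd0 : 0 ≤ d := Real.rpow_nonneg (sub_nonneg.2 (hτ (hjl.trans hlk))) _
      have h7 : ((τ l : ℝ) - τ j) ^ μ ≤ d :=
        Real.rpow_le_rpow h0 (by have : (τ l : ℝ) ≤ τ k := hτ hlk; linarith)
          (by linarith [hm.exp_gt])
      have hdη : d ≤ η ^ κ := by
        refine le_trans ?_ hημ
        exact Real.rpow_le_rpow (sub_nonneg.2 (hτ (hjl.trans hlk)))
          (hd.trans (min_le_left _ _)) (by linarith [hm.exp_gt])
      have hη1κ : η ^ κ ≤ 1 := Real.rpow_le_one hη0.le hη1 hm.exp_pos.le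
      have h8 : ‖euler m τ a l - m (τ l) (τ j) (euler m τ a j)‖ ≤ C₁ * (1 + K) * d :=
        h3.trans (mul_le_mul (mul_le_mul_of_nonneg_left (by linarith) hC10) h7
          (Real.rpow_nonneg h0 _) (by positivity))
      -- Telescoping: the error of the right block, the error of the left block propagated by one
      -- long step (`lip4`), and the defect of composing two long steps (`defect4`).
      have h9 : F j k = F l k +
          ((m (τ k) (τ l) (euler m τ a l) - m (τ k) (τ l) (m (τ l) (τ j) (euler m τ a j))) -
          (m (τ k) (τ l) (euler m τ b l) - m (τ k) (τ l) (m (τ l) (τ j) (euler m τ b j)))) +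
          ((m (τ k) (τ l) (m (τ l) (τ j) (euler m τ a j)) - m (τ k) (τ j) (euler m τ a j)) -
          (m (τ k) (τ l) (m (τ l) (τ j) (euler m τ b j)) - m (τ k) (τ j) (euler m τ b j))) := by
        simp only [hF]; abel
      have hcη : c * η ^ κ ≤ 1 := by linarith
      have hDj := norm_nonneg (D j)
      have hFj := norm_nonneg (F j l)
      have h10 : ‖D l‖ + ‖m (τ l) (τ j) (euler m τ a j) - m (τ l) (τ j) (euler m τ b j)‖ ≤
          ‖F j l‖ + 4 * ‖D j‖ := by
        have := mul_le_of_le_one_left hDj hcη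
        linarith
      -- The cross term of `lip4` contains the local error of one scheme, already of order d by
      -- `exists_euler_close`. It splits into a multiple of F absorbed by the factor 1 + δ and a
      -- source proportional to D.
      have hS : c * ((τ k : ℝ) - τ l) ^ κ *
          (‖D l‖ + ‖m (τ l) (τ j) (euler m τ a j) - m (τ l) (τ j) (euler m τ b j)‖) *
          ‖euler m τ a l - m (τ l) (τ j) (euler m τ a j)‖ ≤
          A * η ^ κ * ‖F j l‖ + 4 * A * ‖D j‖ * d := by
        have hk0 : 0 ≤ ((τ k : ℝ) - τ l) ^ κ := Real.rpow_nonneg (sub_nonneg.2 (hτ hlk)) _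
        have hk1 : ((τ k : ℝ) - τ l) ^ κ ≤ 1 := (hpow l k hlk hlk').trans hη1κ
        calc _ ≤ c * 1 * (‖F j l‖ + 4 * ‖D j‖) * (C₁ * (1 + K) * d) := by gcongr
          _ = A * d * ‖F j l‖ + 4 * A * ‖D j‖ * d := by rw [hA]; ring
          _ ≤ _ := by gcongr
      have hFl : (1 + c * ((τ k : ℝ) - τ l) ^ κ) * ‖F j l‖ ≤ (1 + c * η ^ κ) * ‖F j l‖ :=
        mul_le_mul_of_nonneg_right (by linarith) hFj
      have hdef : c * (1 + ‖euler m τ a j‖ + ‖euler m τ b j‖) * ‖D j‖ * d ≤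
          c * (1 + K + K) * ‖D j‖ * d := by gcongr
      have hιd : 0 ≤ B * ι * d := by positivity
      have hFδ : (c * η ^ κ + A * η ^ κ) * ‖F j l‖ ≤ δ * ‖F j l‖ :=
        mul_le_mul_of_nonneg_right hcA hFj
      change ‖F j k‖ ≤ ‖F l k‖ + (1 + δ) * ‖F j l‖ + B * (‖D j‖ + ι) * d
      have hBe : B * (‖D j‖ + ι) * d =
          4 * A * ‖D j‖ * d + c * (1 + K + K) * ‖D j‖ * d + B * ι * d := by rw [hB]; ring
      rw [hBe, h9]
      refine (norm_add₃_le).trans ?_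
      change _ ≤ (1 + c * ((τ k : ℝ) - τ l) ^ κ) * ‖F j l‖ + c * ((τ k : ℝ) - τ l) ^ κ *
          (‖D l‖ + ‖m (τ l) (τ j) (euler m τ a j) - m (τ l) (τ j) (euler m τ b j)‖) *
          ‖euler m τ a l - m (τ l) (τ j) (euler m τ a j)‖ at h1
      change _ ≤ c * (1 + ‖euler m τ a j‖ + ‖euler m τ b j‖) * ‖D j‖ * d at h2
      linarith
    · intro j l hjl hd
      have h6 := hDl j l hjl hd
      have : c * η ^ κ * ‖D j‖ ≤ δ * ‖D j‖ :=
        mul_le_mul_of_nonneg_right (by linarith) (norm_nonneg _)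
      change ‖D l‖ + ι ≤ (1 + δ) * (‖D j‖ + ι) + ‖F j l‖
      nlinarith [mul_pos hδ0 hι]
  have hfin : ∀ ι : ℝ, 0 < ι → ‖D k‖ + ι ≤ Q ^ (2 * M + 1) * (‖D 0‖ + ι) := by
    intro ι hι
    refine chain_bound (τ := fun i => (τ i : ℝ)) (w := fun i => ‖D i‖ + ι)
      (fun j => by positivity) hη'0.le (by linarith) ?_ ?_ M 0 k (Nat.zero_le _)
      ((time_sub_le _ _).trans hM)
    · intro j
      have h1 := hm.lip (τ (j + 1)) (τ j) (hτ (Nat.le_succ j)) (euler m τ a j) (euler m τ b j)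
      have h2 : ((τ (j + 1) : ℝ) - τ j) ^ κ ≤ T ^ κ :=
        Real.rpow_le_rpow (sub_nonneg.2 (hτ (Nat.le_succ j))) (time_sub_le _ _) hm.exp_pos.le
      have h3 := mul_le_mul_of_nonneg_right (mul_le_mul_of_nonneg_left h2 hc) (norm_nonneg (D j))
      change ‖D (j + 1)‖ + ι ≤ Q * (‖D j‖ + ι)
      change ‖D (j + 1)‖ ≤ (1 + c * ((τ (j + 1) : ℝ) - τ j) ^ κ) * ‖D j‖ at h1
      nlinarith [mul_nonneg hTκ hι.le, norm_nonneg (D j)]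
    · intro j l hjl hd
      have h6 := hDl j l hjl hd
      have h7 := hmain ι hι j l hjl hd
      have h8 : C * B * (‖D j‖ + ι) * ((τ l : ℝ) - τ j) ^ μ ≤ ‖D j‖ + ι := by
        have h0 : ((τ l : ℝ) - τ j) ^ μ ≤ η' ^ μ :=
          Real.rpow_le_rpow (sub_nonneg.2 (hτ hjl)) hd (by linarith [hm.exp_gt])
        have h1 : C * B * ((τ l : ℝ) - τ j) ^ μ ≤ 1 := by
          have := mul_le_mul_of_nonneg_left h0 (show 0 ≤ C * B by positivity)
          have h2 : 0 ≤ B * η' ^ μ := by positivity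
          nlinarith
        have := mul_le_mul_of_nonneg_right h1 (show 0 ≤ ‖D j‖ + ι by positivity)
        linarith
      have h9 : c * η ^ κ * ‖D j‖ ≤ 1 * ‖D j‖ :=
        mul_le_mul_of_nonneg_right (by linarith) (norm_nonneg _)
      change ‖D l‖ + ι ≤ Q * (‖D j‖ + ι)
      nlinarith [mul_nonneg hTκ (show 0 ≤ ‖D j‖ + ι by positivity)]
  change ‖D k‖ ≤ Q ^ (2 * M + 1) * ‖D 0‖
  refine le_of_forall_pos_le_add fun ε hε => ?_
  have hQp : 0 < Q ^ (2 * M + 1) := by positivity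
  have := hfin (ε / Q ^ (2 * M + 1)) (by positivity)
  rw [mul_add, mul_div_cancel₀ _ hQp.ne'] at this
  have h2 : 0 < ε / Q ^ (2 * M + 1) := by positivity
  linarith

/-- Stability of the Euler scheme. -/
theorem exists_euler_stability (hm : AlmostFlow m κ μ c) (R : ℝ) :
    ∃ L : ℝ, 0 ≤ L ∧ ∀ (e : ℝ) (k : ℕ) (τ : ℕ → Time T), Monotone τ → ∀ w : ℕ → E,
      (∀ i, ‖w i‖ ≤ R) →
      (∀ i, ‖w (i + 1) - m (τ (i + 1)) (τ i) (w i)‖ ≤ e) →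
      ‖w k - euler m τ (w 0) k‖ ≤ L * k * e := by
  -- The radius is enlarged because one step of the flow may leave the ball of radius R.
  obtain ⟨L, hL0, hL⟩ := hm.exists_euler_lipschitz (R + c * T ^ κ)
  have hc := hm.nonneg
  refine ⟨L, hL0, fun e k => ?_⟩
  induction k with
  | zero => intro τ _ w _ _; simp [euler]
  | succ k ih =>
    intro τ hτ w hw he
    have hT := time_nonneg (τ 0)
    have hTκ : 0 ≤ c * T ^ κ := by positivity
    have hτ' : Monotone fun i => τ (i + 1) := fun i j h => hτ (by omega)
    -- The path is compared with the scheme restarted from w 1, and that one with the scheme started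
    -- from w 0. After the first step the two initial values differ by at most e, which later steps
    -- multiply by at most L.
    have h1 := ih (fun i => τ (i + 1)) hτ' (fun i => w (i + 1)) (fun i => hw _) (fun i => he _)
    have h2 := hL (fun i => τ (i + 1)) hτ' (w 1) (m (τ 1) (τ 0) (w 0))
      ((hw 1).trans (by linarith)) ?_ k
    · rw [euler_succ']
      have h3 := norm_sub_le_norm_sub_add_norm_sub (w (k + 1))
        (euler m (fun i => τ (i + 1)) (w 1) k)
        (euler m (fun i => τ (i + 1)) (m (τ 1) (τ 0) (w 0)) k)
      have h4 := mul_le_mul_of_nonneg_left (he 0) hL0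
      push_cast
      simp only [zero_add] at h1 h4
      nlinarith
    · have h5 := hm.growth (τ 1) (τ 0) (hτ (Nat.zero_le 1)) (w 0)
      have h6 : ((τ 1 : ℝ) - τ 0) ^ κ ≤ T ^ κ :=
        Real.rpow_le_rpow (sub_nonneg.2 (hτ (Nat.zero_le 1))) (time_sub_le _ _) hm.exp_pos.le
      have := mul_le_mul_of_nonneg_left h6 hc
      linarith [hw 0]

end AlmostFlow

/-! ## Trajectories of almost flows -/

section Grid

variable {T : ℝ}

/-- The point of `[0,T]` which is closest to `k h`. -/
noncomputable def grid (hT : 0 ≤ T) (h : ℝ) (k : ℕ) : Time T := Set.projIcc 0 T hT (k * h)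

theorem grid_mono (hT : 0 ≤ T) {h : ℝ} (hh : 0 ≤ h) : Monotone (grid hT h) := fun i j hij =>
  Set.monotone_projIcc hT (mul_le_mul_of_nonneg_right (by exact_mod_cast hij) hh)

theorem grid_coe (hT : 0 ≤ T) {h : ℝ} {k : ℕ} (h0 : 0 ≤ h) (hk : k * h ≤ T) :
    (grid hT h k : ℝ) = k * h := by
  rw [grid, Set.projIcc_of_mem hT ⟨by positivity, hk⟩]

theorem grid_zero (hT : 0 ≤ T) (h : ℝ) : grid hT h 0 = ⟨0, le_refl 0, hT⟩ := by
  simp [grid, Set.projIcc_left]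

theorem grid_succ_sub_le (hT : 0 ≤ T) {h : ℝ} (hh : 0 ≤ h) (k : ℕ) :
    (grid hT h (k + 1) : ℝ) - grid hT h k ≤ h := by
  have h1 := (LipschitzWith.projIcc hT).dist_le_mul ((k + 1 : ℕ) * h) (k * h)
  rw [Subtype.dist_eq, Real.dist_eq, Real.dist_eq] at h1
  have h2 : ((k + 1 : ℕ) : ℝ) * h - k * h = h := by push_cast; ring
  rw [h2, abs_of_nonneg hh] at h1
  simpa [grid] using (le_abs_self _).trans h1

theorem grid_two_mul (hT : 0 ≤ T) (h : ℝ) (k : ℕ) : grid hT (h / 2) (2 * k) = grid hT h k := by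
  rw [grid, grid]; congr 1; push_cast; ring

end Grid

namespace AlmostFlow

variable {E : Type*} [NormedAddCommGroup E] {T : ℝ}
variable {m : Time T → Time T → E → E} {κ μ c : ℝ}

theorem continuous (hm : AlmostFlow m κ μ c) {t s : Time T} (hst : s ≤ t) :
    Continuous (m t s) := by
  have h0 : (0 : ℝ) ≤ (t : ℝ) - s := sub_nonneg.2 hst
  have hc := hm.nonneg
  refine (LipschitzWith.of_dist_le_mul (K := ⟨1 + c * ((t : ℝ) - s) ^ κ, by positivity⟩)
    fun a b => ?_).continuous
  rw [dist_eq_norm, dist_eq_norm]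
  exact hm.lip t s hst a b

/-- The Euler scheme converges to any trajectory of an almost flow. -/
theorem tendsto_euler (hm : AlmostFlow m κ μ c) (hT : 0 ≤ T) {z : Time T → E} {C ν : ℝ}
    (hν : 1 < ν) (hz : ∀ t s : Time T, s ≤ t → ‖z t - m t s (z s)‖ ≤ C * ((t : ℝ) - s) ^ ν)
    (t : Time T) :
    Tendsto (fun M : ℕ => euler m (grid hT (t / M)) (z ⟨0, le_refl 0, hT⟩) M) atTop
      (𝓝 (z t)) := by
  have hc := hm.nonneg
  set o : Time T := ⟨0, le_refl 0, hT⟩ with ho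
  have hTκ : 0 ≤ c * T ^ κ := by positivity
  have hCabs : ∀ t s : Time T, s ≤ t → ‖z t - m t s (z s)‖ ≤ |C| * ((t : ℝ) - s) ^ ν :=
    fun t s hst => (hz t s hst).trans (mul_le_mul_of_nonneg_right (le_abs_self C)
      (Real.rpow_nonneg (sub_nonneg.2 hst) _))
  have hb : ∀ t, ‖z t‖ ≤ ‖z o‖ + c * T ^ κ + |C| * T ^ ν := by
    intro t
    have hot : o ≤ t := t.2.1
    have h1 := hCabs t o hot
    have h2 := hm.growth t o hot (z o)
    have h0 : (0 : ℝ) ≤ (t : ℝ) - o := sub_nonneg.2 hot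
    have h3 := mul_le_mul_of_nonneg_left
      (Real.rpow_le_rpow h0 (time_sub_le t o) hm.exp_pos.le) hc
    have h4 := mul_le_mul_of_nonneg_left
      (Real.rpow_le_rpow h0 (time_sub_le t o) (by linarith : 0 ≤ ν)) (abs_nonneg C)
    have h5 : ‖z t‖ ≤ ‖z t - m t o (z o)‖ + ‖m t o (z o)‖ := by
      simpa using norm_add_le (z t - m t o (z o)) (m t o (z o))
    linarith
  obtain ⟨L, hL0, hL⟩ := hm.exists_euler_stability (‖z o‖ + c * T ^ κ + |C| * T ^ ν)
  have hbound : ∀ M : ℕ, 0 < M →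
      ‖euler m (grid hT (t / M)) (z o) M - z t‖ ≤ L * |C| * (t : ℝ) ^ ν * (M : ℝ) ^ (-(ν - 1)) := by
    intro M hM
    have hM' : (0 : ℝ) < M := by exact_mod_cast hM
    have ht0 : (0 : ℝ) ≤ t := t.2.1
    have hh : 0 ≤ (t : ℝ) / M := by positivity
    -- Sampled at M equidistant times, the trajectory is an Euler scheme with error (t/M)^ν per
    -- step, so M steps accumulate M^{1-ν}.
    have h1 := hL (|C| * ((t : ℝ) / M) ^ ν) M (grid hT (t / M)) (grid_mono hT hh)
      (fun i => z (grid hT (t / M) i)) (fun i => hb _) (fun i => by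
        refine (hCabs _ _ (grid_mono hT hh (Nat.le_succ i))).trans ?_
        exact mul_le_mul_of_nonneg_left (Real.rpow_le_rpow
          (sub_nonneg.2 (grid_mono hT hh (Nat.le_succ i)))
          (grid_succ_sub_le hT hh i) (by linarith)) (abs_nonneg C))
    have h2 : grid hT (t / M) M = t := by
      apply Subtype.ext
      have : (M : ℝ) * (t / M) = t := by field_simp
      rw [grid_coe hT hh (by rw [this]; exact t.2.2), this]
    rw [h2, grid_zero, norm_sub_rev] at h1
    refine h1.trans (le_of_eq ?_)
    rw [Real.div_rpow ht0 hM'.le, Real.rpow_neg hM'.le, Real.rpow_sub_one hM'.ne']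
    have : (M : ℝ) ^ ν ≠ 0 := by positivity
    field_simp
  rw [tendsto_iff_norm_sub_tendsto_zero]
  refine squeeze_zero' (Eventually.of_forall fun _ => norm_nonneg _)
    ((eventually_gt_atTop 0).mono hbound) ?_
  have h1 : Tendsto (fun M : ℕ => (M : ℝ) ^ (-(ν - 1))) atTop (𝓝 0) :=
    (tendsto_rpow_neg_atTop (by linarith : 0 < ν - 1)).comp tendsto_natCast_atTop_atTop
  simpa using h1.const_mul (L * |C| * (t : ℝ) ^ ν)

/-- Both trajectories are limits of the same Euler schemes, which depend on the initial value only;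
their error exponents may differ. -/
theorem trajectory_unique (hm : AlmostFlow m κ μ c) (hT : 0 ≤ T) {z z' : Time T → E}
    {C C' ν ν' : ℝ} (hν : 1 < ν) (hν' : 1 < ν')
    (hz : ∀ t s : Time T, s ≤ t → ‖z t - m t s (z s)‖ ≤ C * ((t : ℝ) - s) ^ ν)
    (hz' : ∀ t s : Time T, s ≤ t → ‖z' t - m t s (z' s)‖ ≤ C' * ((t : ℝ) - s) ^ ν')
    (h0 : z ⟨0, le_refl 0, hT⟩ = z' ⟨0, le_refl 0, hT⟩) : z = z' := by
  funext t
  have h1 := hm.tendsto_euler hT hν hz t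
  have h2 := hm.tendsto_euler hT hν' hz' t
  rw [h0] at h1
  exact tendsto_nhds_unique h1 h2

-- Two steps of a dyadic scheme differ from one step of the coarser scheme by a defect of order h^μ.
-- By stability the 2^n defects add up to 2^n h^μ, a geometric sequence since μ > 1, so the schemes
-- form a Cauchy sequence at each time.
set_option maxHeartbeats 1600000 in
theorem exists_trajectory [CompleteSpace E] (hm : AlmostFlow m κ μ c) (hT : 0 < T) (z₀ : E) :
    ∃ z : Time T → E, z ⟨0, le_refl 0, hT.le⟩ = z₀ ∧ ∃ C : ℝ, 0 ≤ C ∧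
      ∀ t s : Time T, s ≤ t → ‖z t - m t s (z s)‖ ≤ C * ((t : ℝ) - s) ^ μ := by
  have hc := hm.nonneg
  have hμ := hm.exp_gt
  have hTκ : 0 ≤ c * T ^ κ := by positivity
  obtain ⟨K, hK0, hK⟩ := hm.exists_euler_bound ‖z₀‖
  obtain ⟨L, hL0, hL⟩ := hm.exists_euler_stability K
  obtain ⟨η, hη0, hη1, C₁, hC10, hC₁⟩ := hm.exists_euler_close
  let h : ℕ → ℝ := fun n => T / 2 ^ n
  have hh : ∀ n, 0 < h n := fun n => by positivity
  have hhs : ∀ n, h (n + 1) = h n / 2 := fun n => by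
    simp only [h]; rw [pow_succ]; field_simp
  let g : ℕ → ℕ → Time T := fun n => grid hT.le (h n)
  have hgm : ∀ n, Monotone (g n) := fun n => grid_mono hT.le (hh n).le
  have hg2 : ∀ n k, g (n + 1) (2 * k) = g n k := fun n k => by
    simp only [g]; rw [hhs, grid_two_mul]
  let y : ℕ → ℕ → E := fun n => euler m (g n) z₀
  have hyK : ∀ n k, ‖y n k‖ ≤ K := fun n k => hK (g n) (hgm n) z₀ le_rfl k
  let fl : ℕ → Time T → ℕ := fun n t => ⌊(t : ℝ) / h n⌋₊
  have hfl1 : ∀ n (t : Time T), (fl n t : ℝ) * h n ≤ t := fun n t =>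
    (le_div_iff₀ (hh n)).1 (Nat.floor_le (div_nonneg t.2.1 (hh n).le))
  have hfl2 : ∀ n (t : Time T), (t : ℝ) < (fl n t + 1) * h n := fun n t =>
    (div_lt_iff₀ (hh n)).1 (Nat.lt_floor_add_one _)
  have hgfl : ∀ n (t : Time T), (g n (fl n t) : ℝ) = fl n t * h n := fun n t =>
    grid_coe hT.le (hh n).le ((hfl1 n t).trans t.2.2)
  have hgle : ∀ n (t : Time T), g n (fl n t) ≤ t := fun n t =>
    Subtype.coe_le_coe.1 (by rw [hgfl]; exact hfl1 n t)
  have hfl3 : ∀ n (t : Time T), fl (n + 1) t = 2 * fl n t ∨ fl (n + 1) t = 2 * fl n t + 1 := by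
    intro n t
    have h1 := hfl1 n t
    have h2 := hfl2 n t
    have h3 := hfl1 (n + 1) t
    have h4 := hfl2 (n + 1) t
    rw [hhs] at h3 h4
    have h5 : (2 * fl n t : ℝ) < fl (n + 1) t + 1 := by
      by_contra hcon
      have := mul_le_mul_of_nonneg_right (not_lt.1 hcon) (hh n).le
      nlinarith
    have h6 : (fl (n + 1) t : ℝ) < 2 * fl n t + 2 := by
      by_contra hcon
      have := mul_le_mul_of_nonneg_right (not_lt.1 hcon) (hh n).le
      nlinarith
    have h5' : 2 * fl n t < fl (n + 1) t + 1 := by exact_mod_cast h5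
    have h6' : fl (n + 1) t < 2 * fl n t + 2 := by exact_mod_cast h6
    omega
  -- The scheme runs up to the last grid point before t and is completed by one step to t, so Z is
  -- defined at every time.
  let Z : ℕ → Time T → E := fun n t => m t (g n (fl n t)) (y n (fl n t))
  -- one step of refinement
  set r : ℝ := (2 : ℝ) ^ (1 - μ) with hr
  have hr0 : 0 < r := by positivity
  have hr1 : r < 1 := Real.rpow_lt_one_of_one_lt_of_neg (by norm_num) (by linarith)
  have hhr : ∀ n, (2 : ℝ) ^ n * h n ^ μ = T ^ μ * r ^ n := by
    intro n
    simp only [h]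
    rw [Real.div_rpow hT.le (by positivity), hr, ← Real.rpow_natCast 2 n,
      ← Real.rpow_natCast _ n, ← Real.rpow_mul (by norm_num), ← Real.rpow_mul (by norm_num),
      div_eq_mul_inv, ← Real.rpow_neg (by norm_num), mul_left_comm,
      ← Real.rpow_add (by norm_num)]
    congr 2; ring
  have hhr' : ∀ n, h n ^ μ ≤ T ^ μ * r ^ n := by
    intro n
    rw [← hhr]
    exact le_mul_of_one_le_left (by have := hh n; positivity) (one_le_pow₀ (by norm_num))
  have hstep : ∀ n k, ‖y (n + 1) (2 * (k + 1)) - m (g n (k + 1)) (g n k) (y (n + 1) (2 * k))‖ ≤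
      c * (1 + K) * h n ^ μ := by
    intro n k
    have e1 : y (n + 1) (2 * (k + 1)) = m (g (n + 1) (2 * k + 2)) (g (n + 1) (2 * k + 1))
      (m (g (n + 1) (2 * k + 1)) (g (n + 1) (2 * k)) (y (n + 1) (2 * k))) := rfl
    have h1 := hm.defect (g (n + 1) (2 * k + 2)) (g (n + 1) (2 * k + 1)) (g (n + 1) (2 * k))
      (hgm _ (by omega)) (hgm _ (by omega)) (y (n + 1) (2 * k))
    have h2 : g (n + 1) (2 * k + 2) = g n (k + 1) := hg2 n (k + 1)
    rw [e1, ← h2, ← hg2 n k]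
    refine h1.trans ?_
    rw [h2, hg2]
    have h3 : (0 : ℝ) ≤ (g n (k + 1) : ℝ) - g n k := sub_nonneg.2 (hgm n (Nat.le_succ k))
    have h4 := grid_succ_sub_le hT.le (hh n).le k
    refine mul_le_mul (mul_le_mul_of_nonneg_left ?_ hc)
      (Real.rpow_le_rpow h3 h4 (by linarith)) (Real.rpow_nonneg h3 _) (by positivity)
    linarith [hyK (n + 1) (2 * k)]
  have hcomp : ∀ n k, k ≤ 2 ^ n →
      ‖y (n + 1) (2 * k) - y n k‖ ≤ L * (c * (1 + K) * T ^ μ) * r ^ n := by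
    intro n k hk
    have h1 := hL (c * (1 + K) * h n ^ μ) k (g n) (hgm n) (fun i => y (n + 1) (2 * i))
      (fun i => hyK _ _) (hstep n)
    have hk' : (k : ℝ) ≤ 2 ^ n := by exact_mod_cast hk
    have hhn := hh n
    calc _ ≤ L * k * (c * (1 + K) * h n ^ μ) := h1
      _ ≤ L * 2 ^ n * (c * (1 + K) * h n ^ μ) := by gcongr
      _ = L * (c * (1 + K)) * (2 ^ n * h n ^ μ) := by ring
      _ = _ := by rw [hhr]; ring
  have hfl4 : ∀ n (t : Time T), fl n t ≤ 2 ^ n := by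
    intro n t
    have h1 : (fl n t : ℝ) * h n ≤ 2 ^ n * h n := by
      refine ((hfl1 n t).trans t.2.2).trans (le_of_eq ?_)
      simp only [h]; field_simp
    exact_mod_cast le_of_mul_le_mul_right h1 (hh n)
  have hlipT : ∀ t s : Time T, s ≤ t → ∀ a b, ‖m t s a - m t s b‖ ≤ (1 + c * T ^ κ) * ‖a - b‖ := by
    intro t s hst a b
    refine (hm.lip t s hst a b).trans (mul_le_mul_of_nonneg_right ?_ (norm_nonneg _))
    have := mul_le_mul_of_nonneg_left
      (Real.rpow_le_rpow (sub_nonneg.2 hst) (time_sub_le t s) hm.exp_pos.le) hc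
    linarith
  set A : ℝ := c * (1 + K) * T ^ μ + (1 + c * T ^ κ) * (L * (c * (1 + K) * T ^ μ)) with hA
  have hZ : ∀ t n, ‖Z n t - Z (n + 1) t‖ ≤ A * r ^ n := by
    intro t n
    set k := fl n t with hk
    have h1 : ‖Z (n + 1) t - m t (g n k) (y (n + 1) (2 * k))‖ ≤ c * (1 + K) * (T ^ μ * r ^ n) := by
      rcases hfl3 n t with h2 | h2
      · have : Z (n + 1) t = m t (g n k) (y (n + 1) (2 * k)) := by
          change m t (g (n + 1) (fl (n + 1) t)) (y (n + 1) (fl (n + 1) t)) = _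
          rw [h2, hg2]
        rw [this, sub_self, norm_zero]; positivity
      · have h3 : g (n + 1) (2 * k + 1) ≤ t := by rw [← h2]; exact hgle (n + 1) t
        have h4 : Z (n + 1) t = m t (g (n + 1) (2 * k + 1))
            (m (g (n + 1) (2 * k + 1)) (g n k) (y (n + 1) (2 * k))) := by
          change m t (g (n + 1) (fl (n + 1) t)) (y (n + 1) (fl (n + 1) t)) = _
          rw [h2, ← hg2 n k]; rfl
        have h5 : g n k ≤ g (n + 1) (2 * k + 1) := by rw [← hg2]; exact hgm _ (by omega)
        rw [h4]
        refine (hm.defect t _ _ h5 h3 _).trans ?_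
        have h6 : (0 : ℝ) ≤ (t : ℝ) - g n k := sub_nonneg.2 (hgle n t)
        have h7 : (t : ℝ) - g n k ≤ h n := by rw [hgfl]; have := hfl2 n t; linarith
        refine mul_le_mul (mul_le_mul_of_nonneg_left ?_ hc)
          ((Real.rpow_le_rpow h6 h7 (by linarith)).trans (hhr' n)) (Real.rpow_nonneg h6 _)
          (by positivity)
        linarith [hyK (n + 1) (2 * k)]
    have h2 := hlipT t (g n k) (hgle n t) (y (n + 1) (2 * k)) (y n k)
    have h3 := hcomp n k (hfl4 n t)
    have h4 := norm_sub_le_norm_sub_add_norm_sub (Z (n + 1) t) (m t (g n k) (y (n + 1) (2 * k)))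
      (Z n t)
    have h5 := mul_le_mul_of_nonneg_left h3 (show 0 ≤ 1 + c * T ^ κ by positivity)
    rw [norm_sub_rev]
    change _ ≤ (c * (1 + K) * T ^ μ + (1 + c * T ^ κ) * (L * (c * (1 + K) * T ^ μ))) * r ^ n
    change _ ≤ (1 + c * T ^ κ) * _ at h2
    change ‖m t (g n k) (y (n + 1) (2 * k)) - Z n t‖ ≤ _ at h2
    linarith
  have hlim : ∀ t, ∃ z, Tendsto (fun n => Z n t) atTop (𝓝 z) := fun t =>
    cauchySeq_tendsto_of_complete
      (cauchySeq_of_le_geometric r A hr1 fun n => by rw [dist_eq_norm]; exact hZ t n)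
  choose z hz using hlim
  have hhlim : Tendsto h atTop (𝓝 0) := by
    have := (tendsto_pow_atTop_nhds_zero_of_lt_one (r := (1 / 2 : ℝ)) (by norm_num)
      (by norm_num)).const_mul T
    simpa [h, div_eq_mul_inv] using this
  have hZK : ∀ n (t : Time T), ‖Z n t‖ ≤ K + c * T ^ κ := by
    intro n t
    have h1 := hm.growth t _ (hgle n t) (y n (fl n t))
    have h2 := mul_le_mul_of_nonneg_left
      (Real.rpow_le_rpow (sub_nonneg.2 (hgle n t)) (time_sub_le t _) hm.exp_pos.le) hc
    linarith [hyK n (fl n t)]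
  have hzK : ∀ t, ‖z t‖ ≤ K + c * T ^ κ := fun t =>
    le_of_tendsto (hz t).norm (Eventually.of_forall fun n => hZK n t)
  set C₂ : ℝ := (1 + c * T ^ κ) * (C₁ * (1 + K)) + c * (1 + K) +
    (1 + c * T ^ κ) * (c * (1 + K)) + c * (1 + (K + c * T ^ κ)) with hC₂
  have hC20 : 0 ≤ C₂ := by positivity
  -- the estimate at short distances
  have hshort : ∀ t s : Time T, s < t → (t : ℝ) - s ≤ η →
      ‖z t - m t s (z s)‖ ≤ C₂ * ((t : ℝ) - s) ^ μ := by
    intro t s hst hd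
    have hst' : (0 : ℝ) < (t : ℝ) - s := sub_pos.2 hst
    have hconv : Tendsto (fun n => ‖Z n t - m t s (Z n s)‖) atTop (𝓝 ‖z t - m t s (z s)‖) :=
      ((hz t).sub (((hm.continuous hst.le).tendsto _).comp (hz s))).norm
    refine le_of_tendsto hconv ?_
    -- Once the mesh is smaller than t - s, a grid point lies between s and t.
    filter_upwards [hhlim.eventually (gt_mem_nhds hst')] with n hn
    set j := fl n s with hj
    set k := fl n t with hk
    set d : ℝ := ((t : ℝ) - s) ^ μ with hdd
    have hd0 : 0 ≤ d := Real.rpow_nonneg hst'.le _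
    have hjk : j + 1 ≤ k := by
      have h1 := hfl1 n s
      have h2 := hfl2 n t
      have h3 : ((j : ℝ) + 1) * h n < (k + 1) * h n := by nlinarith
      have h4 : ((j : ℝ) + 1) < k + 1 := lt_of_mul_lt_mul_right h3 (hh n).le
      have : j + 1 < k + 1 := by exact_mod_cast h4
      omega
    have hkt : g n k ≤ t := hgle n t
    have hjs : g n j ≤ s := hgle n s
    have hj1k : g n (j + 1) ≤ g n k := hgm n hjk
    have hj1T : ((j + 1 : ℕ) : ℝ) * h n ≤ T := by
      have h1 : ((j + 1 : ℕ) : ℝ) ≤ k := by exact_mod_cast hjk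
      have h2 := mul_le_mul_of_nonneg_right h1 (hh n).le
      have h3 := (hfl1 n t).trans t.2.2
      linarith
    have hj1 : (g n (j + 1) : ℝ) = (j + 1) * h n := by
      have := grid_coe hT.le (hh n).le hj1T
      simpa [g] using this
    have hsj1 : s ≤ g n (j + 1) := Subtype.coe_le_coe.1 (by rw [hj1]; exact (hfl2 n s).le)
    have hmono : ∀ a b : Time T, s ≤ a → a ≤ b → b ≤ t → ((b : ℝ) - a) ^ μ ≤ d := by
      intro a b h1 h2 h3
      refine Real.rpow_le_rpow (sub_nonneg.2 h2) ?_ (by linarith)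
      have h1' : (s : ℝ) ≤ a := h1
      have h3' : (b : ℝ) ≤ t := h3
      linarith
    have hZt : Z n t = m t (g n k) (y n k) := rfl
    have hZs : Z n s = m s (g n j) (y n j) := rfl
    have hyj1 : y n (j + 1) = m (g n (j + 1)) (g n j) (y n j) := rfl
    -- Four comparisons lead from Z n t to m t s (Z n s): the scheme between grid points becomes one
    -- step, this step is merged with the one reaching t, the value at the first grid point after s
    -- is recomputed from Z n s, and the two steps from s to t are merged. The bounds do not depend
    -- on n.
    have e1 : ‖m t (g n k) (y n k) - m t (g n k) (m (g n k) (g n (j + 1)) (y n (j + 1)))‖ ≤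
        (1 + c * T ^ κ) * (C₁ * (1 + K)) * d := by
      refine (hlipT t _ hkt _ _).trans ?_
      rw [mul_assoc]
      refine mul_le_mul_of_nonneg_left ?_ (by positivity)
      refine (hC₁ (g n) (hgm n) z₀ (j + 1) k hjk ?_).trans ?_
      · have h1 : (s : ℝ) ≤ g n (j + 1) := hsj1
        have h2 : (g n k : ℝ) ≤ t := hkt
        linarith
      · refine mul_le_mul (mul_le_mul_of_nonneg_left ?_ hC10) (hmono _ _ hsj1 hj1k hkt)
          (Real.rpow_nonneg (sub_nonneg.2 hj1k) _) (by positivity)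
        have : ‖euler m (g n) z₀ (j + 1)‖ ≤ K := hyK n (j + 1)
        linarith
    have e2 : ‖m t (g n k) (m (g n k) (g n (j + 1)) (y n (j + 1))) -
        m t (g n (j + 1)) (y n (j + 1))‖ ≤ c * (1 + K) * d := by
      refine (hm.defect t _ _ hj1k hkt _).trans ?_
      refine mul_le_mul (mul_le_mul_of_nonneg_left ?_ hc) (hmono _ _ hsj1 (hj1k.trans hkt) le_rfl)
          (Real.rpow_nonneg (sub_nonneg.2 (hj1k.trans hkt)) _) (by positivity)
      linarith [hyK n (j + 1)]
    have e3 : ‖m t (g n (j + 1)) (y n (j + 1)) -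
        m t (g n (j + 1)) (m (g n (j + 1)) s (Z n s))‖ ≤ (1 + c * T ^ κ) * (c * (1 + K)) * d := by
      refine (hlipT t _ (hj1k.trans hkt) _ _).trans ?_
      rw [mul_assoc]
      refine mul_le_mul_of_nonneg_left ?_ (by positivity)
      rw [norm_sub_rev, hZs, hyj1]
      refine (hm.defect _ s _ hjs hsj1 _).trans ?_
      have h1 : (0 : ℝ) ≤ (g n (j + 1) : ℝ) - g n j := sub_nonneg.2 (hjs.trans hsj1)
      have h2 : (g n (j + 1) : ℝ) - g n j ≤ (t : ℝ) - s :=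
        (grid_succ_sub_le hT.le (hh n).le j).trans hn.le
      refine mul_le_mul (mul_le_mul_of_nonneg_left ?_ hc)
        (Real.rpow_le_rpow h1 h2 (by linarith)) (Real.rpow_nonneg h1 _) (by positivity)
      linarith [hyK n j]
    have e4 : ‖m t (g n (j + 1)) (m (g n (j + 1)) s (Z n s)) - m t s (Z n s)‖ ≤
        c * (1 + (K + c * T ^ κ)) * d := by
      refine (hm.defect t _ _ hsj1 (hj1k.trans hkt) _).trans ?_
      refine mul_le_mul_of_nonneg_right (mul_le_mul_of_nonneg_left ?_ hc) hd0
      linarith [hZK n s]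
    rw [hZt]
    have n1 := norm_sub_le_norm_sub_add_norm_sub (m t (g n k) (y n k))
      (m t (g n k) (m (g n k) (g n (j + 1)) (y n (j + 1)))) (m t s (Z n s))
    have n2 := norm_sub_le_norm_sub_add_norm_sub
      (m t (g n k) (m (g n k) (g n (j + 1)) (y n (j + 1))))
      (m t (g n (j + 1)) (y n (j + 1))) (m t s (Z n s))
    have n3 := norm_sub_le_norm_sub_add_norm_sub (m t (g n (j + 1)) (y n (j + 1)))
      (m t (g n (j + 1)) (m (g n (j + 1)) s (Z n s))) (m t s (Z n s))
    rw [hC₂]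
    linarith
  -- The second term of the constant handles t - s > η, where boundedness of z suffices because (t -
  -- s)^μ ≥ η^μ.
  refine ⟨z, ?_, C₂ + (2 * (K + c * T ^ κ) + c * T ^ κ) / η ^ μ, by positivity, ?_⟩
  · refine tendsto_nhds_unique (hz _) ?_
    have : ∀ n, Z n ⟨0, le_refl 0, hT.le⟩ = z₀ := by
      intro n
      have h1 : fl n ⟨0, le_refl 0, hT.le⟩ = 0 := by simp [fl]
      change m _ (g n (fl n _)) (y n (fl n _)) = z₀
      rw [h1]
      change m _ (grid hT.le (h n) 0) z₀ = z₀
      rw [grid_zero, hm.self]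
    simp [this]
  · intro t s hst
    rcases eq_or_lt_of_le hst with rfl | hlt
    · rw [hm.self, sub_self, norm_zero, sub_self]
      have : (0 : ℝ) ≤ (0 : ℝ) ^ μ := Real.rpow_nonneg le_rfl _
      positivity
    have h0 : (0 : ℝ) ≤ (t : ℝ) - s := sub_nonneg.2 hst
    have hp : 0 ≤ ((t : ℝ) - s) ^ μ := Real.rpow_nonneg h0 _
    rcases le_or_gt ((t : ℝ) - s) η with hd | hd
    · refine (hshort t s hlt hd).trans (mul_le_mul_of_nonneg_right ?_ hp)
      have : 0 ≤ (2 * (K + c * T ^ κ) + c * T ^ κ) / η ^ μ := by positivity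
      linarith
    · have h1 : ‖z t - m t s (z s)‖ ≤ 2 * (K + c * T ^ κ) + c * T ^ κ := by
        have h2 := hm.growth t s hst (z s)
        have h3 := mul_le_mul_of_nonneg_left
          (Real.rpow_le_rpow h0 (time_sub_le t s) hm.exp_pos.le) hc
        have h4 := norm_sub_le (z t) (m t s (z s))
        linarith [hzK t, hzK s]
      have h2 : η ^ μ ≤ ((t : ℝ) - s) ^ μ := Real.rpow_le_rpow hη0.le hd.le (by linarith)
      have h3 : 0 < η ^ μ := by positivity
      calc _ ≤ 2 * (K + c * T ^ κ) + c * T ^ κ := h1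
        _ = (2 * (K + c * T ^ κ) + c * T ^ κ) / η ^ μ * η ^ μ := by field_simp
        _ ≤ (2 * (K + c * T ^ κ) + c * T ^ κ) / η ^ μ * ((t : ℝ) - s) ^ μ := by gcongr
        _ ≤ _ := by
          refine mul_le_mul_of_nonneg_right ?_ hp
          linarith

end AlmostFlow

/-! ## Translations and convolutions in `L^p` -/

section Convolution

variable {n p : ℕ} [Fact (1 ≤ (p : ℝ≥0∞))]

/-- The translation `φ ↦ φ(· - w)` of `L^p`. -/
noncomputable def translate (w : Space n) : LpSpace n p →ₗᵢ[ℝ] LpSpace n p :=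
  Lp.compMeasurePreservingₗᵢ ℝ (fun ξ => ξ - w) (measurePreserving_sub_right volume w)

theorem coeFn_translate (w : Space n) (φ : LpSpace n p) :
    translate w φ =ᵐ[volume] fun ξ => φ (ξ - w) :=
  Lp.coeFn_compMeasurePreserving φ (measurePreserving_sub_right volume w)

theorem translate_translate (w v : Space n) (φ : LpSpace n p) :
    translate w (translate v φ) = translate (w + v) φ := by
  apply Lp.ext
  have h1 := coeFn_translate w (translate v φ)
  have h2 := (measurePreserving_sub_right volume w).quasiMeasurePreserving.ae_eq_comp
    (coeFn_translate v φ)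
  have h3 := coeFn_translate (w + v) φ
  filter_upwards [h1, h2, h3] with ξ e1 e2 e3
  rw [e1, e3]
  simp only [Function.comp_apply] at e2
  rw [e2, sub_sub]

theorem translate_zero (φ : LpSpace n p) : translate 0 φ = φ := by
  apply Lp.ext
  filter_upwards [coeFn_translate 0 φ] with ξ e
  rw [e, sub_zero]

theorem continuous_translate (φ : LpSpace n p) : Continuous fun w : Space n => translate w φ := by
  have hg : Continuous fun w : Space n => (⟨fun ξ => ξ - w, by fun_prop⟩ : C(Space n, Space n)) := by
    apply ContinuousMap.continuous_of_continuous_uncurry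
    simp only [Function.uncurry_def, ContinuousMap.coe_mk]
    fun_prop
  exact (continuous_const (y := φ)).compMeasurePreservingLp hg
    (fun w => measurePreserving_sub_right volume w) (ENNReal.natCast_ne_top p)

instance fact_one_le_conjExponent : Fact (1 ≤ ENNReal.conjExponent (p : ℝ≥0∞)) :=
  ⟨ENNReal.HolderConjugate.one_le _ (p : ℝ≥0∞)⟩

/-- The pairing of `L^p` with a function in the dual space. -/
noncomputable def pairing {u : Space n → ℝ} (hu : MemLp u (ENNReal.conjExponent p) volume) :
    LpSpace n p →L[ℝ] ℝ :=
  ((ContinuousLinearMap.mul ℝ ℝ).lpPairing volume (p : ℝ≥0∞) (ENNReal.conjExponent p)).flip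
    (hu.toLp u)

theorem pairing_apply {u : Space n → ℝ} (hu : MemLp u (ENNReal.conjExponent p) volume)
    (φ : LpSpace n p) : pairing hu φ = ∫ ξ, φ ξ * u ξ := by
  rw [pairing, ContinuousLinearMap.flip_apply, ContinuousLinearMap.lpPairing_eq_integral]
  refine integral_congr_ae ?_
  filter_upwards [hu.coeFn_toLp] with ξ e
  simp [e]

/-- Convolution with an integrable kernel. -/
noncomputable def kconv (k : Space n → ℝ) (φ : LpSpace n p) : LpSpace n p :=
  ∫ w, k w • translate w φ

variable {k : Space n → ℝ}

theorem integrable_kconv (hk : Integrable k) (φ : LpSpace n p) :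
    Integrable fun w => k w • translate w φ := by
  refine Integrable.mono' (hk.norm.mul_const ‖φ‖)
    (hk.aestronglyMeasurable.smul (continuous_translate φ).aestronglyMeasurable)
    (Eventually.of_forall fun w => ?_)
  rw [norm_smul, LinearIsometry.norm_map]

theorem norm_kconv_le (k : Space n → ℝ) (φ : LpSpace n p) :
    ‖kconv k φ‖ ≤ (∫ w, |k w|) * ‖φ‖ := by
  refine (norm_integral_le_integral_norm _).trans (le_of_eq ?_)
  rw [← integral_mul_const]
  simp only [norm_smul, LinearIsometry.norm_map, Real.norm_eq_abs]

theorem kconv_add (hk : Integrable k) (φ χ : LpSpace n p) :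
    kconv k (φ + χ) = kconv k φ + kconv k χ := by
  simp only [kconv, map_add, smul_add]
  exact integral_add (integrable_kconv hk φ) (integrable_kconv hk χ)

theorem kconv_smul (k : Space n → ℝ) (r : ℝ) (φ : LpSpace n p) :
    kconv k (r • φ) = r • kconv k φ := by
  simp only [kconv, map_smul, smul_comm _ r]
  exact integral_smul r _

/-- Convolution with an integrable kernel, as a continuous linear map. -/
noncomputable def kconvL (hk : Integrable k) : LpSpace n p →L[ℝ] LpSpace n p :=
  LinearMap.mkContinuous ⟨⟨kconv k, kconv_add hk⟩, kconv_smul k⟩ (∫ w, |k w|) (norm_kconv_le k)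

theorem kconvL_apply (hk : Integrable k) (φ : LpSpace n p) : kconvL hk φ = kconv k φ := rfl

omit [Fact (1 ≤ (p : ℝ≥0∞))] in
theorem measurable_coeFn (φ : LpSpace n p) : Measurable (φ : Space n → ℝ) :=
  (Lp.stronglyMeasurable φ).measurable

/-- Integrability for the exchange of the convolution and the pairing. -/
theorem integrable_prod_kernel {a b : ℝ≥0∞} [a.HolderConjugate b] {k f u : Space n → ℝ}
    (hk : Integrable k) (hkm : Measurable k) (hf : MemLp f a volume) (hfm : Measurable f)
    (hu : MemLp u b volume) (hum : Measurable u) {ι : Space n → Space n} (hι : Measurable ι) :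
    Integrable (fun z : Space n × Space n => k z.1 * (f (z.2 + ι z.1) * u z.2))
      (volume.prod volume) := by
  have hmeas : Measurable fun z : Space n × Space n => k z.1 * (f (z.2 + ι z.1) * u z.2) :=
    (hkm.comp measurable_fst).mul
      ((hfm.comp (measurable_snd.add (hι.comp measurable_fst))).mul (hum.comp measurable_snd))
  have hft : ∀ w, MemLp (fun ξ => f (ξ + ι w)) a volume := fun w =>
    hf.comp_measurePreserving (measurePreserving_add_right volume (ι w))
  have hnft : ∀ w, eLpNorm (fun ξ => f (ξ + ι w)) a volume = eLpNorm f a volume := fun w =>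
    eLpNorm_comp_measurePreserving hf.1 (measurePreserving_add_right volume (ι w))
  have hint : ∀ w, Integrable fun ξ => f (ξ + ι w) * u ξ := fun w =>
    memLp_one_iff_integrable.1 (hu.mul' (hft w))
  rw [integrable_prod_iff hmeas.aestronglyMeasurable]
  refine ⟨Eventually.of_forall fun w => (hint w).const_mul (k w), ?_⟩
  -- Hölder's inequality, uniform in w because translations preserve the norm of f.
  have hbound : ∀ w, ∫ ξ, ‖f (ξ + ι w) * u ξ‖ ≤
      (eLpNorm f a volume * eLpNorm u b volume).toReal := by
    intro w
    have h1 : eLpNorm (fun ξ => f (ξ + ι w) * u ξ) 1 volume ≤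
        eLpNorm f a volume * eLpNorm u b volume := by
      have h2 := eLpNorm_smul_le_mul_eLpNorm (p := a) (q := b) (r := 1) hu.1 (hft w).1
      rw [hnft w] at h2
      exact h2
    rw [integral_norm_eq_lintegral_enorm (hint w).1, ← eLpNorm_one_eq_lintegral_enorm]
    exact ENNReal.toReal_mono (ENNReal.mul_ne_top hf.eLpNorm_ne_top hu.eLpNorm_ne_top) h1
  refine Integrable.mono' (hk.norm.mul_const (eLpNorm f a volume * eLpNorm u b volume).toReal)
    (hmeas.norm.stronglyMeasurable.integral_prod_right').aestronglyMeasurable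
    (Eventually.of_forall fun w => ?_)
  have h1 : ∀ ξ, ‖k w * (f (ξ + ι w) * u ξ)‖ = ‖k w‖ * ‖f (ξ + ι w) * u ξ‖ := fun ξ => norm_mul _ _
  simp only [h1]
  rw [integral_const_mul, Real.norm_of_nonneg
    (mul_nonneg (norm_nonneg _) (integral_nonneg fun _ => norm_nonneg _))]
  exact mul_le_mul_of_nonneg_left (hbound w) (norm_nonneg _)

theorem pairing_kconv (hk : Integrable k) {u : Space n → ℝ}
    (hu : MemLp u (ENNReal.conjExponent p) volume) (φ : LpSpace n p) :
    pairing hu (kconv k φ) = ∫ w, k w * ∫ ξ, φ (ξ - w) * u ξ := by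
  rw [kconv, ← ContinuousLinearMap.integral_comp_comm _ (integrable_kconv hk φ)]
  congr 1
  funext w
  rw [map_smul, pairing_apply, smul_eq_mul]
  congr 1
  refine integral_congr_ae ?_
  filter_upwards [coeFn_translate w φ] with ξ e
  rw [e]

/-- Fubini moves the kernel onto the test function, where derivatives of u can be traded for
derivatives of the kernel. -/
theorem pairing_kconv' (hk : Integrable k) (hkm : Measurable k) {u : Space n → ℝ}
    (hu : MemLp u (ENNReal.conjExponent p) volume) (hum : Measurable u) (φ : LpSpace n p) :
    pairing hu (kconv k φ) = ∫ ξ, φ ξ * ∫ w, k w * u (ξ + w) := by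
  rw [pairing_kconv hk hu]
  have h1 : ∀ w, ∫ ξ, φ (ξ - w) * u ξ = ∫ ξ, φ ξ * u (ξ + w) := by
    intro w
    rw [← integral_add_right_eq_self _ w]
    simp
  simp only [h1]
  have h2 := integrable_prod_kernel (a := ENNReal.conjExponent p) (b := (p : ℝ≥0∞)) hk hkm hu hum
    (Lp.memLp φ) (measurable_coeFn φ) (ι := fun w => w) measurable_id
  calc ∫ w, k w * ∫ ξ, φ ξ * u (ξ + w) = ∫ w, ∫ ξ, k w * (u (ξ + w) * φ ξ) := by
        congr 1; funext w; rw [← integral_const_mul]; congr 1; funext ξ; ring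
    _ = ∫ ξ, ∫ w, k w * (u (ξ + w) * φ ξ) := integral_integral_swap h2
    _ = _ := by
        congr 1; funext ξ; rw [← integral_const_mul]; congr 1; funext w; ring

/-- The Bochner convolution is the pointwise convolution. -/
theorem coeFn_kconv (hk : Integrable k) (hkm : Measurable k) (φ : LpSpace n p) :
    kconv k φ =ᵐ[volume] fun ξ => ∫ η, k (ξ - η) * φ η := by
  have hform : ∀ ξ, ∫ η, k (ξ - η) * φ η = ∫ w, k w * φ (ξ - w) := fun ξ => by
    rw [← integral_sub_left_eq_self (fun w => k w * φ (ξ - w)) volume ξ]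
    simp
  have hind : ∀ s : Set (Space n), MeasurableSet s → volume s < ∞ →
      MemLp (s.indicator fun _ => (1 : ℝ)) (ENNReal.conjExponent p) volume := fun s hs hμ =>
    memLp_indicator_const _ hs _ (Or.inr hμ.ne)
  have hprod : ∀ s : Set (Space n), MeasurableSet s → volume s < ∞ →
      Integrable (fun z : Space n × Space n =>
        k z.1 * (φ (z.2 + -z.1) * s.indicator (fun _ => (1 : ℝ)) z.2)) (volume.prod volume) :=
    fun s hs hμ => integrable_prod_kernel hk hkm (Lp.memLp φ) (measurable_coeFn φ) (hind s hs hμ)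
      (measurable_const.indicator hs) (ι := fun w => -w) measurable_neg
  have hinner : ∀ s : Set (Space n), ∀ ξ,
      ∫ w, k w * (φ (ξ + -w) * s.indicator (fun _ => (1 : ℝ)) ξ) =
        s.indicator (fun ξ => ∫ η, k (ξ - η) * φ η) ξ := by
    intro s ξ
    by_cases h : ξ ∈ s
    · rw [indicator_of_mem h (fun ξ => ∫ η, k (ξ - η) * φ η), hform]; simp only [indicator_of_mem h, mul_one, sub_eq_add_neg]
    · simp [indicator_of_notMem h]
  -- Integrals over sets of finite measure are compared: each is a pairing with an indicator, which
  -- commutes with the Bochner integral, and Fubini does the rest.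
  refine ae_eq_of_forall_setIntegral_eq_of_sigmaFinite ?_ ?_ ?_
  · intro s hs hμ
    have h1 := (Lp.memLp (kconv k φ)).integrable_mul (hind s hs hμ)
    rw [← integrable_indicator_iff hs]
    refine h1.congr (Eventually.of_forall fun ξ => ?_)
    by_cases h : ξ ∈ s <;> simp [h]
  · intro s hs hμ
    rw [← integrable_indicator_iff hs]
    refine (hprod s hs hμ).integral_prod_right.congr (Eventually.of_forall fun ξ => ?_)
    exact hinner s ξ
  · intro s hs hμ
    have h1 := pairing_kconv hk (hind s hs hμ) φ
    rw [pairing_apply] at h1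
    rw [← integral_indicator hs, ← integral_indicator hs]
    have h2 : ∀ ξ, s.indicator (kconv k φ) ξ = kconv k φ ξ * s.indicator (fun _ => (1 : ℝ)) ξ := by
      intro ξ; by_cases h : ξ ∈ s <;> simp [h]
    simp only [h2]
    rw [h1, ← integral_congr_ae (Eventually.of_forall (hinner s)),
      ← integral_integral_swap (hprod s hs hμ)]
    congr 1; funext w; rw [← integral_const_mul]; simp only [sub_eq_add_neg]

/-- Composition of convolutions. -/
theorem kconv_kconv {k l : Space n → ℝ} (hk : Integrable k) (hkm : Measurable k)
    (hl : Integrable l) (hlm : Measurable l) (φ : LpSpace n p) :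
    kconv k (kconv l φ) = kconv (fun v => ∫ w, k w * l (v - w)) φ := by
  have hm : AEStronglyMeasurable (fun z : Space n × Space n =>
      (k z.1 * l (z.2 - z.1)) • translate z.2 φ) (volume.prod volume) :=
    (((hkm.comp measurable_fst).mul
      (hlm.comp (measurable_snd.sub measurable_fst))).aestronglyMeasurable).smul
      ((continuous_translate φ).comp continuous_snd).aestronglyMeasurable
  have hint : Integrable (fun z : Space n × Space n =>
      (k z.1 * l (z.2 - z.1)) • translate z.2 φ) (volume.prod volume) := by
    rw [integrable_prod_iff hm]
    constructor
    · refine Eventually.of_forall fun w => ?_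
      simp only [mul_smul]
      exact (integrable_kconv (hl.comp_sub_right w) φ).smul (k w)
    · have : ∀ w, ∫ v, ‖(k w * l (v - w)) • translate v φ‖ = ‖k w‖ * ((∫ v, ‖l v‖) * ‖φ‖) := by
        intro w
        simp only [norm_smul, LinearIsometry.norm_map, norm_mul]
        rw [integral_mul_const, integral_const_mul,
          integral_sub_right_eq_self (fun v => ‖l v‖) w]
        ring
      simp only [this]
      exact hk.norm.mul_const _
  calc kconv k (kconv l φ) = ∫ w, ∫ v, (k w * l (v - w)) • translate v φ := by
        rw [kconv]
        congr 1
        funext w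
        rw [kconv, ← LinearIsometry.coe_toContinuousLinearMap,
          ← ContinuousLinearMap.integral_comp_comm _ (integrable_kconv hl φ), ← integral_smul,
          ← integral_sub_right_eq_self _ w]
        congr 1
        funext v
        simp only [LinearIsometry.coe_toContinuousLinearMap, map_smul, translate_translate,
          mul_smul, add_sub_cancel]
    _ = ∫ v, ∫ w, (k w * l (v - w)) • translate v φ := integral_integral_swap hint
    _ = _ := by
        rw [kconv]
        congr 1
        funext v
        exact integral_smul_const _ _

end Convolution

/-! ## The heat kernel -/

section Gaussian

variable {n : ℕ}

/-- A non-integrable function has Bochner integral 0, whereas the Gaussian formula gives a positive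
value. -/
theorem integrable_exp_neg_mul_sq {b : ℝ} (hb : 0 < b) :
    Integrable fun w : Space n => Real.exp (-b * ‖w‖ ^ 2) := by
  by_contra h
  have h1 := GaussianFourier.integral_rexp_neg_mul_sq_norm (V := Space n) hb
  rw [integral_undef h] at h1
  have : 0 < (Real.pi / b) ^ ((Module.finrank ℝ (Space n) : ℝ) / 2) := by positivity
  exact this.ne h1

theorem heatKernel_eq {t : ℝ} (w : Space n) :
    heatKernel n t w = (2 * Real.pi * t) ^ (-(n : ℝ) / 2) * Real.exp (-(1 / (2 * t)) * ‖w‖ ^ 2) := by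
  rw [heatKernel]; congr 2; ring

theorem heatKernel_pos {t : ℝ} (ht : 0 < t) (w : Space n) : 0 < heatKernel n t w := by
  rw [heatKernel]; positivity

theorem continuous_heatKernel (t : ℝ) : Continuous (heatKernel n t) := by
  unfold heatKernel; fun_prop

theorem integrable_heatKernel {t : ℝ} (ht : 0 < t) : Integrable (heatKernel n t) := by
  have := (integrable_exp_neg_mul_sq (n := n) (b := 1 / (2 * t)) (by positivity)).const_mul
    ((2 * Real.pi * t) ^ (-(n : ℝ) / 2))
  exact this.congr (Eventually.of_forall fun w => (heatKernel_eq w).symm)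

theorem integral_exp_neg_mul_sq {b : ℝ} (hb : 0 < b) :
    ∫ w : Space n, Real.exp (-b * ‖w‖ ^ 2) = (Real.pi / b) ^ ((n : ℝ) / 2) := by
  rw [GaussianFourier.integral_rexp_neg_mul_sq_norm hb, finrank_euclideanSpace_fin]

theorem integral_heatKernel {t : ℝ} (ht : 0 < t) : ∫ w, heatKernel n t w = 1 := by
  simp only [heatKernel_eq]
  rw [integral_const_mul, integral_exp_neg_mul_sq (by positivity), neg_div,
    Real.rpow_neg (by positivity)]
  have : Real.pi / (1 / (2 * t)) = 2 * Real.pi * t := by field_simp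
  rw [this]
  exact inv_mul_cancel₀ (by positivity)

theorem integral_abs_heatKernel {t : ℝ} (ht : 0 < t) : ∫ w, |heatKernel n t w| = 1 := by
  rw [← integral_heatKernel (n := n) ht]
  congr 1; funext w; exact abs_of_pos (heatKernel_pos ht w)

/-- Completing the square: the product of the two Gaussians is a Gaussian in w centred at (s/(s+t))
v, times the Gaussian of variance s + t in v. -/
theorem heatKernel_conv {s t : ℝ} (hs : 0 < s) (ht : 0 < t) (v : Space n) :
    ∫ w, heatKernel n s w * heatKernel n t (v - w) = heatKernel n (s + t) v := by
  set b : ℝ := (s + t) / (2 * s * t) with hb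
  have hb0 : 0 < b := by positivity
  have h1 : ∀ w, heatKernel n s w * heatKernel n t (v - w) =
      (2 * Real.pi * s) ^ (-(n : ℝ) / 2) * (2 * Real.pi * t) ^ (-(n : ℝ) / 2) *
        Real.exp (-(1 / (2 * (s + t))) * ‖v‖ ^ 2) *
        Real.exp (-b * ‖w - (s / (s + t)) • v‖ ^ 2) := by
    intro w
    rw [heatKernel_eq, heatKernel_eq]
    have e1 : -(1 / (2 * s)) * ‖w‖ ^ 2 + -(1 / (2 * t)) * ‖v - w‖ ^ 2 =
        -(1 / (2 * (s + t))) * ‖v‖ ^ 2 + -b * ‖w - (s / (s + t)) • v‖ ^ 2 := by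
      rw [@norm_sub_sq_real, @norm_sub_sq_real, norm_smul, inner_smul_right, mul_pow,
        real_inner_comm, hb, Real.norm_eq_abs, sq_abs]
      field_simp
      ring
    calc _ = (2 * Real.pi * s) ^ (-(n : ℝ) / 2) * (2 * Real.pi * t) ^ (-(n : ℝ) / 2) *
        (Real.exp (-(1 / (2 * s)) * ‖w‖ ^ 2) * Real.exp (-(1 / (2 * t)) * ‖v - w‖ ^ 2)) := by ring
      _ = _ := by rw [← Real.exp_add, e1, Real.exp_add]; ring
  simp only [h1]
  rw [integral_const_mul, integral_sub_right_eq_self (fun w : Space n => Real.exp (-b * ‖w‖ ^ 2)),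
    integral_exp_neg_mul_sq hb0, heatKernel_eq]
  have h2 : (2 * Real.pi * s) ^ (-(n : ℝ) / 2) * (2 * Real.pi * t) ^ (-(n : ℝ) / 2) *
      (Real.pi / b) ^ ((n : ℝ) / 2) = (2 * Real.pi * (s + t)) ^ (-(n : ℝ) / 2) := by
    have e1 : (Real.pi / b) ^ ((n : ℝ) / 2) = (b / Real.pi) ^ (-(n : ℝ) / 2) := by
      rw [neg_div, Real.rpow_neg (by positivity), ← Real.inv_rpow (by positivity), inv_div]
    rw [e1, ← Real.mul_rpow (by positivity) (by positivity),
      ← Real.mul_rpow (by positivity) (by positivity)]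
    congr 1
    rw [hb]; field_simp
  rw [← h2]; ring

theorem mul_exp_neg_le_one (y : ℝ) : y * Real.exp (-y) ≤ 1 := by
  have h1 : y ≤ Real.exp y := by linarith [Real.add_one_le_exp y]
  calc y * Real.exp (-y) ≤ Real.exp y * Real.exp (-y) :=
        mul_le_mul_of_nonneg_right h1 (Real.exp_pos _).le
    _ = 1 := by rw [← Real.exp_add]; simp

theorem sq_mul_exp_le {b : ℝ} (hb : 0 < b) (w : Space n) :
    ‖w‖ ^ 2 * Real.exp (-b * ‖w‖ ^ 2) ≤ 2 / b * Real.exp (-(b / 2) * ‖w‖ ^ 2) := by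
  have h1 := mul_exp_neg_le_one (b / 2 * ‖w‖ ^ 2)
  have h2 : Real.exp (-b * ‖w‖ ^ 2) =
      Real.exp (-(b / 2 * ‖w‖ ^ 2)) * Real.exp (-(b / 2) * ‖w‖ ^ 2) := by
    rw [← Real.exp_add]; congr 1; ring
  rw [h2]
  have h3 := Real.exp_pos (-(b / 2) * ‖w‖ ^ 2)
  calc _ = 2 / b * ((b / 2 * ‖w‖ ^ 2 * Real.exp (-(b / 2 * ‖w‖ ^ 2))) *
        Real.exp (-(b / 2) * ‖w‖ ^ 2)) := by field_simp
    _ ≤ 2 / b * (1 * Real.exp (-(b / 2) * ‖w‖ ^ 2)) := by gcongr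
    _ = _ := by ring

/-- The Laplacian of the heat kernel. -/
noncomputable def heatKernelLap (n : ℕ) (t : ℝ) (w : Space n) : ℝ :=
  (‖w‖ ^ 2 / t ^ 2 - n / t) * heatKernel n t w

theorem continuous_heatKernelLap (t : ℝ) : Continuous (heatKernelLap n t) := by
  unfold heatKernelLap
  exact (by fun_prop : Continuous fun w : Space n => ‖w‖ ^ 2 / t ^ 2 - n / t).mul
    (continuous_heatKernel t)

/-- A single integrable majorant for all t in [a,b], which justifies differentiation under the
integral; half of the exponent absorbs the factor ‖w‖². With a = t = b it gives integrability. -/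
theorem abs_heatKernelLap_le {a t b : ℝ} (ha : 0 < a) (hat : a ≤ t) (htb : t ≤ b) (w : Space n) :
    |heatKernelLap n t w| ≤ (2 * Real.pi * a) ^ (-(n : ℝ) / 2) *
      ((4 * b / a ^ 2 + n / a) * Real.exp (-(1 / (4 * b)) * ‖w‖ ^ 2)) := by
  have ht : 0 < t := ha.trans_le hat
  have hb : 0 < b := ht.trans_le htb
  rw [heatKernelLap, heatKernel_eq, abs_mul, abs_of_pos
    (by positivity : 0 < (2 * Real.pi * t) ^ (-(n : ℝ) / 2) * Real.exp (-(1 / (2 * t)) * ‖w‖ ^ 2))]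
  have h1 : (2 * Real.pi * t) ^ (-(n : ℝ) / 2) ≤ (2 * Real.pi * a) ^ (-(n : ℝ) / 2) := by
    refine Real.rpow_le_rpow_of_nonpos (by positivity) (by gcongr) ?_
    have : (0 : ℝ) ≤ n := by positivity
    linarith
  have h2 : Real.exp (-(1 / (2 * t)) * ‖w‖ ^ 2) ≤ Real.exp (-(1 / (2 * b)) * ‖w‖ ^ 2) := by
    apply Real.exp_le_exp.2
    have : 1 / (2 * b) ≤ 1 / (2 * t) := by gcongr
    nlinarith [sq_nonneg ‖w‖]
  have h3 : |‖w‖ ^ 2 / t ^ 2 - n / t| ≤ ‖w‖ ^ 2 / a ^ 2 + n / a := by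
    refine (abs_sub _ _).trans ?_
    rw [abs_of_nonneg (by positivity), abs_of_nonneg (by positivity)]
    gcongr
  have h4 := sq_mul_exp_le (b := 1 / (2 * b)) (by positivity) w
  have h5 : Real.exp (-(1 / (2 * b)) * ‖w‖ ^ 2) ≤ Real.exp (-(1 / (4 * b)) * ‖w‖ ^ 2) := by
    apply Real.exp_le_exp.2
    have : 1 / (4 * b) ≤ 1 / (2 * b) := by gcongr; norm_num
    nlinarith [sq_nonneg ‖w‖]
  have h6 : (1 / (2 * b)) / 2 = 1 / (4 * b) := by field_simp; norm_num
  have h7 : 2 / (1 / (2 * b)) = 4 * b := by field_simp; norm_num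
  rw [h6, h7] at h4
  calc _ ≤ (‖w‖ ^ 2 / a ^ 2 + n / a) * ((2 * Real.pi * a) ^ (-(n : ℝ) / 2) *
        Real.exp (-(1 / (2 * b)) * ‖w‖ ^ 2)) := by gcongr
    _ = (2 * Real.pi * a) ^ (-(n : ℝ) / 2) * ((‖w‖ ^ 2 * Real.exp (-(1 / (2 * b)) * ‖w‖ ^ 2)) / a ^ 2
        + n / a * Real.exp (-(1 / (2 * b)) * ‖w‖ ^ 2)) := by ring
    _ ≤ (2 * Real.pi * a) ^ (-(n : ℝ) / 2) * ((4 * b * Real.exp (-(1 / (4 * b)) * ‖w‖ ^ 2)) / a ^ 2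
        + n / a * Real.exp (-(1 / (4 * b)) * ‖w‖ ^ 2)) := by gcongr
    _ = _ := by ring

theorem integrable_heatKernelLap {t : ℝ} (ht : 0 < t) : Integrable (heatKernelLap n t) := by
  refine Integrable.mono' (((integrable_exp_neg_mul_sq (n := n) (b := 1 / (4 * t))
    (by positivity)).const_mul _).const_mul _)
    (continuous_heatKernelLap t).aestronglyMeasurable
    (Eventually.of_forall (abs_heatKernelLap_le ht le_rfl le_rfl))

/-- With variance t the kernel solves ∂_t g = ½ Δg, whence the factor ½. -/
theorem hasDerivAt_heatKernel {t : ℝ} (ht : 0 < t) (w : Space n) :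
    HasDerivAt (fun r => heatKernel n r w) (1 / 2 * heatKernelLap n t w) t := by
  have h1 : HasDerivAt (fun r : ℝ => (2 * Real.pi * r) ^ (-(n : ℝ) / 2))
      ((2 * Real.pi) * (-(n : ℝ) / 2) * (2 * Real.pi * t) ^ (-(n : ℝ) / 2 - 1)) t := by
    have h := ((hasDerivAt_id t).const_mul (2 * Real.pi)).rpow_const (p := -(n : ℝ) / 2)
      (Or.inl (by simp only [id]; positivity))
    simpa using h
  have h2 : HasDerivAt (fun r : ℝ => Real.exp (-‖w‖ ^ 2 / (2 * r)))
      (Real.exp (-‖w‖ ^ 2 / (2 * t)) * (‖w‖ ^ 2 / (2 * t ^ 2))) t := by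
    have h := ((hasDerivAt_id t).const_mul (2 : ℝ)).fun_inv (by simp only [id]; positivity)
    have h' := (h.const_mul (-‖w‖ ^ 2)).exp
    simp only [id, ← div_eq_mul_inv] at h'
    refine h'.congr_deriv ?_
    congr 1
    field_simp
  refine (h1.mul h2).congr_deriv ?_
  rw [Real.rpow_sub_one (by positivity), heatKernelLap, heatKernel]
  field_simp
  ring

theorem memLp_heatKernel {t : ℝ} (ht : 0 < t) (q : ℝ≥0∞) : MemLp (heatKernel n t) q volume := by
  have h1 : MemLp (fun w : Space n => Real.exp (-(1 / (2 * t)) * ‖w‖ ^ 2)) q volume := by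
    have hm : AEStronglyMeasurable (fun w : Space n => Real.exp (-(1 / (2 * t)) * ‖w‖ ^ 2))
      volume := (by fun_prop : Continuous _).aestronglyMeasurable
    rcases eq_or_ne q 0 with rfl | hq0
    · exact memLp_zero_iff_aestronglyMeasurable.2 hm
    rcases eq_or_ne q ∞ with rfl | hq
    · refine memLp_top_of_bound hm 1 (Eventually.of_forall fun w => ?_)
      rw [Real.norm_of_nonneg (Real.exp_pos _).le, Real.exp_le_one_iff]
      have : 0 ≤ 1 / (2 * t) * ‖w‖ ^ 2 := by positivity
      linarith
    · rw [← integrable_norm_rpow_iff hm hq0 hq]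
      have hq' : 0 < q.toReal := ENNReal.toReal_pos hq0 hq
      refine (integrable_exp_neg_mul_sq (n := n) (b := q.toReal * (1 / (2 * t)))
        (by positivity)).congr (Eventually.of_forall fun w => ?_)
      simp only [Real.norm_of_nonneg (Real.exp_pos _).le]
      rw [← Real.exp_mul]; congr 1; ring
  have h2 : heatKernel n t = fun w => (2 * Real.pi * t) ^ (-(n : ℝ) / 2) *
      Real.exp (-(1 / (2 * t)) * ‖w‖ ^ 2) := funext heatKernel_eq
  rw [h2]
  exact h1.const_mul _

theorem hasLineDerivAt_heatKernel {t : ℝ} (ht : 0 < t) (w v : Space n) :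
    HasLineDerivAt ℝ (heatKernel n t) (-(inner ℝ w v / t) * heatKernel n t w) w v := by
  have h : HasFDerivAt (heatKernel n t)
      (((2 * Real.pi * t) ^ (-(n : ℝ) / 2)) • (Real.exp (-(1 / (2 * t)) * ‖w‖ ^ 2) •
        ((-(1 / (2 * t))) • (2 • innerSL ℝ w)))) w := by
    have h2 : heatKernel n t = fun w => (2 * Real.pi * t) ^ (-(n : ℝ) / 2) *
      Real.exp (-(1 / (2 * t)) * ‖w‖ ^ 2) := funext heatKernel_eq
    rw [h2]
    have h3 : HasFDerivAt (fun w : Space n => ‖w‖ ^ 2) (2 • innerSL ℝ w) w :=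
      (hasStrictFDerivAt_norm_sq w).hasFDerivAt
    exact ((h3.const_mul _).exp).const_mul _
  refine (h.hasLineDerivAt v).congr_deriv ?_
  rw [heatKernel_eq]
  simp
  field_simp

theorem hasLineDerivAt_heatKernel_two {t : ℝ} (ht : 0 < t) (w v : Space n) :
    HasLineDerivAt ℝ (fun w => -(inner ℝ w v / t) * heatKernel n t w)
      ((inner ℝ w v ^ 2 / t ^ 2 - ‖v‖ ^ 2 / t) * heatKernel n t w) w v := by
  have h1 : HasLineDerivAt ℝ (fun w : Space n => -(inner ℝ w v / t)) (-(‖v‖ ^ 2 / t)) w v := by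
    have : HasDerivAt (fun r : ℝ => -((inner ℝ w v + r * ‖v‖ ^ 2) / t)) (-(‖v‖ ^ 2 / t)) 0 := by
      simpa using ((((hasDerivAt_id (0 : ℝ)).mul_const (‖v‖ ^ 2)).const_add
        (inner ℝ w v)).div_const t).fun_neg
    refine HasDerivAt.congr_of_eventuallyEq this (Eventually.of_forall fun r => ?_)
    simp only [inner_add_left, inner_smul_left, real_inner_self_eq_norm_sq]
    simp
  have h2 := hasLineDerivAt_heatKernel ht w v
  have h3 : HasDerivAt _ _ (0 : ℝ) := HasDerivAt.mul h1 h2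
  refine HasDerivAt.congr_deriv h3 ?_
  simp
  ring

end Gaussian

/-! ## The heat semigroup on `L^p` -/

section HeatSemigroup

variable {n p : ℕ} [Fact (1 ≤ (p : ℝ≥0∞))]

/-- The pointwise convolution agrees almost everywhere with an element of L^p, so the default value
in `classOf` is not taken. -/
theorem heat_eq_kconv {t : ℝ} (ht : 0 < t) (φ : LpSpace n p) :
    heat t φ = kconv (heatKernel n t) φ := by
  have h1 := coeFn_kconv (integrable_heatKernel ht) (continuous_heatKernel t).measurable φ
  have h2 : MemLp (heatConv t φ) (p : ℝ≥0∞) volume := (memLp_congr_ae h1).1 (Lp.memLp _)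
  rw [heat, if_neg ht.ne', classOf, dif_pos h2]
  apply Lp.ext
  filter_upwards [h2.coeFn_toLp, h1] with ξ e1 e2
  rw [e1, e2, heatConv]

/-- The heat semigroup as continuous linear maps. -/
noncomputable def heatL (t : ℝ) : LpSpace n p →L[ℝ] LpSpace n p :=
  open Classical in
  if h : 0 < t then kconvL (integrable_heatKernel h) else ContinuousLinearMap.id ℝ _

theorem heatL_of_pos {t : ℝ} (ht : 0 < t) (φ : LpSpace n p) :
    heatL t φ = kconv (heatKernel n t) φ := by
  rw [heatL, dif_pos ht, kconvL_apply]

theorem heatL_of_nonpos {t : ℝ} (ht : t ≤ 0) (φ : LpSpace n p) : heatL t φ = φ := by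
  rw [heatL, dif_neg (not_lt.2 ht), ContinuousLinearMap.id_apply]

theorem heatL_zero (φ : LpSpace n p) : heatL 0 φ = φ := heatL_of_nonpos le_rfl φ

theorem heat_eq_heatL {t : ℝ} (ht : 0 ≤ t) (φ : LpSpace n p) : heat t φ = heatL t φ := by
  rcases eq_or_lt_of_le ht with rfl | h
  · rw [heatL_zero, heat, if_pos rfl]
  · rw [heatL_of_pos h, heat_eq_kconv h]

theorem norm_heatL_le (t : ℝ) (φ : LpSpace n p) : ‖heatL t φ‖ ≤ ‖φ‖ := by
  rcases le_or_gt t 0 with h | h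
  · rw [heatL_of_nonpos h]
  · rw [heatL_of_pos h]
    simpa [integral_abs_heatKernel h] using norm_kconv_le (heatKernel n t) φ

theorem heatL_heatL {s t : ℝ} (hs : 0 ≤ s) (ht : 0 ≤ t) (φ : LpSpace n p) :
    heatL s (heatL t φ) = heatL (s + t) φ := by
  rcases eq_or_lt_of_le hs with rfl | hs
  · rw [heatL_zero, zero_add]
  rcases eq_or_lt_of_le ht with rfl | ht
  · rw [heatL_zero, add_zero]
  rw [heatL_of_pos hs, heatL_of_pos ht, heatL_of_pos (add_pos hs ht),
    kconv_kconv (integrable_heatKernel hs) (continuous_heatKernel s).measurable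
      (integrable_heatKernel ht) (continuous_heatKernel t).measurable]
  congr 1
  funext v
  exact heatKernel_conv hs ht v

theorem heatL_comm {s t : ℝ} (hs : 0 ≤ s) (ht : 0 ≤ t) (φ : LpSpace n p) :
    heatL s (heatL t φ) = heatL t (heatL s φ) := by
  rw [heatL_heatL hs ht, heatL_heatL ht hs, add_comm]

/-- Rescaling w by √t freezes the kernel and leaves t in the translation only. The formula also
covers t ≤ 0, where √t = 0, so strong continuity, including at 0, follows by dominated convergence.
-/
theorem heatL_eq_integral (t : ℝ) (φ : LpSpace n p) :
    heatL t φ = ∫ w, heatKernel n 1 w • translate (√t • w) φ := by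
  rcases le_or_gt t 0 with h | h
  · simp only [Real.sqrt_eq_zero_of_nonpos h, zero_smul, translate_zero]
    rw [integral_smul_const, integral_heatKernel one_pos, one_smul, heatL_of_nonpos h]
  · have hs : 0 < √t := Real.sqrt_pos.2 h
    have h1 := Measure.integral_comp_smul (volume : Measure (Space n))
      (fun w => heatKernel n t w • translate w φ) (√t)
    rw [finrank_euclideanSpace_fin] at h1
    have h2 : ∀ w : Space n, heatKernel n t (√t • w) = (√t ^ n)⁻¹ * heatKernel n 1 w := by
      intro w
      have e1 : ‖√t • w‖ ^ 2 = t * ‖w‖ ^ 2 := by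
        rw [norm_smul, mul_pow, Real.norm_of_nonneg hs.le, Real.sq_sqrt h.le]
      have e2 : (2 * Real.pi * t) ^ (-(n : ℝ) / 2) =
          (√t ^ n)⁻¹ * (2 * Real.pi * 1) ^ (-(n : ℝ) / 2) := by
        rw [Real.mul_rpow (by positivity) h.le, mul_one, mul_comm]
        congr 1
        rw [Real.sqrt_eq_rpow, ← Real.rpow_natCast, ← Real.rpow_mul h.le, ← Real.rpow_neg h.le]
        congr 1; ring
      rw [heatKernel, heatKernel, e1, e2, mul_assoc]
      congr 3
      field_simp
    simp only [h2, mul_smul] at h1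
    rw [integral_smul, abs_of_pos (by positivity)] at h1
    have h3 : (√t ^ n)⁻¹ ≠ 0 := by positivity
    rw [heatL_of_pos h, kconv]
    exact (smul_right_injective _ h3 h1).symm

theorem continuous_heatL (φ : LpSpace n p) : Continuous fun t : ℝ => heatL t φ := by
  simp only [heatL_eq_integral]
  refine continuous_of_dominated (bound := fun w => ‖heatKernel n 1 w‖ * ‖φ‖) ?_ ?_
    ((integrable_heatKernel one_pos).norm.mul_const _) ?_
  · intro t
    exact (continuous_heatKernel 1).aestronglyMeasurable.smul
      ((continuous_translate φ).comp (continuous_const_smul √t)).aestronglyMeasurable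
  · intro t
    exact Eventually.of_forall fun w => by rw [norm_smul, LinearIsometry.norm_map]
  · refine Eventually.of_forall fun w => ?_
    have h : Continuous fun t : ℝ => translate (√t • w) φ :=
      (continuous_translate φ).comp (Real.continuous_sqrt.smul continuous_const)
    exact h.const_smul (heatKernel n 1 w)

theorem coeFn_heatL {t : ℝ} (ht : 0 < t) (φ : LpSpace n p) :
    heatL t φ =ᵐ[volume] fun ξ => ∫ η, heatKernel n t (ξ - η) * φ η := by
  rw [heatL_of_pos ht]
  exact coeFn_kconv (integrable_heatKernel ht) (continuous_heatKernel t).measurable φ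

/-- Hölder's inequality against the kernel in the dual space. This smoothing from L^p to L^∞ is what
allows products of increments to be estimated in L^p, which is not an algebra. -/
theorem exists_sup_heatL_le {t : ℝ} (ht : 0 < t) : ∃ C : ℝ, 0 ≤ C ∧ ∀ φ : LpSpace n p,
    ∀ᵐ ξ, |heatL t φ ξ| ≤ C * ‖φ‖ := by
  have hk := memLp_heatKernel (n := n) ht (ENNReal.conjExponent p)
  have hm : ∀ ξ : Space n, MeasurePreserving (fun η => ξ - η) volume volume := fun ξ =>
    Measure.measurePreserving_sub_left volume ξ
  refine ⟨‖hk.toLp _‖, norm_nonneg _, fun φ => ?_⟩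
  filter_upwards [coeFn_heatL ht φ] with ξ e
  rw [e]
  have h1 : MemLp (fun η => heatKernel n t (ξ - η)) (ENNReal.conjExponent p) volume :=
    hk.comp_measurePreserving (hm ξ)
  have h2 := eLpNorm_smul_le_mul_eLpNorm (p := ENNReal.conjExponent p) (q := (p : ℝ≥0∞)) (r := 1)
    (Lp.memLp φ).1 h1.1
  have h3 : eLpNorm (fun η => heatKernel n t (ξ - η)) (ENNReal.conjExponent p) volume =
      eLpNorm (heatKernel n t) (ENNReal.conjExponent p) volume :=
    eLpNorm_comp_measurePreserving hk.1 (hm ξ)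
  rw [h3] at h2
  have h4 : AEStronglyMeasurable (fun η => heatKernel n t (ξ - η) * φ η) volume :=
    h1.1.mul (Lp.memLp φ).1
  calc |∫ η, heatKernel n t (ξ - η) * φ η| ≤ ∫ η, ‖heatKernel n t (ξ - η) * φ η‖ :=
        norm_integral_le_integral_norm (fun η => heatKernel n t (ξ - η) * φ η)
    _ = (eLpNorm (fun η => heatKernel n t (ξ - η) * φ η) 1 volume).toReal := by
        rw [integral_norm_eq_lintegral_enorm h4, eLpNorm_one_eq_lintegral_enorm]
    _ ≤ (eLpNorm (heatKernel n t) (ENNReal.conjExponent p) volume *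
          eLpNorm φ p volume).toReal :=
        ENNReal.toReal_mono (ENNReal.mul_ne_top hk.eLpNorm_ne_top (Lp.memLp φ).eLpNorm_ne_top) h2
    _ = ‖hk.toLp _‖ * ‖φ‖ := by rw [ENNReal.toReal_mul, Lp.norm_toLp, Lp.norm_def]

/-- The kernel is positive and has mass one. -/
theorem heatL_sup_le {t M : ℝ} (ht : 0 < t) {φ : LpSpace n p} (hφ : ∀ᵐ ξ, |φ ξ| ≤ M) :
    ∀ᵐ ξ, |heatL t φ ξ| ≤ M := by
  filter_upwards [coeFn_heatL ht φ] with ξ e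
  rw [e]
  have hm := Measure.measurePreserving_sub_left (volume : Measure (Space n)) ξ
  have hint : Integrable fun η => heatKernel n t (ξ - η) :=
    hm.integrable_comp_of_integrable (integrable_heatKernel ht)
  have h1 : ∫ η, heatKernel n t (ξ - η) * M = M := by
    rw [integral_mul_const, integral_sub_left_eq_self (heatKernel n t) volume ξ,
      integral_heatKernel ht, one_mul]
  refine (norm_integral_le_of_norm_le (f := fun η => heatKernel n t (ξ - η) * φ η)
    (hint.mul_const M) ?_).trans h1.le
  filter_upwards [hφ] with η h
  rw [norm_mul, Real.norm_of_nonneg (heatKernel_pos ht _).le]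
  exact mul_le_mul_of_nonneg_left h (heatKernel_pos ht _).le

theorem hasDerivAt_heatL {t : ℝ} (ht : 0 < t) (φ : LpSpace n p) :
    HasDerivAt (fun r => heatL r φ) ((1 / 2 : ℝ) • kconv (heatKernelLap n t) φ) t := by
  set c : ℝ := (2 * Real.pi * (t / 2)) ^ (-(n : ℝ) / 2) with hc
  set bound : Space n → ℝ := fun w => (1 / 2) * (c * ((4 * (2 * t) / (t / 2) ^ 2 + n / (t / 2)) *
    Real.exp (-(1 / (4 * (2 * t))) * ‖w‖ ^ 2))) * ‖φ‖ with hbound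
  have hs : Ioo (t / 2) (2 * t) ∈ 𝓝 t := Ioo_mem_nhds (by linarith) (by linarith)
  have h1 := (hasDerivAt_integral_of_dominated_loc_of_deriv_le
    (F := fun r w => heatKernel n r w • translate w φ)
    (F' := fun r w => (1 / 2 * heatKernelLap n r w) • translate w φ) (x₀ := t)
    (μ := (volume : Measure (Space n))) (bound := bound) hs ?_
    (integrable_kconv (integrable_heatKernel ht) φ) ?_ ?_ ?_ ?_).2
  · have h2 : ∫ w, (1 / 2 * heatKernelLap n t w) • translate w φ =
        (1 / 2 : ℝ) • kconv (heatKernelLap n t) φ := by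
      simp only [mul_smul]
      exact integral_smul _ _
    rw [h2] at h1
    refine h1.congr_of_eventuallyEq ?_
    filter_upwards [lt_mem_nhds ht] with r hr
    rw [heatL_of_pos hr, kconv]
  · exact Eventually.of_forall fun r => ((continuous_heatKernel r).smul
      (continuous_translate φ)).aestronglyMeasurable
  · exact ((continuous_const.mul (continuous_heatKernelLap t)).smul
      (continuous_translate φ)).aestronglyMeasurable
  · refine Eventually.of_forall fun w r hr => ?_
    rw [norm_smul, LinearIsometry.norm_map, norm_mul, Real.norm_of_nonneg (by norm_num)]
    have := abs_heatKernelLap_le (by linarith : 0 < t / 2) hr.1.le hr.2.le w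
    rw [Real.norm_eq_abs]
    exact mul_le_mul_of_nonneg_right (mul_le_mul_of_nonneg_left this (by norm_num))
      (norm_nonneg _)
  · exact (((integrable_exp_neg_mul_sq (by positivity)).const_mul _).const_mul _ |>.const_mul
      _).mul_const _
  · refine Eventually.of_forall fun w r hr => ?_
    exact (hasDerivAt_heatKernel (by linarith [hr.1]) w).smul_const _

/-! ### The weak Laplacian -/

omit [Fact (1 ≤ (p : ℝ≥0∞))] in
theorem schwartz_memLp (u : 𝓢(Space n, ℝ)) :
    MemLp u (ENNReal.conjExponent (p : ℝ≥0∞)) volume := u.memLp _ _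

theorem hasWeakLaplacian_iff {φ ψ : LpSpace n p} : HasWeakLaplacian φ ψ ↔
    ∀ u : 𝓢(Space n, ℝ), pairing (schwartz_memLp (Δ u)) φ = pairing (schwartz_memLp u) ψ := by
  simp only [pairing_apply]
  rfl

theorem HasWeakLaplacian.add {φ ψ φ' ψ' : LpSpace n p} (h : HasWeakLaplacian φ ψ)
    (h' : HasWeakLaplacian φ' ψ') : HasWeakLaplacian (φ + φ') (ψ + ψ') := by
  rw [hasWeakLaplacian_iff] at *
  intro u
  rw [map_add, map_add, h u, h' u]

theorem HasWeakLaplacian.smul {φ ψ : LpSpace n p} (h : HasWeakLaplacian φ ψ) (r : ℝ) :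
    HasWeakLaplacian (r • φ) (r • ψ) := by
  rw [hasWeakLaplacian_iff] at *
  intro u
  rw [map_smul, map_smul, h u]

theorem HasWeakLaplacian.zero : HasWeakLaplacian (0 : LpSpace n p) 0 := by
  rw [hasWeakLaplacian_iff]
  intro u
  rw [map_zero, map_zero]

theorem HasWeakLaplacian.unique {φ ψ ψ' : LpSpace n p} (h : HasWeakLaplacian φ ψ)
    (h' : HasWeakLaplacian φ ψ') : ψ = ψ' := by
  apply Lp.ext
  refine ae_eq_of_integral_contDiff_smul_eq
    ((Lp.memLp ψ).locallyIntegrable Fact.out) ((Lp.memLp ψ').locallyIntegrable Fact.out) ?_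
  intro g hg hgs
  have h1 := (h (hgs.toSchwartzMap hg)).symm.trans (h' (hgs.toSchwartzMap hg))
  simpa [mul_comm] using h1

theorem lineDerivOp_compSubConst (u : 𝓢(Space n, ℝ)) (a m : Space n) :
    LineDeriv.lineDerivOp m (SchwartzMap.compSubConstCLM ℝ a u) =
      SchwartzMap.compSubConstCLM ℝ a (LineDeriv.lineDerivOp m u : 𝓢(Space n, ℝ)) := by
  ext ξ
  rw [SchwartzMap.compSubConstCLM_apply, SchwartzMap.lineDerivOp_apply,
    SchwartzMap.lineDerivOp_apply, lineDeriv, lineDeriv]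
  congr 1
  funext r
  rw [SchwartzMap.compSubConstCLM_apply]
  congr 1
  abel

theorem laplacian_compSubConst (u : 𝓢(Space n, ℝ)) (a : Space n) :
    Δ (SchwartzMap.compSubConstCLM ℝ a u) = SchwartzMap.compSubConstCLM ℝ a (Δ u) := by
  rw [SchwartzMap.laplacian_eq_sum (stdOrthonormalBasis ℝ (Space n)),
    SchwartzMap.laplacian_eq_sum (stdOrthonormalBasis ℝ (Space n)), map_sum]
  simp only [lineDerivOp_compSubConst]

/-- The Laplacian commutes with translations, and a convolution is an average of translations. -/
theorem HasWeakLaplacian.kconv {φ ψ : LpSpace n p} (h : HasWeakLaplacian φ ψ)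
    {k : Space n → ℝ} (hk : Integrable k) : HasWeakLaplacian (kconv k φ) (kconv k ψ) := by
  rw [hasWeakLaplacian_iff]
  intro u
  rw [pairing_kconv hk, pairing_kconv hk]
  congr 1
  funext w
  congr 1
  have h1 : ∀ (χ : LpSpace n p) (v : 𝓢(Space n, ℝ)), ∫ ξ, χ (ξ - w) * v ξ =
      ∫ ξ, χ ξ * SchwartzMap.compSubConstCLM ℝ (-w) v ξ := by
    intro χ v
    rw [← integral_add_right_eq_self _ w]
    simp
  rw [h1, h1, ← laplacian_compSubConst]
  exact h _

theorem HasWeakLaplacian.heatL {φ ψ : LpSpace n p} (h : HasWeakLaplacian φ ψ) (t : ℝ) :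
    HasWeakLaplacian (heatL t φ) (heatL t ψ) := by
  rcases le_or_gt t 0 with ht | ht
  · rwa [heatL_of_nonpos ht, heatL_of_nonpos ht]
  · rw [heatL_of_pos ht, heatL_of_pos ht]
    exact h.kconv (integrable_heatKernel ht)

theorem integrable_heatKernelLine {t : ℝ} (ht : 0 < t) (v : Space n) :
    Integrable fun w => -(inner ℝ w v / t) * heatKernel n t w := by
  -- The majorant uses ‖w‖ ≤ 1 + ‖w‖² and rewrites ‖w‖² g_t as t² (Δg_t + (n/t) g_t), which is
  -- already known to be integrable.
  refine Integrable.mono' (((integrable_heatKernel (n := n) ht).add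
    (((integrable_heatKernelLap (n := n) ht).add
      ((integrable_heatKernel (n := n) ht).const_mul (n / t))).const_mul (t ^ 2))).const_mul
        (‖v‖ / t))
    ((by fun_prop : Continuous fun w : Space n => -(inner ℝ w v / t)).mul
      (continuous_heatKernel t)).aestronglyMeasurable (Eventually.of_forall fun w => ?_)
  have h0 := heatKernel_pos ht w
  rw [norm_mul, Real.norm_of_nonneg h0.le, norm_neg, norm_div, Real.norm_of_nonneg ht.le]
  have h1 : ‖inner ℝ w v‖ ≤ ‖w‖ * ‖v‖ := norm_inner_le_norm w v
  have h2 : ‖w‖ ≤ 1 + ‖w‖ ^ 2 := by nlinarith [sq_nonneg (‖w‖ - 1), norm_nonneg w]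
  simp only [Pi.add_apply, heatKernelLap]
  calc ‖inner ℝ w v‖ / t * heatKernel n t w ≤ ((1 + ‖w‖ ^ 2) * ‖v‖) / t * heatKernel n t w := by
        gcongr
        exact h1.trans (mul_le_mul_of_nonneg_right h2 (norm_nonneg _))
    _ = _ := by field_simp; ring

theorem integrable_heatKernelLine_two {t : ℝ} (ht : 0 < t) (v : Space n) :
    Integrable fun w => (inner ℝ w v ^ 2 / t ^ 2 - ‖v‖ ^ 2 / t) * heatKernel n t w := by
  refine Integrable.mono' (((((integrable_heatKernelLap (n := n) ht).add
      ((integrable_heatKernel (n := n) ht).const_mul (n / t))).const_mul (‖v‖ ^ 2))).add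
        ((integrable_heatKernel (n := n) ht).const_mul (‖v‖ ^ 2 / t)))
    ((by fun_prop : Continuous fun w : Space n => inner ℝ w v ^ 2 / t ^ 2 - ‖v‖ ^ 2 / t).mul
      (continuous_heatKernel t)).aestronglyMeasurable (Eventually.of_forall fun w => ?_)
  have h0 := heatKernel_pos ht w
  rw [norm_mul, Real.norm_of_nonneg h0.le]
  have h1 : ‖inner ℝ w v‖ ≤ ‖w‖ * ‖v‖ := norm_inner_le_norm w v
  have h2 : inner ℝ w v ^ 2 ≤ ‖w‖ ^ 2 * ‖v‖ ^ 2 := by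
    rw [← mul_pow, ← sq_abs]
    exact pow_le_pow_left₀ (abs_nonneg _) h1 2
  have h3 : ‖inner ℝ w v ^ 2 / t ^ 2 - ‖v‖ ^ 2 / t‖ ≤
      ‖w‖ ^ 2 * ‖v‖ ^ 2 / t ^ 2 + ‖v‖ ^ 2 / t := by
    refine (norm_sub_le _ _).trans ?_
    rw [Real.norm_of_nonneg (by positivity), Real.norm_of_nonneg (by positivity)]
    gcongr
  simp only [Pi.add_apply, heatKernelLap]
  refine (mul_le_mul_of_nonneg_right h3 h0.le).trans (le_of_eq ?_)
  ring

/-- Integration by parts against the heat kernel. -/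
theorem integral_heatKernel_mul_laplacian {t : ℝ} (ht : 0 < t) (u : 𝓢(Space n, ℝ)) :
    ∫ w, heatKernel n t w * (Δ u) w = ∫ w, heatKernelLap n t w * u w := by
  have hbdd : ∀ v : 𝓢(Space n, ℝ), ∀ k : Space n → ℝ, Integrable k →
      Integrable fun w => k w * v w := by
    intro v k hk
    obtain ⟨C, hC⟩ : ∃ C, ∀ w, ‖v w‖ ≤ C := by
      obtain ⟨C, hC⟩ := v.decay 0 0
      exact ⟨C, fun w => by simpa using hC.2 w⟩
    exact hk.mul_bdd v.continuous.aestronglyMeasurable (Eventually.of_forall hC)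
  have hline : ∀ (v : 𝓢(Space n, ℝ)) (m w : Space n),
      HasLineDerivAt ℝ v ((LineDeriv.lineDerivOp m v : 𝓢(Space n, ℝ)) w) w m := by
    intro v m w
    rw [SchwartzMap.lineDerivOp_apply]
    exact (v.differentiableAt.lineDifferentiableAt).hasLineDerivAt
  have hone : ∀ m : Space n, ∫ w, heatKernel n t w *
      (LineDeriv.lineDerivOp m (LineDeriv.lineDerivOp m u : 𝓢(Space n, ℝ)) : 𝓢(Space n, ℝ)) w =
      ∫ w, (inner ℝ w m ^ 2 / t ^ 2 - ‖m‖ ^ 2 / t) * heatKernel n t w * u w := by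
    intro m
    have e1 := integral_bilinear_hasLineDerivAt_right_eq_neg_left_of_integrable
      (μ := (volume : Measure (Space n))) (B := ContinuousLinearMap.mul ℝ ℝ) (v := m)
      (f := heatKernel n t) (f' := fun w => -(inner ℝ w m / t) * heatKernel n t w)
      (g := (LineDeriv.lineDerivOp m u : 𝓢(Space n, ℝ)))
      (g' := (LineDeriv.lineDerivOp m (LineDeriv.lineDerivOp m u : 𝓢(Space n, ℝ)) :
        𝓢(Space n, ℝ)))
      (hbdd _ _ (integrable_heatKernelLine ht m)) (hbdd _ _ (integrable_heatKernel ht))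
      (hbdd _ _ (integrable_heatKernel ht))
      (fun w _ => hasLineDerivAt_heatKernel ht w m) (fun w _ => hline _ m w)
    have e2 := integral_bilinear_hasLineDerivAt_right_eq_neg_left_of_integrable
      (μ := (volume : Measure (Space n))) (B := ContinuousLinearMap.mul ℝ ℝ) (v := m)
      (f := fun w => -(inner ℝ w m / t) * heatKernel n t w)
      (f' := fun w => (inner ℝ w m ^ 2 / t ^ 2 - ‖m‖ ^ 2 / t) * heatKernel n t w)
      (g := u) (g' := (LineDeriv.lineDerivOp m u : 𝓢(Space n, ℝ)))
      (hbdd _ _ (integrable_heatKernelLine_two ht m)) (hbdd _ _ (integrable_heatKernelLine ht m))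
      (hbdd _ _ (integrable_heatKernelLine ht m))
      (fun w _ => hasLineDerivAt_heatKernel_two ht w m) (fun w _ => hline _ m w)
    simp only [ContinuousLinearMap.mul_apply'] at e1 e2
    rw [e1, e2, neg_neg]
  set b := stdOrthonormalBasis ℝ (Space n)
  rw [SchwartzMap.laplacian_eq_sum b]
  simp only [_root_.sum_apply, Finset.mul_sum]
  rw [integral_finsetSum _ fun i _ => hbdd _ _ (integrable_heatKernel ht)]
  simp only [hone]
  rw [← integral_finsetSum _ fun i _ => hbdd u _ (integrable_heatKernelLine_two ht (b i))]
  congr 1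
  funext w
  rw [← Finset.sum_mul, ← Finset.sum_mul, Finset.sum_sub_distrib, ← Finset.sum_div]
  have h1 : ∑ i, inner ℝ w (b i) ^ 2 = ‖w‖ ^ 2 := by
    have := b.sum_sq_norm_inner_left w
    simpa using this
  rw [h1, heatKernelLap]
  congr 3
  simp [b.norm_eq_one, div_eq_mul_inv]

theorem hasWeakLaplacian_kconv_heatKernel {t : ℝ} (ht : 0 < t) (φ : LpSpace n p) :
    HasWeakLaplacian (kconv (heatKernel n t) φ) (kconv (heatKernelLap n t) φ) := by
  rw [hasWeakLaplacian_iff]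
  intro u
  rw [pairing_kconv' (integrable_heatKernel ht) (continuous_heatKernel t).measurable _
    (Δ u).continuous.measurable, pairing_kconv' (integrable_heatKernelLap ht)
    (continuous_heatKernelLap t).measurable _ u.continuous.measurable]
  congr 1
  funext ξ
  congr 1
  have h1 := integral_heatKernel_mul_laplacian ht (SchwartzMap.compSubConstCLM ℝ (-ξ) u)
  rw [laplacian_compSubConst] at h1
  simpa [add_comm] using h1

/-- For r > 0 the derivative of S_r φ is ½ S_r Δφ, and S_r is a contraction; the segment starts at
some δ > 0 that is then sent to 0. -/
theorem norm_heatL_sub_le {φ ψ : LpSpace n p} (h : HasWeakLaplacian φ ψ) {t : ℝ} (ht : 0 ≤ t) :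
    ‖heatL t φ - φ‖ ≤ t * ‖ψ‖ := by
  rcases eq_or_lt_of_le ht with rfl | ht
  · simp [heatL_zero]
  have hderiv : ∀ r, 0 < r → HasDerivAt (fun r => heatL r φ) ((1 / 2 : ℝ) • heatL r ψ) r := by
    intro r hr
    have h1 := h.heatL r
    have h2 := hasWeakLaplacian_kconv_heatKernel hr φ
    rw [← heatL_of_pos hr] at h2
    -- Both S_r ψ and the convolution with the Laplacian of the kernel are weak Laplacians of S_r φ,
    -- hence equal.
    rw [h1.unique h2]
    exact hasDerivAt_heatL hr φ
  have hδ : ∀ δ, 0 < δ → δ < t → ‖heatL t φ - heatL δ φ‖ ≤ t * ‖ψ‖ := by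
    intro δ h0 h1
    have h2 := norm_image_sub_le_of_norm_deriv_le_segment' (f := fun r => heatL r φ) (a := δ)
      (b := t) (C := ‖ψ‖) (f' := fun r => (1 / 2 : ℝ) • heatL r ψ)
      (fun r hr => (hderiv r (h0.trans_le hr.1)).hasDerivWithinAt)
      (fun r _ => by
        rw [norm_smul, Real.norm_of_nonneg (by norm_num)]
        have := norm_heatL_le r ψ
        have := norm_nonneg ψ
        linarith) t ⟨h1.le, le_rfl⟩
    refine h2.trans ?_
    rw [mul_comm]
    exact mul_le_mul_of_nonneg_right (by linarith) (norm_nonneg _)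
  have hlim : Tendsto (fun δ => ‖heatL t φ - heatL δ φ‖) (𝓝[>] 0) (𝓝 ‖heatL t φ - φ‖) := by
    have h1 := ((continuous_heatL φ).tendsto 0).mono_left
      (nhdsWithin_le_nhds : 𝓝[>] (0 : ℝ) ≤ 𝓝 0)
    rw [heatL_zero] at h1
    exact (tendsto_const_nhds.sub h1).norm
  refine le_of_tendsto hlim ?_
  filter_upwards [Ioo_mem_nhdsGT ht] with δ h1
  exact hδ δ h1.1 h1.2

end HeatSemigroup

/-! ## The norm of the Bessel space -/

section Bessel

variable {n p : ℕ} [Fact (1 ≤ (p : ℝ≥0∞))]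

theorem besselNorm_eq {φ ψ : LpSpace n p} (h : HasWeakLaplacian φ ψ) :
    besselNorm φ = ‖φ‖ₑ + ‖ψ‖ₑ := by
  refine le_antisymm (iInf₂_le ψ h) (le_iInf₂ fun ψ' h' => ?_)
  rw [h.unique h']

omit [Fact (1 ≤ (p : ℝ≥0∞))] in
theorem exists_hasWeakLaplacian {φ : LpSpace n p} (h : besselNorm φ ≠ ∞) :
    ∃ ψ, HasWeakLaplacian φ ψ := by
  by_contra hcon
  push Not at hcon
  refine h ?_
  rw [besselNorm]
  simp [hcon]

theorem enorm_le_besselNorm (φ : LpSpace n p) : ‖φ‖ₑ ≤ besselNorm φ :=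
  le_iInf₂ fun _ _ => le_self_add

theorem besselNorm_zero : besselNorm (0 : LpSpace n p) = 0 := by
  rw [besselNorm_eq HasWeakLaplacian.zero]; simp

theorem besselNorm_add_le (φ χ : LpSpace n p) :
    besselNorm (φ + χ) ≤ besselNorm φ + besselNorm χ := by
  by_cases h1 : besselNorm φ = ∞
  · simp [h1]
  by_cases h2 : besselNorm χ = ∞
  · simp [h2]
  obtain ⟨φ', h1'⟩ := exists_hasWeakLaplacian h1
  obtain ⟨χ', h2'⟩ := exists_hasWeakLaplacian h2
  rw [besselNorm_eq h1', besselNorm_eq h2', besselNorm_eq (h1'.add h2')]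
  calc ‖φ + χ‖ₑ + ‖φ' + χ'‖ₑ ≤ (‖φ‖ₑ + ‖χ‖ₑ) + (‖φ'‖ₑ + ‖χ'‖ₑ) := by
        gcongr <;> exact enorm_add_le _ _
    _ = _ := by ring

theorem besselNorm_heatL_le (t : ℝ) (φ : LpSpace n p) : besselNorm (heatL t φ) ≤ besselNorm φ := by
  by_cases h1 : besselNorm φ = ∞
  · simp [h1]
  obtain ⟨φ', h1'⟩ := exists_hasWeakLaplacian h1
  rw [besselNorm_eq h1', besselNorm_eq (h1'.heatL t)]
  gcongr <;> exact enorm_le_iff_norm_le.2 (norm_heatL_le t _)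

/-- The Laplacian may be put on the kernel, and Δg_t is integrable for t > 0. -/
theorem exists_besselNorm_heatL_le {t : ℝ} (ht : 0 < t) :
    ∃ C : ℝ≥0, ∀ φ : LpSpace n p, besselNorm (heatL t φ) ≤ C * ‖φ‖ₑ := by
  refine ⟨1 + (∫ w, |heatKernelLap n t w|).toNNReal, fun φ => ?_⟩
  have h := hasWeakLaplacian_kconv_heatKernel ht φ
  rw [heatL_of_pos ht, besselNorm_eq h, ENNReal.coe_add, add_mul, ENNReal.coe_one, one_mul]
  gcongr
  · rw [← heatL_of_pos ht]; exact enorm_le_iff_norm_le.2 (norm_heatL_le t _)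
  · have h1 := norm_kconv_le (heatKernelLap n t) φ
    rw [← ofReal_norm, ← ofReal_norm]
    refine (ENNReal.ofReal_le_ofReal h1).trans ?_
    rw [ENNReal.ofReal_mul (integral_nonneg fun _ => abs_nonneg _)]
    rfl

theorem norm_heatL_sub_le_besselNorm {φ : LpSpace n p} (h : besselNorm φ ≠ ∞) {t : ℝ}
    (ht : 0 ≤ t) : ‖heatL t φ - φ‖ ≤ t * (besselNorm φ).toReal := by
  obtain ⟨ψ, h'⟩ := exists_hasWeakLaplacian h
  refine (norm_heatL_sub_le h' ht).trans (mul_le_mul_of_nonneg_left ?_ ht)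
  rw [← toReal_enorm ψ]
  refine ENNReal.toReal_mono h ?_
  rw [besselNorm_eq h']
  exact le_add_self

/-- By smoothing, continuity in the Bessel space of anything of the form S_ε G reduces to continuity
of G in L^p. -/
theorem contIn_heatL {α : Type} [TopologicalSpace α] {ε : ℝ} (hε : 0 < ε) {A : Set α}
    {g G : α → LpSpace n p} (hg : ∀ a ∈ A, g a = heatL ε (G a)) (hG : ContinuousOn G A) :
    ContIn besselNorm A g := by
  obtain ⟨C, hC⟩ := exists_besselNorm_heatL_le (n := n) (p := p) hε
  intro a ha
  constructor
  · rw [hg a ha]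
    exact ((hC _).trans_lt (ENNReal.mul_lt_top ENNReal.coe_lt_top (enorm_lt_top))).ne
  · have h1 : Tendsto (fun b => (C : ℝ≥0∞) * ‖G b - G a‖ₑ) (𝓝[A] a) (𝓝 0) := by
      have h2 : Tendsto (fun b => ‖G b - G a‖ₑ) (𝓝[A] a) (𝓝 0) := by
        have := ((hG a ha).tendsto.sub_const (G a)).enorm
        simpa using this
      simpa using ENNReal.Tendsto.const_mul h2 (Or.inr ENNReal.coe_ne_top)
    refine tendsto_of_tendsto_of_tendsto_of_le_of_le' tendsto_const_nhds h1
      (Eventually.of_forall fun _ => zero_le) ?_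
    filter_upwards [self_mem_nhdsWithin] with b hb
    rw [hg a ha, hg b hb, ← map_sub]
    exact hC _

theorem ContIn.add {α : Type} [TopologicalSpace α] {A : Set α} {g h : α → LpSpace n p}
    (hg : ContIn besselNorm A g) (hh : ContIn besselNorm A h) :
    ContIn besselNorm A fun a => g a + h a := by
  intro a ha
  constructor
  · exact ((besselNorm_add_le _ _).trans_lt
      (ENNReal.add_lt_top.2 ⟨(hg a ha).1.lt_top, (hh a ha).1.lt_top⟩)).ne
  · have h1 := (hg a ha).2.add (hh a ha).2
    rw [add_zero] at h1
    refine tendsto_of_tendsto_of_tendsto_of_le_of_le tendsto_const_nhds h1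
      (fun _ => zero_le) fun b => ?_
    change besselNorm (g b + h b - (g a + h a)) ≤ besselNorm (g b - g a) + besselNorm (h b - h a)
    rw [add_sub_add_comm]
    exact besselNorm_add_le _ _

/-- The Laplacian commutes with S_t, so strong continuity in L^p is applied to ψ and to Δψ. -/
theorem contIn_heatL_time {T : ℝ} {ψ : LpSpace n p} (hψ : besselNorm ψ ≠ ∞) :
    ContIn besselNorm univ fun t : Time T => heatL (t : ℝ) ψ := by
  obtain ⟨ψ', h⟩ := exists_hasWeakLaplacian hψ
  intro a _
  constructor
  · exact ((besselNorm_heatL_le _ _).trans_lt hψ.lt_top).ne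
  · have h1 : ∀ b : Time T, besselNorm (heatL (b : ℝ) ψ - heatL (a : ℝ) ψ) =
        ‖heatL (b : ℝ) ψ - heatL (a : ℝ) ψ‖ₑ + ‖heatL (b : ℝ) ψ' - heatL (a : ℝ) ψ'‖ₑ := by
      intro b
      have h2 := (h.heatL b).add ((h.heatL a).smul (-1))
      simp only [neg_one_smul, ← sub_eq_add_neg] at h2
      exact besselNorm_eq h2
    simp only [h1]
    have h3 : ∀ χ : LpSpace n p, Tendsto (fun b : Time T => ‖heatL (b : ℝ) χ - heatL (a : ℝ) χ‖ₑ)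
        (𝓝[univ] a) (𝓝 0) := by
      intro χ
      have hc : Continuous fun b : Time T => ‖heatL (b : ℝ) χ - heatL (a : ℝ) χ‖ₑ :=
        (((continuous_heatL χ).comp continuous_subtype_val).sub continuous_const).enorm
      have := hc.tendsto a
      rw [nhdsWithin_univ]
      simpa using this
    simpa using (h3 ψ).add (h3 ψ')

/-- A nonzero test element on which both X and X^a can be evaluated with their bounds; it reveals
the regularity of x. -/
theorem exists_ne_zero_besselNorm_ne_top : ∃ φ : LpSpace n p, φ ≠ 0 ∧ besselNorm φ ≠ ∞ := by
  let f : ContDiffBump (0 : Space n) := ⟨1, 2, one_pos, one_lt_two⟩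
  let u : 𝓢(Space n, ℝ) := f.hasCompactSupport.toSchwartzMap f.contDiff
  refine ⟨u.toLp (p : ℝ≥0∞) volume, ?_, ?_⟩
  · intro h
    have h0 : (u.toLp (p : ℝ≥0∞) volume) = (0 : 𝓢(Space n, ℝ)).toLp (p : ℝ≥0∞) volume := by
      rw [h]
      exact ((SchwartzMap.toLpCLM ℝ ℝ (p : ℝ≥0∞) (volume : Measure (Space n))).map_zero).symm
    have h1 : u = 0 := SchwartzMap.injective_toLp (p : ℝ≥0∞) volume h0
    have h2 : u 0 = 1 := f.one_of_mem_closedBall (by simp [f])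
    rw [h1] at h2
    simp at h2
  · have h : HasWeakLaplacian (u.toLp (p : ℝ≥0∞) volume) ((Δ u).toLp (p : ℝ≥0∞) volume) := by
      intro v
      have h1 := SchwartzMap.integral_mul_laplacian_right_eq_left
        (μ := (volume : Measure (Space n))) u v
      refine Eq.trans (integral_congr_ae ?_) (h1.trans (integral_congr_ae ?_))
      · filter_upwards [u.coeFn_toLp (p : ℝ≥0∞) volume] with ξ e
        rw [e]
      · filter_upwards [(Δ u).coeFn_toLp (p : ℝ≥0∞) volume] with ξ e
        rw [e]
    rw [besselNorm_eq h]
    exact (ENNReal.add_lt_top.2 ⟨enorm_lt_top, enorm_lt_top⟩).ne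

end Bessel

/-! ## Scalar estimates -/

/-- `τ'` is the derivative of `τ`, and both `τ` and `τ'` are Lipschitz with constant `C`. -/
structure DerivLipschitz (τ τ' : ℝ → ℝ) (C : ℝ) : Prop where
  hasDerivAt : ∀ a, HasDerivAt τ (τ' a) a
  bound : ∀ a, |τ' a| ≤ C
  lip : ∀ a b, |τ' a - τ' b| ≤ C * |a - b|

namespace DerivLipschitz

variable {τ τ' τ'' : ℝ → ℝ} {C : ℝ}

theorem nonneg (h : DerivLipschitz τ τ' C) : 0 ≤ C := (abs_nonneg _).trans (h.bound 0)

theorem sub_le (h : DerivLipschitz τ τ' C) (a b : ℝ) : |τ a - τ b| ≤ C * |a - b| :=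
  Convex.norm_image_sub_le_of_norm_hasDerivWithin_le
    (fun x _ => (h.hasDerivAt x).hasDerivWithinAt) (fun x _ => h.bound x) convex_univ
    (mem_univ b) (mem_univ a)

/-- The segments from a to a' and from b to b' are followed with the same parameter, and the mean
value inequality is applied to the difference of τ along them. -/
theorem four_le (h : DerivLipschitz τ τ' C) (a' a b' b : ℝ) :
    |τ a' - τ a - (τ b' - τ b)| ≤
      C * |a' - a - (b' - b)| + C * (|a' - b'| + |a - b|) * |a' - a| := by
  have hC := h.nonneg
  have hd : ∀ r ∈ Icc (0 : ℝ) 1, HasDerivWithinAt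
      (fun r => τ (a + r * (a' - a)) - τ (b + r * (b' - b)))
      (τ' (a + r * (a' - a)) * (a' - a) - τ' (b + r * (b' - b)) * (b' - b)) (Icc 0 1) r := by
    intro r _
    have h1 : ∀ c d : ℝ, HasDerivAt (fun r => τ (c + r * d)) (τ' (c + r * d) * d) r := by
      intro c d
      have h2 : HasDerivAt (fun r : ℝ => c + r * d) d r := by
        simpa using ((hasDerivAt_id r).mul_const d).const_add c
      exact (h.hasDerivAt _).comp r h2
    exact ((h1 a _).sub (h1 b _)).hasDerivWithinAt
  have hb : ∀ r ∈ Ico (0 : ℝ) 1,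
      ‖τ' (a + r * (a' - a)) * (a' - a) - τ' (b + r * (b' - b)) * (b' - b)‖ ≤
      C * |a' - a - (b' - b)| + C * (|a' - b'| + |a - b|) * |a' - a| := by
    intro r hr
    have e : τ' (a + r * (a' - a)) * (a' - a) - τ' (b + r * (b' - b)) * (b' - b) =
        τ' (b + r * (b' - b)) * (a' - a - (b' - b)) +
        (τ' (a + r * (a' - a)) - τ' (b + r * (b' - b))) * (a' - a) := by ring
    rw [e, Real.norm_eq_abs]
    refine (abs_add_le _ _).trans ?_
    rw [abs_mul, abs_mul]
    have h1 := h.bound (b + r * (b' - b))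
    have h2 := h.lip (a + r * (a' - a)) (b + r * (b' - b))
    have h3 : |a + r * (a' - a) - (b + r * (b' - b))| ≤ |a' - b'| + |a - b| := by
      have e2 : a + r * (a' - a) - (b + r * (b' - b)) = r * (a' - b') + (1 - r) * (a - b) := by ring
      rw [e2]
      refine (abs_add_le _ _).trans ?_
      rw [abs_mul, abs_mul, abs_of_nonneg hr.1, abs_of_nonneg (by linarith [hr.2] : 0 ≤ 1 - r)]
      have := abs_nonneg (a' - b'); have := abs_nonneg (a - b)
      have := hr.1; have := hr.2
      nlinarith
    have h4 := h2.trans (mul_le_mul_of_nonneg_left h3 hC)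
    exact add_le_add (mul_le_mul_of_nonneg_right h1 (abs_nonneg _))
      (mul_le_mul_of_nonneg_right h4 (abs_nonneg _))
  have := norm_image_sub_le_of_norm_deriv_le_segment_01' hd hb
  simp only [one_mul, zero_mul, add_zero, add_sub_cancel, Real.norm_eq_abs] at this
  convert this using 2
  ring

theorem taylor_le (h : DerivLipschitz τ τ' C) (a χ : ℝ) :
    |τ (a + χ) - τ a - τ' a * χ| ≤ C * |χ| * |χ| := by
  have hC := h.nonneg
  have hd : ∀ r ∈ Icc (0 : ℝ) 1, HasDerivWithinAt (fun r => τ (a + r * χ) - r * (τ' a * χ))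
      (τ' (a + r * χ) * χ - τ' a * χ) (Icc 0 1) r := by
    intro r _
    have h2 : HasDerivAt (fun r : ℝ => a + r * χ) χ r := by
      simpa using ((hasDerivAt_id r).mul_const χ).const_add a
    have h3 : HasDerivAt (fun r : ℝ => r * (τ' a * χ)) (τ' a * χ) r := by
      simpa using (hasDerivAt_id r).mul_const (τ' a * χ)
    exact (((h.hasDerivAt _).comp r h2).sub h3).hasDerivWithinAt
  have hb : ∀ r ∈ Ico (0 : ℝ) 1, ‖τ' (a + r * χ) * χ - τ' a * χ‖ ≤ C * |χ| * |χ| := by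
    intro r hr
    rw [← sub_mul, norm_mul, Real.norm_eq_abs, Real.norm_eq_abs]
    refine mul_le_mul_of_nonneg_right ((h.lip _ _).trans (mul_le_mul_of_nonneg_left ?_ hC))
      (abs_nonneg _)
    rw [add_sub_cancel_left, abs_mul, abs_of_nonneg hr.1]
    exact mul_le_of_le_one_left (abs_nonneg _) hr.2.le
  have := norm_image_sub_le_of_norm_deriv_le_segment_01' hd hb
  simp only [one_mul, zero_mul, add_zero, Real.norm_eq_abs] at this
  convert this using 2
  ring

/-- The same interpolation for the difference of two Taylor remainders; its derivative is a second
difference of τ', controlled by `four_le` for τ'. This consumes the bound on the third derivative of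
the nonlinearity. -/
theorem taylor_sub_le (h : DerivLipschitz τ τ' C) (h' : DerivLipschitz τ' τ'' C) (a χ b ω : ℝ) :
    |(τ (a + χ) - τ a - τ' a * χ) - (τ (b + ω) - τ b - τ' b * ω)| ≤
      C * (|χ| + |ω|) * |χ - ω| + C * (2 * |a - b| + |χ - ω|) * |χ| * |χ| := by
  have hC := h.nonneg
  have hd : ∀ r ∈ Icc (0 : ℝ) 1, HasDerivWithinAt
      (fun r => (τ (a + r * χ) - r * (τ' a * χ)) - (τ (b + r * ω) - r * (τ' b * ω)))
      ((τ' (a + r * χ) * χ - τ' a * χ) - (τ' (b + r * ω) * ω - τ' b * ω)) (Icc 0 1) r := by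
    intro r _
    have h1 : ∀ c d : ℝ, HasDerivAt (fun r => τ (c + r * d) - r * (τ' c * d))
        (τ' (c + r * d) * d - τ' c * d) r := by
      intro c d
      have h2 : HasDerivAt (fun r : ℝ => c + r * d) d r := by
        simpa using ((hasDerivAt_id r).mul_const d).const_add c
      have h3 : HasDerivAt (fun r : ℝ => r * (τ' c * d)) (τ' c * d) r := by
        simpa using (hasDerivAt_id r).mul_const (τ' c * d)
      exact ((h.hasDerivAt _).comp r h2).sub h3
    exact ((h1 a χ).sub (h1 b ω)).hasDerivWithinAt
  have hb : ∀ r ∈ Ico (0 : ℝ) 1,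
      ‖(τ' (a + r * χ) * χ - τ' a * χ) - (τ' (b + r * ω) * ω - τ' b * ω)‖ ≤
      C * (|χ| + |ω|) * |χ - ω| + C * (2 * |a - b| + |χ - ω|) * |χ| * |χ| := by
    intro r hr
    have hr0 := hr.1
    have hr1 := hr.2.le
    have e : (τ' (a + r * χ) * χ - τ' a * χ) - (τ' (b + r * ω) * ω - τ' b * ω) =
        (τ' (a + r * χ) - τ' a - (τ' (b + r * ω) - τ' b)) * χ +
        (τ' (b + r * ω) - τ' b) * (χ - ω) := by ring
    rw [e, Real.norm_eq_abs]
    refine (abs_add_le _ _).trans ?_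
    rw [abs_mul, abs_mul]
    have h1 := h'.four_le (a + r * χ) a (b + r * ω) b
    have h2 := h.lip (b + r * ω) b
    simp only [add_sub_cancel_left] at h1 h2
    rw [← mul_sub, abs_mul, abs_mul, abs_of_nonneg hr0] at h1
    rw [abs_mul, abs_of_nonneg hr0] at h2
    have h3 : |a + r * χ - (b + r * ω)| ≤ |a - b| + |χ - ω| := by
      have e2 : a + r * χ - (b + r * ω) = (a - b) + r * (χ - ω) := by ring
      rw [e2]
      refine (abs_add_le _ _).trans (add_le_add_right ?_ _)
      rw [abs_mul, abs_of_nonneg hr0]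
      exact mul_le_of_le_one_left (abs_nonneg _) hr1
    have h4 : r * |χ - ω| ≤ |χ - ω| := mul_le_of_le_one_left (abs_nonneg _) hr1
    have h5 : r * |χ| ≤ |χ| := mul_le_of_le_one_left (abs_nonneg _) hr1
    have h6 : r * |ω| ≤ |ω| := mul_le_of_le_one_left (abs_nonneg _) hr1
    have h7 : |τ' (a + r * χ) - τ' a - (τ' (b + r * ω) - τ' b)| ≤
        C * |χ - ω| + C * (2 * |a - b| + |χ - ω|) * |χ| := by
      refine h1.trans ?_
      have : 0 ≤ r * |χ| := by positivity
      have e3 : |a + r * χ - (b + r * ω)| + |a - b| ≤ 2 * |a - b| + |χ - ω| := by linarith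
      gcongr
    have h8 : |τ' (b + r * ω) - τ' b| ≤ C * |ω| := h2.trans (by gcongr)
    calc _ ≤ (C * |χ - ω| + C * (2 * |a - b| + |χ - ω|) * |χ|) * |χ| + C * |ω| * |χ - ω| := by
          gcongr
      _ = _ := by ring
  have := norm_image_sub_le_of_norm_deriv_le_segment_01' hd hb
  simp only [one_mul, zero_mul, add_zero, Real.norm_eq_abs] at this
  convert this using 2
  ring

end DerivLipschitz

/-! ## Nonlinearities on `L^p` -/

section Nonlinear

variable {n p : ℕ}

/-- Quantitative form of membership in `𝒳_3`, without the derivatives in space. -/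
structure RegularField (σ : Space n → ℝ → ℝ) (C : ℝ) : Prop where
  support : ∃ M : ℝ, ∀ ξ, M < ‖ξ‖ → ∀ η, σ ξ η = 0
  measurable : Measurable (Function.uncurry σ)
  measurable_deriv : Measurable (Function.uncurry fun ξ η => deriv (σ ξ) η)
  abs_le : ∀ ξ η, |σ ξ η| ≤ C
  first : ∀ ξ, DerivLipschitz (σ ξ) (deriv (σ ξ)) C
  second : ∀ ξ, DerivLipschitz (deriv (σ ξ)) (deriv (deriv (σ ξ))) C

/-- Lipschitz bounds come from the next derivative. Joint measurability is the Carathéodory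
criterion: continuity in η, and measurability in ξ from differentiability. -/
theorem ClassX.exists_regularField {σ : Space n → ℝ → ℝ} (h : ClassX 3 σ) :
    ∃ C, RegularField σ C := by
  obtain ⟨C, hC⟩ := h.bound
  have e2 : ∀ f : ℝ → ℝ, iteratedDeriv 2 f = deriv (deriv f) := fun f => by
    rw [iteratedDeriv_succ, iteratedDeriv_one]
  have e3 : ∀ f : ℝ → ℝ, iteratedDeriv 3 f = deriv (deriv (deriv f)) := fun f => by
    rw [iteratedDeriv_succ, e2]
  have b0 : ∀ ξ η, |σ ξ η| ≤ C := fun ξ η => by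
    simpa [iteratedDeriv_zero] using (hC ξ η).1 0 (by norm_num)
  have b1 : ∀ ξ η, |deriv (σ ξ) η| ≤ C := fun ξ η => by
    simpa using (hC ξ η).1 1 (by norm_num)
  have b2 : ∀ ξ η, |deriv (deriv (σ ξ)) η| ≤ C := fun ξ η => by
    simpa [e2] using (hC ξ η).1 2 (by norm_num)
  have b3 : ∀ ξ η, |deriv (deriv (deriv (σ ξ))) η| ≤ C := fun ξ η => by
    simpa [e3] using (hC ξ η).1 3 (by norm_num)
  have d0 : ∀ ξ, Differentiable ℝ (σ ξ) := fun ξ => (h.smooth ξ).differentiable (by norm_num)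
  have d1 : ∀ ξ, Differentiable ℝ (deriv (σ ξ)) := fun ξ => by
    simpa using (h.smooth ξ).differentiable_iteratedDeriv 1 (by norm_num)
  have d2 : ∀ ξ, Differentiable ℝ (deriv (deriv (σ ξ))) := fun ξ => by
    rw [← e2]
    exact (h.smooth ξ).differentiable_iteratedDeriv 2 (by norm_num)
  have lip : ∀ τ : ℝ → ℝ, Differentiable ℝ τ → (∀ η, |deriv τ η| ≤ C) →
      ∀ a b, |τ a - τ b| ≤ C * |a - b| := fun τ hτ hb a b =>
    Convex.norm_image_sub_le_of_norm_deriv_le (fun x _ => hτ x) (fun x _ => hb x) convex_univ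
      (mem_univ b) (mem_univ a)
  refine ⟨C, h.support, ?_, ?_, b0,
    fun ξ => ⟨fun a => (d0 ξ a).hasDerivAt, b1 ξ, lip _ (d1 ξ) (b2 ξ)⟩,
    fun ξ => ⟨fun a => (d1 ξ a).hasDerivAt, b2 ξ, lip _ (d2 ξ) (b3 ξ)⟩⟩
  · have := measurable_uncurry_of_continuous_of_measurable (u := fun (η : ℝ) (ξ : Space n) => σ ξ η)
      (fun ξ => (d0 ξ).continuous)
      (fun η => by simpa using (h.diff 0 (by norm_num) η).continuous.measurable)
    exact this.comp measurable_swap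
  · have := measurable_uncurry_of_continuous_of_measurable
      (u := fun (η : ℝ) (ξ : Space n) => deriv (σ ξ) η)
      (fun ξ => (d1 ξ).continuous)
      (fun η => by simpa using (h.diff 1 (by norm_num) η).continuous.measurable)
    exact this.comp measurable_swap

theorem coeFn_classOf {g : Space n → ℝ} (h : MemLp g (p : ℝ≥0∞) volume) :
    classOf p g =ᵐ[volume] g := by
  rw [classOf, dif_pos h]
  exact h.coeFn_toLp

theorem measurable_coe (φ : LpSpace n p) : AEMeasurable φ volume :=
  (Lp.aestronglyMeasurable φ).aemeasurable

/-- Monotonicity of the L^p norm and the triangle inequality. Four terms are enough for all the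
estimates below; missing ones are filled with 0. -/
theorem norm_le_of_ae_le_sum {F g₁ g₂ g₃ g₄ : LpSpace n p} {c₁ c₂ c₃ c₄ : ℝ}
    [Fact (1 ≤ (p : ℝ≥0∞))] (h₁ : 0 ≤ c₁) (h₂ : 0 ≤ c₂) (h₃ : 0 ≤ c₃) (h₄ : 0 ≤ c₄)
    (h : ∀ᵐ ξ, |F ξ| ≤ c₁ * |g₁ ξ| + c₂ * |g₂ ξ| + c₃ * |g₃ ξ| + c₄ * |g₄ ξ|) :
    ‖F‖ ≤ c₁ * ‖g₁‖ + c₂ * ‖g₂‖ + c₃ * ‖g₃‖ + c₄ * ‖g₄‖ := by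
  have h1 : ‖F‖ ≤ ‖c₁ • |g₁| + c₂ • |g₂| + c₃ • |g₃| + c₄ • |g₄|‖ := by
    refine Lp.norm_le_norm_of_ae_le ?_
    filter_upwards [h, Lp.coeFn_abs g₁, Lp.coeFn_abs g₂, Lp.coeFn_abs g₃, Lp.coeFn_abs g₄,
      Lp.coeFn_smul c₁ |g₁|, Lp.coeFn_smul c₂ |g₂|, Lp.coeFn_smul c₃ |g₃|, Lp.coeFn_smul c₄ |g₄|,
      Lp.coeFn_add (c₁ • |g₁|) (c₂ • |g₂|), Lp.coeFn_add (c₁ • |g₁| + c₂ • |g₂|) (c₃ • |g₃|),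
      Lp.coeFn_add (c₁ • |g₁| + c₂ • |g₂| + c₃ • |g₃|) (c₄ • |g₄|)]
      with ξ h a1 a2 a3 a4 b1 b2 b3 b4 e1 e2 e3
    rw [e3, Pi.add_apply, e2, Pi.add_apply, e1, Pi.add_apply, b1, b2, b3, b4]
    simp only [Pi.smul_apply, smul_eq_mul, a1, a2, a3, a4]
    exact h.trans (le_abs_self _)
  refine h1.trans ?_
  refine (norm_add_le _ _).trans (add_le_add ((norm_add_le _ _).trans (add_le_add
    ((norm_add_le _ _).trans (add_le_add ?_ ?_)) ?_)) ?_) <;>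
  · rw [norm_smul, norm_abs_eq_norm, Real.norm_of_nonneg (by assumption)]

namespace RegularField

variable {σ : Space n → ℝ → ℝ} {C : ℝ}

theorem nonneg (h : RegularField σ C) : 0 ≤ C := (h.first 0).nonneg

theorem mono {C' : ℝ} (h : RegularField σ C) (hC : C ≤ C') : RegularField σ C' := by
  have key : ∀ τ τ' : ℝ → ℝ, DerivLipschitz τ τ' C → DerivLipschitz τ τ' C' := fun τ τ' h =>
    ⟨h.hasDerivAt, fun a => (h.bound a).trans hC, fun a b =>
      (h.lip a b).trans (mul_le_mul_of_nonneg_right hC (abs_nonneg _))⟩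
  exact ⟨h.support, h.measurable, h.measurable_deriv, fun ξ η => (h.abs_le ξ η).trans hC,
    fun ξ => key _ _ (h.first ξ), fun ξ => key _ _ (h.second ξ)⟩

/-- C times the indicator of the supporting ball lies in L^p and dominates f(φ) for all φ at once;
this uniform bound is what keeps the growth of the scheme additive. -/
theorem exists_bound (h : RegularField σ C) :
    ∃ g : LpSpace n p, (∀ φ : LpSpace n p, ∀ᵐ ξ, |σ ξ (φ ξ)| ≤ |g ξ|) := by
  obtain ⟨M, hM⟩ := h.support
  have hm : MemLp ((Metric.closedBall (0 : Space n) M).indicator fun _ => C) (p : ℝ≥0∞) volume :=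
    memLp_indicator_const _ Metric.isClosed_closedBall.measurableSet _
      (Or.inr (isCompact_closedBall _ _).measure_lt_top.ne)
  refine ⟨hm.toLp _, fun φ => ?_⟩
  filter_upwards [hm.coeFn_toLp] with ξ hξ
  rw [hξ]
  by_cases hb : ‖ξ‖ ≤ M
  · rw [indicator_of_mem (by simpa using hb), abs_of_nonneg h.nonneg]
    exact h.abs_le _ _
  · rw [hM ξ (not_le.1 hb)]
    simp

theorem coeFn_field (h : RegularField σ C) (φ : LpSpace n p) :
    field σ φ =ᵐ[volume] fun ξ => σ ξ (φ ξ) := by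
  obtain ⟨g, hg⟩ := h.exists_bound (p := p)
  refine coeFn_classOf ((Lp.memLp g).mono ?_ (hg φ))
  exact (h.measurable.comp_aemeasurable
    (aemeasurable_id.prodMk (measurable_coe φ))).aestronglyMeasurable

theorem coeFn_mulDeriv (h : RegularField σ C) (χ φ : LpSpace n p) :
    mulDeriv σ χ φ =ᵐ[volume] fun ξ => χ ξ * deriv (σ ξ) (φ ξ) := by
  refine coeFn_classOf ((Lp.memLp χ).of_le_mul (c := C) ?_ (Eventually.of_forall fun ξ => ?_))
  · exact ((measurable_coe χ).mul (h.measurable_deriv.comp_aemeasurable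
      (aemeasurable_id.prodMk (measurable_coe φ)))).aestronglyMeasurable
  · rw [norm_mul, mul_comm]
    exact mul_le_mul_of_nonneg_right ((h.first ξ).bound _) (norm_nonneg _)

/-- Fundamental theorem of calculus at each ξ. The right-hand side is visibly in L^p, so `classOf`
is not at its default value, and the closed form lets the terms of f(y)^♯ telescope. -/
theorem taylorRem_eq (h : RegularField σ C) (φ χ : LpSpace n p) :
    taylorRem σ φ χ = field σ (φ + χ) - field σ φ - mulDeriv σ χ φ := by
  have key : (fun ξ => ∫ r in (0 : ℝ)..1,
      (deriv (σ ξ) (φ ξ + r * χ ξ) - deriv (σ ξ) (φ ξ)) * χ ξ) =ᵐ[volume]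
      ⇑(field σ (φ + χ) - field σ φ - mulDeriv σ χ φ) := by
    filter_upwards [h.coeFn_field (φ + χ), h.coeFn_field φ, h.coeFn_mulDeriv χ φ,
      Lp.coeFn_add φ χ, Lp.coeFn_sub (field σ (φ + χ) - field σ φ) (mulDeriv σ χ φ),
      Lp.coeFn_sub (field σ (φ + χ)) (field σ φ)] with ξ h1 h2 h3 h4 h5 h6
    rw [h5, Pi.sub_apply, h6, Pi.sub_apply, h1, h2, h3, h4, Pi.add_apply]
    have hd : ∀ r ∈ Set.uIcc (0 : ℝ) 1, HasDerivAt
        (fun r => σ ξ (φ ξ + r * χ ξ) - r * (deriv (σ ξ) (φ ξ) * χ ξ))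
        ((deriv (σ ξ) (φ ξ + r * χ ξ) - deriv (σ ξ) (φ ξ)) * χ ξ) r := by
      intro r _
      have h2 : HasDerivAt (fun r : ℝ => φ ξ + r * χ ξ) (χ ξ) r := by
        simpa using ((hasDerivAt_id r).mul_const (χ ξ)).const_add (φ ξ)
      have h3 : HasDerivAt (fun r : ℝ => r * (deriv (σ ξ) (φ ξ) * χ ξ))
          (deriv (σ ξ) (φ ξ) * χ ξ) r := by
        simpa using (hasDerivAt_id r).mul_const (deriv (σ ξ) (φ ξ) * χ ξ)
      rw [sub_mul]
      exact (((h.first ξ).hasDerivAt _).comp r h2).sub h3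
    have hcont : Continuous (deriv (σ ξ)) :=
      continuous_iff_continuousAt.2 fun a => ((h.second ξ).hasDerivAt a).continuousAt
    rw [intervalIntegral.integral_eq_sub_of_hasDerivAt hd
      (Continuous.intervalIntegrable (by fun_prop) _ _)]
    simp only [one_mul, zero_mul, add_zero, sub_zero]
    ring
  rw [taylorRem, classOf, dif_pos ((memLp_congr_ae key).2 (Lp.memLp _))]
  rw [Lp.ext_iff]
  exact (MemLp.coeFn_toLp _).trans key

theorem mulDeriv_add (h : RegularField σ C) (χ χ' φ : LpSpace n p) :
    mulDeriv σ (χ + χ') φ = mulDeriv σ χ φ + mulDeriv σ χ' φ := by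
  rw [Lp.ext_iff]
  filter_upwards [h.coeFn_mulDeriv (χ + χ') φ, h.coeFn_mulDeriv χ φ, h.coeFn_mulDeriv χ' φ,
    Lp.coeFn_add χ χ', Lp.coeFn_add (mulDeriv σ χ φ) (mulDeriv σ χ' φ)] with ξ h1 h2 h3 h4 h5
  rw [h1, h5, Pi.add_apply, h2, h3, h4, Pi.add_apply, add_mul]

theorem mulDeriv_smul (h : RegularField σ C) (c : ℝ) (χ φ : LpSpace n p) :
    mulDeriv σ (c • χ) φ = c • mulDeriv σ χ φ := by
  rw [Lp.ext_iff]
  filter_upwards [h.coeFn_mulDeriv (c • χ) φ, h.coeFn_mulDeriv χ φ,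
    Lp.coeFn_smul c χ, Lp.coeFn_smul c (mulDeriv σ χ φ)] with ξ h1 h2 h4 h5
  rw [h1, h5, Pi.smul_apply, h2, h4, Pi.smul_apply, smul_eq_mul, smul_eq_mul, mul_assoc]

/-- `χ ↦ χ · f'(φ)` as a linear map. -/
noncomputable def mulDerivₗ (h : RegularField σ C) (φ : LpSpace n p) :
    LpSpace n p →ₗ[ℝ] LpSpace n p where
  toFun χ := mulDeriv σ χ φ
  map_add' χ χ' := h.mulDeriv_add χ χ' φ
  map_smul' c χ := h.mulDeriv_smul c χ φ

theorem mulDeriv_sum (h : RegularField σ C) {ι : Type*} (s : Finset ι) (χ : ι → LpSpace n p)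
    (φ : LpSpace n p) : mulDeriv σ (∑ j ∈ s, χ j) φ = ∑ j ∈ s, mulDeriv σ (χ j) φ :=
  map_sum (h.mulDerivₗ φ) χ s

theorem field_sup_le (h : RegularField σ C) (φ : LpSpace n p) : ∀ᵐ ξ, |field σ φ ξ| ≤ C := by
  filter_upwards [h.coeFn_field φ] with ξ h1
  rw [h1]
  exact h.abs_le _ _

end RegularField

end Nonlinear

/-! ### Estimates of the nonlinearities in the norm of L^p -/

namespace RegularField

variable {n p : ℕ} [Fact (1 ≤ (p : ℝ≥0∞))] {σ : Space n → ℝ → ℝ} {C : ℝ}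

theorem exists_norm_field_le (h : RegularField σ C) :
    ∃ K, 0 ≤ K ∧ ∀ φ : LpSpace n p, ‖field σ φ‖ ≤ K := by
  obtain ⟨g, hg⟩ := h.exists_bound (p := p)
  refine ⟨‖g‖, norm_nonneg g, fun φ => Lp.norm_le_norm_of_ae_le ?_⟩
  filter_upwards [hg φ, h.coeFn_field φ] with ξ h1 h2
  rw [h2]
  exact h1

omit [Fact (1 ≤ (p : ℝ≥0∞))] in
theorem field_sub_sup_le (h : RegularField σ C) {φ χ : LpSpace n p} {m : ℝ}
    (hm : ∀ᵐ ξ, |(φ - χ) ξ| ≤ m) : ∀ᵐ ξ, |(field σ φ - field σ χ) ξ| ≤ C * m := by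
  filter_upwards [h.coeFn_field φ, h.coeFn_field χ, hm, Lp.coeFn_sub φ χ,
    Lp.coeFn_sub (field σ φ) (field σ χ)] with ξ h1 h2 h3 h4 h5
  rw [h5, Pi.sub_apply, h1, h2]
  rw [h4, Pi.sub_apply] at h3
  exact ((h.first ξ).sub_le _ _).trans (mul_le_mul_of_nonneg_left h3 h.nonneg)

omit [Fact (1 ≤ (p : ℝ≥0∞))] in
theorem norm_field_sub_le (h : RegularField σ C) (φ χ : LpSpace n p) :
    ‖field σ φ - field σ χ‖ ≤ C * ‖φ - χ‖ := by
  refine Lp.norm_le_mul_norm_of_ae_le_mul ?_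
  filter_upwards [h.coeFn_field φ, h.coeFn_field χ, Lp.coeFn_sub φ χ,
    Lp.coeFn_sub (field σ φ) (field σ χ)] with ξ h1 h2 h4 h5
  rw [h5, Pi.sub_apply, h1, h2, h4, Pi.sub_apply]
  exact (h.first ξ).sub_le _ _

/-- In the cross term of the scalar estimate, one factor is measured in sup norm by m and the other
in L^p. -/
theorem norm_field_four_le (h : RegularField σ C) {y' y w' w : LpSpace n p} {m : ℝ}
    (hm' : ∀ᵐ ξ, |(y' - w') ξ| ≤ m) (hm : ∀ᵐ ξ, |(y - w) ξ| ≤ m) :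
    ‖field σ y' - field σ y - (field σ w' - field σ w)‖ ≤
      C * ‖y' - y - (w' - w)‖ + C * (m + m) * ‖y' - y‖ := by
  have hC := h.nonneg
  have hm0 : 0 ≤ m := by
    obtain ⟨ξ, hξ⟩ := hm.exists
    exact (abs_nonneg _).trans hξ
  have := norm_le_of_ae_le_sum (F := field σ y' - field σ y - (field σ w' - field σ w))
    (g₁ := y' - y - (w' - w)) (g₂ := y' - y) (g₃ := 0) (g₄ := 0) hC
    (by positivity : 0 ≤ C * (m + m)) le_rfl le_rfl ?_
  · simpa using this
  filter_upwards [h.coeFn_field y', h.coeFn_field y, h.coeFn_field w', h.coeFn_field w,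
    Lp.coeFn_sub y' y, Lp.coeFn_sub w' w, Lp.coeFn_sub y' w', Lp.coeFn_sub y w,
    Lp.coeFn_sub (y' - y) (w' - w), Lp.coeFn_sub (field σ y') (field σ y),
    Lp.coeFn_sub (field σ w') (field σ w),
    Lp.coeFn_sub (field σ y' - field σ y) (field σ w' - field σ w), hm', hm]
    with ξ f1 f2 f3 f4 a1 a2 a3 a4 a5 a6 a7 a8 b1 b2
  simp only [a8, a7, a6, a5, a4, a3, a2, a1, Pi.sub_apply, f1, f2, f3, f4] at b1 b2 ⊢
  refine ((h.first ξ).four_le _ _ _ _).trans ?_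
  have : C * (|y' ξ - w' ξ| + |y ξ - w ξ|) * |y' ξ - y ξ| ≤ C * (m + m) * |y' ξ - y ξ| := by
    gcongr
  linarith

omit [Fact (1 ≤ (p : ℝ≥0∞))] in
theorem norm_mulDeriv_le (h : RegularField σ C) (χ φ : LpSpace n p) :
    ‖mulDeriv σ χ φ‖ ≤ C * ‖χ‖ := by
  refine Lp.norm_le_mul_norm_of_ae_le_mul ?_
  filter_upwards [h.coeFn_mulDeriv χ φ] with ξ h1
  rw [h1, norm_mul, mul_comm]
  exact mul_le_mul_of_nonneg_right ((h.first ξ).bound _) (norm_nonneg _)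

theorem norm_mulDeriv_sub_le (h : RegularField σ C) {χ χ' φ φ' : LpSpace n p} {M : ℝ}
    (hM : ∀ᵐ ξ, |χ' ξ| ≤ M) :
    ‖mulDeriv σ χ φ - mulDeriv σ χ' φ'‖ ≤ C * ‖χ - χ'‖ + C * M * ‖φ - φ'‖ := by
  have hC := h.nonneg
  have hM0 : 0 ≤ M := by
    obtain ⟨ξ, hξ⟩ := hM.exists
    exact (abs_nonneg _).trans hξ
  have := norm_le_of_ae_le_sum (F := mulDeriv σ χ φ - mulDeriv σ χ' φ')
    (g₁ := χ - χ') (g₂ := φ - φ') (g₃ := 0) (g₄ := 0) hC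
    (by positivity : 0 ≤ C * M) le_rfl le_rfl ?_
  · simpa using this
  filter_upwards [h.coeFn_mulDeriv χ φ, h.coeFn_mulDeriv χ' φ', hM, Lp.coeFn_sub χ χ',
    Lp.coeFn_sub φ φ', Lp.coeFn_sub (mulDeriv σ χ φ) (mulDeriv σ χ' φ')]
    with ξ f1 f2 b a1 a2 a3
  simp only [a1, a2, a3, Pi.sub_apply, f1, f2]
  have e : χ ξ * deriv (σ ξ) (φ ξ) - χ' ξ * deriv (σ ξ) (φ' ξ) =
      deriv (σ ξ) (φ ξ) * (χ ξ - χ' ξ) + (deriv (σ ξ) (φ ξ) - deriv (σ ξ) (φ' ξ)) * χ' ξ := by ring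
  rw [e]
  refine (abs_add_le _ _).trans ?_
  rw [abs_mul, abs_mul]
  have h1 := (h.first ξ).bound (φ ξ)
  have h2 := (h.first ξ).lip (φ ξ) (φ' ξ)
  have h3 : |deriv (σ ξ) (φ ξ)| * |χ ξ - χ' ξ| ≤ C * |χ ξ - χ' ξ| := by gcongr
  have h4 : |deriv (σ ξ) (φ ξ) - deriv (σ ξ) (φ' ξ)| * |χ' ξ| ≤ C * |φ ξ - φ' ξ| * M := by gcongr
  linarith

theorem norm_mulDeriv_four_le (h : RegularField σ C) {y' y w' w b' b d' d : LpSpace n p}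
    {m m₁ M : ℝ}
    (hm' : ∀ᵐ ξ, |(y' - w') ξ| ≤ m) (hm : ∀ᵐ ξ, |(y - w) ξ| ≤ m)
    (hm₁ : ∀ᵐ ξ, |(b - d) ξ| ≤ m₁) (hM : ∀ᵐ ξ, |d ξ| ≤ M) :
    ‖mulDeriv σ b' y' - mulDeriv σ b y - (mulDeriv σ d' w' - mulDeriv σ d w)‖ ≤
      C * ‖b' - b - (d' - d)‖ + C * m * ‖b' - b‖ + C * (m₁ + M * (m + m)) * ‖y' - y‖
        + C * M * ‖y' - y - (w' - w)‖ := by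
  have hC := h.nonneg
  have hm0 : 0 ≤ m := by
    obtain ⟨ξ, hξ⟩ := hm.exists
    exact (abs_nonneg _).trans hξ
  have hm10 : 0 ≤ m₁ := by
    obtain ⟨ξ, hξ⟩ := hm₁.exists
    exact (abs_nonneg _).trans hξ
  have hM0 : 0 ≤ M := by
    obtain ⟨ξ, hξ⟩ := hM.exists
    exact (abs_nonneg _).trans hξ
  refine norm_le_of_ae_le_sum hC (by positivity) (by positivity) (by positivity) ?_
  filter_upwards [h.coeFn_mulDeriv b' y', h.coeFn_mulDeriv b y, h.coeFn_mulDeriv d' w',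
    h.coeFn_mulDeriv d w,
    Lp.coeFn_sub y' y, Lp.coeFn_sub w' w, Lp.coeFn_sub y' w', Lp.coeFn_sub y w,
    Lp.coeFn_sub (y' - y) (w' - w), Lp.coeFn_sub b' b, Lp.coeFn_sub d' d, Lp.coeFn_sub b d,
    Lp.coeFn_sub (b' - b) (d' - d),
    Lp.coeFn_sub (mulDeriv σ b' y') (mulDeriv σ b y),
    Lp.coeFn_sub (mulDeriv σ d' w') (mulDeriv σ d w),
    Lp.coeFn_sub (mulDeriv σ b' y' - mulDeriv σ b y) (mulDeriv σ d' w' - mulDeriv σ d w),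
    hm', hm, hm₁, hM]
    with ξ f1 f2 f3 f4 a1 a2 a3 a4 a5 a6 a7 a8 a9 a10 a11 a12 b1 b2 b3 b4
  simp only [a12, a11, a10, a9, a8, a7, a6, a5, a4, a3, a2, a1, Pi.sub_apply, f1, f2, f3, f4]
    at b1 b2 b3 b4 ⊢
  set c := deriv (σ ξ)
  -- A product rule for second differences, arranged so that only d and b - d, which are bounded in
  -- sup norm, multiply increments of c.
  have e : b' ξ * c (y' ξ) - b ξ * c (y ξ) - (d' ξ * c (w' ξ) - d ξ * c (w ξ)) =
      c (w' ξ) * (b' ξ - b ξ - (d' ξ - d ξ)) + (c (y' ξ) - c (w' ξ)) * (b' ξ - b ξ)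
      + (b ξ - d ξ) * (c (y' ξ) - c (y ξ))
      + d ξ * (c (y' ξ) - c (y ξ) - (c (w' ξ) - c (w ξ))) := by ring
  rw [e]
  refine (abs_add_le _ _).trans ?_
  refine (add_le_add_left ((abs_add_le _ _).trans (add_le_add_left (abs_add_le _ _) _)) _).trans ?_
  rw [abs_mul, abs_mul, abs_mul, abs_mul]
  have g1 := (h.first ξ).bound (w' ξ)
  have g2 : |c (y' ξ) - c (w' ξ)| ≤ C * m :=
    ((h.first ξ).lip _ _).trans (mul_le_mul_of_nonneg_left b1 hC)
  have g3 := (h.first ξ).lip (y' ξ) (y ξ)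
  have g4 : |c (y' ξ) - c (y ξ) - (c (w' ξ) - c (w ξ))| ≤
      C * |y' ξ - y ξ - (w' ξ - w ξ)| + C * (m + m) * |y' ξ - y ξ| := by
    refine ((h.second ξ).four_le _ _ _ _).trans ?_
    gcongr
  calc _ ≤ C * |b' ξ - b ξ - (d' ξ - d ξ)| + C * m * |b' ξ - b ξ| + m₁ * (C * |y' ξ - y ξ|)
        + M * (C * |y' ξ - y ξ - (w' ξ - w ξ)| + C * (m + m) * |y' ξ - y ξ|) := by gcongr
    _ = _ := by ring

/-- First order expansion of the vector field, where the increment is the sum of a small part `χ₁`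
and of a bounded part `χ₂`. -/
theorem norm_field_expansion_le (h : RegularField σ C) {y χ₁ χ₂ : LpSpace n p} {M : ℝ}
    (hM : ∀ᵐ ξ, |χ₂ ξ| ≤ M) :
    ‖field σ (y + χ₂ + χ₁) - field σ y - mulDeriv σ χ₂ y‖ ≤ C * ‖χ₁‖ + C * M * ‖χ₂‖ := by
  have hC := h.nonneg
  have hM0 : 0 ≤ M := by
    obtain ⟨ξ, hξ⟩ := hM.exists
    exact (abs_nonneg _).trans hξ
  have := norm_le_of_ae_le_sum (F := field σ (y + χ₂ + χ₁) - field σ y - mulDeriv σ χ₂ y)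
    (g₁ := χ₁) (g₂ := χ₂) (g₃ := 0) (g₄ := 0) hC
    (by positivity : 0 ≤ C * M) le_rfl le_rfl ?_
  · simpa using this
  filter_upwards [h.coeFn_field (y + χ₂ + χ₁), h.coeFn_field y, h.coeFn_mulDeriv χ₂ y,
    Lp.coeFn_add y χ₂, Lp.coeFn_add (y + χ₂) χ₁,
    Lp.coeFn_sub (field σ (y + χ₂ + χ₁)) (field σ y),
    Lp.coeFn_sub (field σ (y + χ₂ + χ₁) - field σ y) (mulDeriv σ χ₂ y), hM]
    with ξ f1 f2 f3 a1 a2 a3 a4 b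
  simp only [a1, a2, a3, a4, Pi.add_apply, Pi.sub_apply, f1, f2, f3]
  have g1 := (h.first ξ).sub_le (y ξ + χ₂ ξ + χ₁ ξ) (y ξ + χ₂ ξ)
  rw [add_sub_cancel_left] at g1
  have g2 := (h.first ξ).taylor_le (y ξ) (χ₂ ξ)
  have g3 : C * |χ₂ ξ| * |χ₂ ξ| ≤ C * M * |χ₂ ξ| := by gcongr
  rw [mul_comm (χ₂ ξ)]
  have e : σ ξ (y ξ + χ₂ ξ + χ₁ ξ) - σ ξ (y ξ) - deriv (σ ξ) (y ξ) * χ₂ ξ =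
      (σ ξ (y ξ + χ₂ ξ + χ₁ ξ) - σ ξ (y ξ + χ₂ ξ)) +
      (σ ξ (y ξ + χ₂ ξ) - σ ξ (y ξ) - deriv (σ ξ) (y ξ) * χ₂ ξ) := by ring
  rw [e]
  have := abs_add_le (σ ξ (y ξ + χ₂ ξ + χ₁ ξ) - σ ξ (y ξ + χ₂ ξ))
    (σ ξ (y ξ + χ₂ ξ) - σ ξ (y ξ) - deriv (σ ξ) (y ξ) * χ₂ ξ)
  linarith [abs_nonneg (χ₁ ξ)]

/-- The difference of two first order expansions: `four_le` handles the small parts χ₁, ω₁, and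
`taylor_sub_le` the bounded parts χ₂, ω₂, whose squares are finite in L^p thanks to M. -/
theorem norm_field_expansion_sub_le (h : RegularField σ C)
    {y χ₁ χ₂ w ω₁ ω₂ : LpSpace n p} {m m' m₂ M : ℝ}
    (hm' : ∀ᵐ ξ, |((y + χ₂ + χ₁) - (w + ω₂ + ω₁)) ξ| ≤ m') (hm : ∀ᵐ ξ, |(y - w) ξ| ≤ m)
    (hm₂ : ∀ᵐ ξ, |(χ₂ - ω₂) ξ| ≤ m₂)
    (hM : ∀ᵐ ξ, |χ₂ ξ| ≤ M) (hM' : ∀ᵐ ξ, |ω₂ ξ| ≤ M) :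
    ‖(field σ (y + χ₂ + χ₁) - field σ y - mulDeriv σ χ₂ y) -
        (field σ (w + ω₂ + ω₁) - field σ w - mulDeriv σ ω₂ w)‖ ≤
      C * ‖χ₁ - ω₁‖ + C * (m' + (m + m₂)) * ‖χ₁‖ + C * (M + M) * ‖χ₂ - ω₂‖
        + C * (2 * m + m₂) * M * ‖χ₂‖ := by
  have hC := h.nonneg
  obtain ⟨ξ₀, n1, n2, n3, n4⟩ := (hm'.and (hm.and (hm₂.and hM))).exists
  have hm0' : 0 ≤ m' := (abs_nonneg _).trans n1
  have hm0 : 0 ≤ m := (abs_nonneg _).trans n2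
  have hm20 : 0 ≤ m₂ := (abs_nonneg _).trans n3
  have hM0 : 0 ≤ M := (abs_nonneg _).trans n4
  refine norm_le_of_ae_le_sum hC (by positivity) (by positivity) (by positivity) ?_
  filter_upwards [h.coeFn_field (y + χ₂ + χ₁), h.coeFn_field y, h.coeFn_mulDeriv χ₂ y,
    Lp.coeFn_add y χ₂, Lp.coeFn_add (y + χ₂) χ₁,
    Lp.coeFn_sub (field σ (y + χ₂ + χ₁)) (field σ y),
    Lp.coeFn_sub (field σ (y + χ₂ + χ₁) - field σ y) (mulDeriv σ χ₂ y), hM,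
    h.coeFn_field (w + ω₂ + ω₁), h.coeFn_field w, h.coeFn_mulDeriv ω₂ w,
    Lp.coeFn_add w ω₂, Lp.coeFn_add (w + ω₂) ω₁,
    Lp.coeFn_sub (field σ (w + ω₂ + ω₁)) (field σ w),
    Lp.coeFn_sub (field σ (w + ω₂ + ω₁) - field σ w) (mulDeriv σ ω₂ w), hM',
    Lp.coeFn_sub (field σ (y + χ₂ + χ₁) - field σ y - mulDeriv σ χ₂ y)
      (field σ (w + ω₂ + ω₁) - field σ w - mulDeriv σ ω₂ w),
    hm', hm, hm₂, Lp.coeFn_sub (y + χ₂ + χ₁) (w + ω₂ + ω₁), Lp.coeFn_sub y w,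
    Lp.coeFn_sub χ₂ ω₂, Lp.coeFn_sub χ₁ ω₁]
    with ξ f1 f2 f3 a1 a2 a3 a4 b f1' f2' f3' a1' a2' a3' a4' b' a5 c1 c2 c3 a6 a7 a8 a9
  simp only [a1, a2, a3, a4, a1', a2', a3', a4', a5, a6, a7, a8, a9, Pi.add_apply, Pi.sub_apply,
    f1, f2, f3, f1', f2', f3'] at c1 c2 c3 ⊢
  have g1 := (h.first ξ).four_le (y ξ + χ₂ ξ + χ₁ ξ) (y ξ + χ₂ ξ) (w ξ + ω₂ ξ + ω₁ ξ) (w ξ + ω₂ ξ)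
  simp only [add_sub_cancel_left] at g1
  have g2 := (h.first ξ).taylor_sub_le (h.second ξ) (y ξ) (χ₂ ξ) (w ξ) (ω₂ ξ)
  have g3 : |y ξ + χ₂ ξ - (w ξ + ω₂ ξ)| ≤ m + m₂ := by
    rw [add_sub_add_comm]
    exact (abs_add_le _ _).trans (add_le_add c2 c3)
  have g4 : C * (|y ξ + χ₂ ξ + χ₁ ξ - (w ξ + ω₂ ξ + ω₁ ξ)| + |y ξ + χ₂ ξ - (w ξ + ω₂ ξ)|)
      * |χ₁ ξ| ≤ C * (m' + (m + m₂)) * |χ₁ ξ| := by gcongr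
  have g5 : C * (|χ₂ ξ| + |ω₂ ξ|) * |χ₂ ξ - ω₂ ξ| ≤ C * (M + M) * |χ₂ ξ - ω₂ ξ| := by gcongr
  have g6 : C * (2 * |y ξ - w ξ| + |χ₂ ξ - ω₂ ξ|) * |χ₂ ξ| * |χ₂ ξ| ≤
      C * (2 * m + m₂) * M * |χ₂ ξ| := by gcongr
  have e : (σ ξ (y ξ + χ₂ ξ + χ₁ ξ) - σ ξ (y ξ) - χ₂ ξ * deriv (σ ξ) (y ξ)) -
      (σ ξ (w ξ + ω₂ ξ + ω₁ ξ) - σ ξ (w ξ) - ω₂ ξ * deriv (σ ξ) (w ξ)) =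
      ((σ ξ (y ξ + χ₂ ξ + χ₁ ξ) - σ ξ (y ξ + χ₂ ξ)) -
        (σ ξ (w ξ + ω₂ ξ + ω₁ ξ) - σ ξ (w ξ + ω₂ ξ))) +
      ((σ ξ (y ξ + χ₂ ξ) - σ ξ (y ξ) - deriv (σ ξ) (y ξ) * χ₂ ξ) -
        (σ ξ (w ξ + ω₂ ξ) - σ ξ (w ξ) - deriv (σ ξ) (w ξ) * ω₂ ξ)) := by ring
  rw [e]
  refine (abs_add_le _ _).trans ?_
  linarith

end RegularField

/-! ## Bounds for the rough path -/

theorem exists_common_bound {ι : Type*} [Fintype ι] {P : ι → ℝ → Prop}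
    (hmono : ∀ i a b, a ≤ b → P i a → P i b) (h : ∀ i, ∃ c, 0 ≤ c ∧ P i c) :
    ∃ c, 0 ≤ c ∧ ∀ i, P i c := by
  choose c hc hP using h
  exact ⟨∑ i, c i, Finset.sum_nonneg fun i _ => hc i, fun i => hmono i _ _
    (Finset.single_le_sum (fun j _ => hc j) (Finset.mem_univ i)) (hP i)⟩

theorem rpow_le_mul_rpow {τ T a b : ℝ} (hτ : 0 ≤ τ) (hT : τ ≤ T) (ha : 0 < a) (hab : a ≤ b) :
    τ ^ b ≤ T ^ (b - a) * τ ^ a := by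
  rcases hτ.eq_or_lt with rfl | hτ
  · rw [Real.zero_rpow ha.ne', Real.zero_rpow (ha.trans_le hab).ne', mul_zero]
  · calc τ ^ b = τ ^ (b - a) * τ ^ a := by rw [← Real.rpow_add hτ, sub_add_cancel]
      _ ≤ _ := by gcongr

theorem rpow_mul_rpow_le {a b κ ρ : ℝ} (ha : 0 ≤ a) (hb : 0 ≤ b) (hκ : 0 < κ) (hρ : 0 < ρ) :
    a ^ κ * b ^ ρ ≤ (a + b) ^ (κ + ρ) := by
  rcases (add_nonneg ha hb).eq_or_lt with h | h
  · have h0 : a = 0 := by linarith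
    rw [h0, Real.zero_rpow hκ.ne', zero_mul]
    positivity
  · rw [Real.rpow_add h]
    gcongr <;> linarith

section Rough

variable {n p N : ℕ} {T : ℝ} [Fact (1 ≤ (p : ℝ≥0∞))]

theorem sub_time_nonneg {t s : Time T} (h : s ≤ t) : 0 ≤ (t : ℝ) - s := sub_nonneg.2 h

theorem sub_time_le (t s : Time T) : (t : ℝ) - s ≤ T := by
  linarith [t.2.2, s.2.1]

theorem aOp_eq {t s : Time T} (h : s ≤ t) (φ : LpSpace n p) :
    aOp t s φ = heatL ((t : ℝ) - s) φ - φ := by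
  rw [aOp, heat_eq_heatL (sub_time_nonneg h)]

theorem deltaHat2_eq (z : Time T → Time T → LpSpace n p) {t u s : Time T} (h : u ≤ t) :
    deltaHat2 z t u s = z t s - z t u - heatL ((t : ℝ) - u) (z u s) := by
  rw [deltaHat2, aOp_eq h]
  abel

theorem deltaHat1_eq (y : Time T → LpSpace n p) {t s : Time T} (h : s ≤ t) :
    deltaHat1 y t s = y t - heatL ((t : ℝ) - s) (y s) := by
  rw [deltaHat1, aOp_eq h]
  abel

/-- On a bounded time interval the exponent can be lowered; the diagonal, on which `MemC2Op` says
nothing quantitative, is covered by the vanishing of M there. -/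
theorem MemC2Op.exists_norm_le' {γ b : ℝ} {ν : LpSpace n p → ℝ≥0∞}
    {M : Time T → Time T → LpSpace n p →L[ℝ] LpSpace n p}
    (h : MemC2Op ν lebNorm γ (fun t s => M t s)) (hself : ∀ t φ, M t t φ = 0)
    (hT : 0 ≤ T) (hb : 0 < b) (hbγ : b ≤ γ) :
    ∃ c, 0 ≤ c ∧ ∀ t s : Time T, s ≤ t → ∀ φ, ν φ ≠ ∞ →
      ‖M t s φ‖ ≤ c * ((t : ℝ) - s) ^ b * (ν φ).toReal := by
  obtain ⟨-, C, hC⟩ := h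
  refine ⟨C * T ^ (γ - b), by positivity, fun t s hst φ hφ => ?_⟩
  have h0 := sub_time_nonneg hst
  have key : ‖M t s φ‖ ≤ C * ((t : ℝ) - s) ^ γ * (ν φ).toReal := by
    rcases hst.eq_or_lt with rfl | hlt
    · simp only [hself, norm_zero, sub_self]
      positivity
    · have h1 := hC t s hlt φ hφ
      have h2 := ENNReal.toReal_mono
        (ENNReal.mul_ne_top (ENNReal.mul_ne_top ENNReal.coe_ne_top ENNReal.ofReal_ne_top) hφ) h1
      simpa [lebNorm, ENNReal.toReal_mul, ENNReal.toReal_ofReal (Real.rpow_nonneg h0 γ)] using h2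
  refine key.trans (mul_le_mul_of_nonneg_right ?_ ENNReal.toReal_nonneg)
  rw [mul_assoc]
  exact mul_le_mul_of_nonneg_left (rpow_le_mul_rpow h0 (sub_time_le t s) hb hbγ) C.2

theorem MemC2Op.exists_norm_le {γ b : ℝ} {M : Time T → Time T → LpSpace n p →L[ℝ] LpSpace n p}
    (h : MemC2Op lebNorm lebNorm γ (fun t s => M t s)) (hself : ∀ t φ, M t t φ = 0)
    (hT : 0 ≤ T) (hb : 0 < b) (hbγ : b ≤ γ) :
    ∃ c, 0 ≤ c ∧ ∀ t s : Time T, s ≤ t → ∀ φ, ‖M t s φ‖ ≤ c * ((t : ℝ) - s) ^ b * ‖φ‖ := by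
  obtain ⟨c, hc, h⟩ := h.exists_norm_le' hself hT hb hbγ
  exact ⟨c, hc, fun t s hst φ => by simpa [lebNorm] using h t s hst φ (by simp [lebNorm])⟩

theorem MemC2Op.continuousOn {γ : ℝ} {M : Time T → Time T → LpSpace n p →L[ℝ] LpSpace n p}
    (h : MemC2Op lebNorm lebNorm γ (fun t s => M t s)) :
    ContinuousOn (fun q : Time T × Time T => M q.1 q.2) (simplex2 T) := by
  intro q₀ hq₀
  rw [ContinuousWithinAt, Metric.tendsto_nhds]
  intro r hr
  filter_upwards [h.1 q₀ hq₀ (r / 2).toNNReal (by simpa using hr)] with q hq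
  rw [dist_eq_norm]
  refine lt_of_le_of_lt (ContinuousLinearMap.opNorm_le_bound _ (by positivity) fun φ => ?_)
    (half_lt_self hr)
  have h1 := hq φ (by simp [lebNorm])
  have h2 := ENNReal.toReal_mono
    (ENNReal.mul_ne_top ENNReal.coe_ne_top (by simp [lebNorm])) h1
  rw [ENNReal.toReal_mul, ENNReal.coe_toReal, Real.coe_toNNReal _ (half_pos hr).le] at h2
  simpa [lebNorm] using h2

/-- Algebraic relations and bounds on `L^p` for a rough path above `x`. -/
structure RoughBounds (κ ρ ε c : ℝ) (x : Fin N → Time T → ℝ)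
    (X Xa : Fin N → Time T → Time T → LpSpace n p →L[ℝ] LpSpace n p)
    (XX : Fin N → Fin N → Time T → Time T → LpSpace n p →L[ℝ] LpSpace n p) : Prop where
  nonneg : 0 ≤ c
  X_split : ∀ i, ∀ t u s : Time T, s ≤ u → u ≤ t → ∀ φ,
    X i t s φ = X i t u φ + heatL ((t : ℝ) - u) (X i u s φ)
  XX_split : ∀ i j, ∀ t u s : Time T, s ≤ u → u ≤ t → ∀ φ,
    XX i j t s φ = XX i j t u φ + heatL ((t : ℝ) - u) (XX i j u s φ)
      + (x j u - x j s) • X i t u φ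
  X_eq : ∀ i, ∀ t s : Time T, s ≤ t → ∀ φ, X i t s φ = Xa i t s φ + (x i t - x i s) • φ
  comm_X : ∀ i, ∀ t s : Time T, s ≤ t → ∀ φ, X i t s (heatL ε φ) = heatL ε (X i t s φ)
  comm_XX : ∀ i j, ∀ t s : Time T, s ≤ t → ∀ φ,
    XX i j t s (heatL ε φ) = heatL ε (XX i j t s φ)
  x_le : ∀ i, ∀ t s : Time T, s ≤ t → |x i t - x i s| ≤ c * ((t : ℝ) - s) ^ κ
  X_le : ∀ i, ∀ t s : Time T, s ≤ t → ∀ φ, ‖X i t s φ‖ ≤ c * ((t : ℝ) - s) ^ κ * ‖φ‖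
  XX_le : ∀ i j, ∀ t s : Time T, s ≤ t → ∀ φ,
    ‖XX i j t s φ‖ ≤ c * ((t : ℝ) - s) ^ ρ * ‖φ‖
  Xa_le : ∀ i, ∀ t s : Time T, s ≤ t → ∀ φ,
    ‖Xa i t s (heatL ε φ)‖ ≤ c * ((t : ℝ) - s) ^ ρ * ‖φ‖

section

variable {γ κ ρ ε c : ℝ} {x : Fin N → Time T → ℝ}
  {X Xa : Fin N → Time T → Time T → LpSpace n p →L[ℝ] LpSpace n p}
  {XX : Fin N → Fin N → Time T → Time T → LpSpace n p →L[ℝ] LpSpace n p}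

/-- At coinciding times the relation δ̂X = 0 reads -X_{tt} = 0. -/
theorem HeatRoughPath.X_self (h : HeatRoughPath γ ε x X Xa XX) (i : Fin N) (t : Time T)
    (φ : LpSpace n p) : X i t t φ = 0 := by
  have := h.delta_X i t t t le_rfl le_rfl φ
  rw [deltaHat2_eq _ le_rfl] at this
  simpa [heatL_zero] using this

theorem HeatRoughPath.XX_self (h : HeatRoughPath γ ε x X Xa XX) (i j : Fin N) (t : Time T)
    (φ : LpSpace n p) : XX i j t t φ = 0 := by
  have := h.delta_XX i j t t t le_rfl le_rfl φ
  rw [deltaHat2_eq _ le_rfl] at this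
  simpa [heatL_zero] using this

theorem HeatRoughPath.Xa_self (h : HeatRoughPath γ ε x X Xa XX) (i : Fin N) (t : Time T)
    (φ : LpSpace n p) : Xa i t t φ = 0 := by
  have := h.X_eq i t t le_rfl φ
  rw [h.X_self, sub_self, zero_smul, add_zero] at this
  exact this.symm

/-- The regularity of x is read off from (δx) φ = Xφ - X^a φ for one fixed nonzero φ in the Bessel
space. -/
theorem HeatRoughPath.exists_x_le (h : HeatRoughPath γ ε x X Xa XX) (hT : 0 ≤ T)
    (hκ : 0 < κ) (hκγ : κ ≤ γ) (i : Fin N) :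
    ∃ c, 0 ≤ c ∧ ∀ t s : Time T, s ≤ t → |x i t - x i s| ≤ c * ((t : ℝ) - s) ^ κ := by
  obtain ⟨φ, hφ0, hφ⟩ := exists_ne_zero_besselNorm_ne_top (n := n) (p := p)
  obtain ⟨c₁, hc₁, h₁⟩ := (h.X_leb i).exists_norm_le (h.X_self i) hT hκ hκγ
  obtain ⟨c₂, hc₂, h₂⟩ := (h.Xa_bessel i).exists_norm_le' (b := κ) (h.Xa_self i) hT hκ
    (by linarith)
  have hpos : 0 < ‖φ‖ := norm_pos_iff.2 hφ0
  refine ⟨c₁ + c₂ * (besselNorm φ).toReal / ‖φ‖, by positivity, fun t s hst => ?_⟩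
  have h3 : ‖(x i t - x i s) • φ‖ ≤
      c₁ * ((t : ℝ) - s) ^ κ * ‖φ‖ + c₂ * ((t : ℝ) - s) ^ κ * (besselNorm φ).toReal := by
    rw [← sub_eq_of_eq_add' (h.X_eq i t s hst φ)]
    exact (norm_sub_le _ _).trans (add_le_add (h₁ t s hst φ) (h₂ t s hst φ hφ))
  rw [norm_smul, Real.norm_eq_abs] at h3
  refine le_of_mul_le_mul_right (h3.trans_eq ?_) hpos
  field_simp

/-- From here on only bounds on L^p are needed: X^a enters composed with S_ε, which turns its bound
on the Bessel space into one on L^p, of order 1 + γ ≥ ρ. -/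
theorem HeatRoughPath.exists_roughBounds (h : HeatRoughPath γ ε x X Xa XX)
    (hT : 0 ≤ T) (hε : 0 < ε) (hκ : 0 < κ) (hκγ : κ ≤ γ) (hρ : 0 < ρ) (hρ1 : ρ ≤ 1)
    (hρκ : ρ ≤ 2 * κ) : ∃ c, RoughBounds κ ρ ε c x X Xa XX := by
  have hmono : ∀ (a b τ r : ℝ), 0 ≤ τ → 0 ≤ r → a ≤ b → ∀ {w : ℝ}, w ≤ a * τ * r → w ≤ b * τ * r :=
    fun a b τ r hτ hr hab w hw => hw.trans (by gcongr)
  obtain ⟨c₁, hc₁, h₁⟩ := exists_common_bound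
    (P := fun i c => ∀ t s : Time T, s ≤ t → |x i t - x i s| ≤ c * ((t : ℝ) - s) ^ κ)
    (fun i a b hab H t s hst => (H t s hst).trans
      (mul_le_mul_of_nonneg_right hab (Real.rpow_nonneg (sub_time_nonneg hst) _)))
    (h.exists_x_le hT hκ hκγ)
  obtain ⟨c₂, hc₂, h₂⟩ := exists_common_bound
    (P := fun i c => ∀ t s : Time T, s ≤ t → ∀ φ, ‖X i t s φ‖ ≤ c * ((t : ℝ) - s) ^ κ * ‖φ‖)
    (fun i a b hab H t s hst φ => hmono a b _ _ (Real.rpow_nonneg (sub_time_nonneg hst) _)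
      (norm_nonneg _) hab (H t s hst φ))
    (fun i => (h.X_leb i).exists_norm_le (h.X_self i) hT hκ hκγ)
  obtain ⟨c₃, hc₃, h₃⟩ := exists_common_bound
    (P := fun (i : Fin N × Fin N) c => ∀ t s : Time T, s ≤ t → ∀ φ,
      ‖XX i.1 i.2 t s φ‖ ≤ c * ((t : ℝ) - s) ^ ρ * ‖φ‖)
    (fun i a b hab H t s hst φ => hmono a b _ _ (Real.rpow_nonneg (sub_time_nonneg hst) _)
      (norm_nonneg _) hab (H t s hst φ))
    (fun i => (h.XX_leb i.1 i.2).exists_norm_le (h.XX_self i.1 i.2) hT hρ (by linarith))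
  obtain ⟨K, hK⟩ := exists_besselNorm_heatL_le (n := n) (p := p) hε
  obtain ⟨c₄, hc₄, h₄⟩ := exists_common_bound
    (P := fun i c => ∀ t s : Time T, s ≤ t → ∀ φ,
      ‖Xa i t s (heatL ε φ)‖ ≤ c * ((t : ℝ) - s) ^ ρ * ‖φ‖)
    (fun i a b hab H t s hst φ => hmono a b _ _ (Real.rpow_nonneg (sub_time_nonneg hst) _)
      (norm_nonneg _) hab (H t s hst φ))
    (fun i => by
      obtain ⟨c, hc, H⟩ := (h.Xa_bessel i).exists_norm_le' (b := ρ) (h.Xa_self i) hT hρ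
        (by linarith)
      refine ⟨c * K, by positivity, fun t s hst φ => ?_⟩
      have htop : (K : ℝ≥0∞) * ‖φ‖ₑ ≠ ∞ := ENNReal.mul_ne_top ENNReal.coe_ne_top enorm_ne_top
      refine (H t s hst _ (ne_top_of_le_ne_top htop (hK φ))).trans ?_
      have h1 := ENNReal.toReal_mono htop (hK φ)
      rw [ENNReal.toReal_mul, ENNReal.coe_toReal, toReal_enorm] at h1
      have h0 := Real.rpow_nonneg (sub_time_nonneg hst) ρ
      calc _ ≤ c * ((t : ℝ) - s) ^ ρ * (K * ‖φ‖) := by gcongr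
        _ = _ := by ring)
  refine ⟨c₁ + c₂ + c₃ + c₄, by positivity, ?_, ?_, h.X_eq, ?_, ?_, ?_, ?_, ?_, ?_⟩
  · intro i t u s hsu hut φ
    have := h.delta_X i t u s hsu hut φ
    rw [deltaHat2_eq _ hut, sub_sub, sub_eq_zero] at this
    exact this
  · intro i j t u s hsu hut φ
    have := h.delta_XX i j t u s hsu hut φ
    rw [deltaHat2_eq _ hut, map_smul] at this
    rw [← this]
    abel
  · intro i t s hst φ
    rw [← heat_eq_heatL hε.le, h.comm_X i t s hst, heat_eq_heatL hε.le]
  · intro i j t s hst φ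
    rw [← heat_eq_heatL hε.le, h.comm_XX i j t s hst, heat_eq_heatL hε.le]
  · intro i t s hst
    have h0 := Real.rpow_nonneg (sub_time_nonneg hst) κ
    exact (h₁ i t s hst).trans (mul_le_mul_of_nonneg_right (by linarith) h0)
  · intro i t s hst φ
    exact hmono _ _ _ _ (Real.rpow_nonneg (sub_time_nonneg hst) _) (norm_nonneg _) (by linarith)
      (h₂ i t s hst φ)
  · intro i j t s hst φ
    exact hmono _ _ _ _ (Real.rpow_nonneg (sub_time_nonneg hst) _) (norm_nonneg _) (by linarith)
      (h₃ (i, j) t s hst φ)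
  · intro i t s hst φ
    exact hmono _ _ _ _ (Real.rpow_nonneg (sub_time_nonneg hst) _) (norm_nonneg _) (by linarith)
      (h₄ i t s hst φ)

end

end Rough

/-! ## Smooth maps between `L^p` spaces -/

section SmoothMap

variable {n p : ℕ} [Fact (1 ≤ (p : ℝ≥0∞))]

/-- Bounded Lipschitz maps of `L^p` whose differences are controlled on bounded increments. -/
structure SmoothMap (Φ : LpSpace n p → LpSpace n p) (D : ℝ) : Prop where
  nonneg : 0 ≤ D
  bound : ∀ y, ‖Φ y‖ ≤ D
  lip : ∀ y w, ‖Φ y - Φ w‖ ≤ D * ‖y - w‖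
  four : ∀ (y' y w' w : LpSpace n p) (m : ℝ), (∀ᵐ ξ, |(y' - w') ξ| ≤ m) →
    (∀ᵐ ξ, |(y - w) ξ| ≤ m) →
    ‖Φ y' - Φ y - (Φ w' - Φ w)‖ ≤ D * ‖y' - y - (w' - w)‖ + D * m * ‖y' - y‖

namespace SmoothMap

variable {Φ Ψ : LpSpace n p → LpSpace n p} {D E : ℝ}

theorem mono (h : SmoothMap Φ D) (hDE : D ≤ E) : SmoothMap Φ E where
  nonneg := h.nonneg.trans hDE
  bound y := (h.bound y).trans hDE
  lip y w := (h.lip y w).trans (by gcongr)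
  four y' y w' w m hm' hm := by
    have hm0 : 0 ≤ m := by
      obtain ⟨ξ, hξ⟩ := hm.exists
      exact (abs_nonneg _).trans hξ
    exact (h.four y' y w' w m hm' hm).trans (by gcongr)

theorem zero : SmoothMap (fun _ : LpSpace n p => (0 : LpSpace n p)) 0 :=
  ⟨le_rfl, by simp, by simp, by simp⟩

theorem add (h : SmoothMap Φ D) (h' : SmoothMap Ψ E) :
    SmoothMap (fun y => Φ y + Ψ y) (D + E) where
  nonneg := add_nonneg h.nonneg h'.nonneg
  bound y := norm_add_le_of_le (h.bound y) (h'.bound y)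
  lip y w := by
    rw [add_sub_add_comm, add_mul]
    exact norm_add_le_of_le (h.lip y w) (h'.lip y w)
  four y' y w' w m hm' hm := by
    rw [add_sub_add_comm, add_sub_add_comm, add_sub_add_comm]
    refine (norm_add_le_of_le (h.four y' y w' w m hm' hm) (h'.four y' y w' w m hm' hm)).trans_eq ?_
    ring

theorem sum {ι : Type*} (s : Finset ι) {Φ : ι → LpSpace n p → LpSpace n p} {D : ι → ℝ}
    (h : ∀ i, SmoothMap (Φ i) (D i)) : SmoothMap (fun y => ∑ i ∈ s, Φ i y) (∑ i ∈ s, D i) := by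
  classical
  induction s using Finset.induction_on with
  | empty => simpa using zero
  | insert a s ha ih =>
    simp only [Finset.sum_insert ha]
    exact (h a).add ih

/-- All three bounds pass through a linear operator, so the Hölder factor of the operator becomes a
factor of D. -/
theorem clm (h : SmoothMap Φ D) {b : ℝ} (hb : 0 ≤ b) {O : LpSpace n p →L[ℝ] LpSpace n p}
    (hO : ∀ φ, ‖O φ‖ ≤ b * ‖φ‖) : SmoothMap (fun y => O (Φ y)) (b * D) where
  nonneg := mul_nonneg hb h.nonneg
  bound y := (hO _).trans (mul_le_mul_of_nonneg_left (h.bound y) hb)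
  lip y w := by
    rw [← map_sub, mul_assoc]
    exact (hO _).trans (mul_le_mul_of_nonneg_left (h.lip y w) hb)
  four y' y w' w m hm' hm := by
    rw [← map_sub, ← map_sub, ← map_sub]
    refine ((hO _).trans (mul_le_mul_of_nonneg_left (h.four y' y w' w m hm' hm) hb)).trans_eq ?_
    ring

theorem heatL (h : SmoothMap Φ D) (t : ℝ) : SmoothMap (fun y => heatL t (Φ y)) D := by
  simpa using h.clm zero_le_one (O := RoughHeat.heatL t) fun φ => by simpa using norm_heatL_le t φ

end SmoothMap

/-- `(τ-field smoothed by the heat semigroup) · σ'(y)`. -/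
noncomputable def fieldDeriv (ε : ℝ) (σ τ : Space n → ℝ → ℝ) (y : LpSpace n p) : LpSpace n p :=
  mulDeriv σ (heatL ε (field τ y)) y

theorem RegularField.exists_smoothMap {σ : Space n → ℝ → ℝ} {C : ℝ} (h : RegularField σ C) :
    ∃ D, 0 ≤ D ∧ SmoothMap (field (p := p) σ) D := by
  obtain ⟨K, hK, hb⟩ := h.exists_norm_field_le (p := p)
  have hC := h.nonneg
  refine ⟨K + 2 * C, by positivity, by positivity, fun y => (hb y).trans (by linarith),
    fun y w => (h.norm_field_sub_le y w).trans ?_, fun y' y w' w m hm' hm =>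
    (h.norm_field_four_le hm' hm).trans ?_⟩
  · gcongr
    linarith
  · have hm0 : 0 ≤ m := by
      obtain ⟨ξ, hξ⟩ := hm.exists
      exact (abs_nonneg _).trans hξ
    rw [show C * (m + m) = (2 * C) * m by ring]
    gcongr <;> linarith

/-- S_ε contracts L^∞, so S_ε f_j(y) is bounded by C and its differences inherit sup bounds from
those of y; the four-point product estimate applies. -/
theorem RegularField.exists_smoothMap_fieldDeriv {σ τ : Space n → ℝ → ℝ} {C : ℝ}
    (h : RegularField σ C) (h' : RegularField τ C) {ε : ℝ} (hε : 0 < ε) :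
    ∃ D, 0 ≤ D ∧ SmoothMap (fieldDeriv (p := p) ε σ τ) D := by
  obtain ⟨K, hK, hb⟩ := h'.exists_norm_field_le (p := p)
  have hC := h.nonneg
  have hsup : ∀ y : LpSpace n p, ∀ᵐ ξ, |heatL ε (field τ y) ξ| ≤ C := fun y =>
    heatL_sup_le hε (h'.field_sup_le y)
  have hlip : ∀ y w : LpSpace n p, ‖heatL ε (field τ y) - heatL ε (field τ w)‖ ≤ C * ‖y - w‖ := by
    intro y w
    rw [← map_sub]
    exact (norm_heatL_le _ _).trans (h'.norm_field_sub_le y w)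
  refine ⟨C * K + 6 * (C * C), by positivity, by positivity, fun y => ?_, fun y w => ?_,
    fun y' y w' w m hm' hm => ?_⟩
  · refine ((h.norm_mulDeriv_le _ _).trans (mul_le_mul_of_nonneg_left
      ((norm_heatL_le _ _).trans (hb y)) hC)).trans ?_
    linarith [mul_nonneg hC hC]
  · refine (h.norm_mulDeriv_sub_le (hsup w)).trans ?_
    calc _ ≤ C * (C * ‖y - w‖) + C * C * ‖y - w‖ := by gcongr; exact hlip y w
      _ ≤ C * K * ‖y - w‖ + 6 * (C * C) * ‖y - w‖ := by
        have : 0 ≤ C * K * ‖y - w‖ := by positivity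
        have : 0 ≤ C * C * ‖y - w‖ := by positivity
        linarith
      _ = _ := by ring
  · have hm0 : 0 ≤ m := by
      obtain ⟨ξ, hξ⟩ := hm.exists
      exact (abs_nonneg _).trans hξ
    have hm₁ : ∀ᵐ ξ, |(heatL ε (field τ y) - heatL ε (field τ w)) ξ| ≤ C * m := by
      rw [← map_sub]
      exact heatL_sup_le hε (h'.field_sub_sup_le hm)
    refine (h.norm_mulDeriv_four_le hm' hm hm₁ (hsup w)).trans ?_
    have hfour : ‖heatL ε (field τ y') - heatL ε (field τ y) -
        (heatL ε (field τ w') - heatL ε (field τ w))‖ ≤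
        C * ‖y' - y - (w' - w)‖ + C * (m + m) * ‖y' - y‖ := by
      rw [← map_sub, ← map_sub, ← map_sub]
      exact (norm_heatL_le _ _).trans (h'.norm_field_four_le hm' hm)
    set A := ‖y' - y - (w' - w)‖
    set B := ‖y' - y‖
    have hA : 0 ≤ A := norm_nonneg _
    have hB : 0 ≤ B := norm_nonneg _
    calc _ ≤ C * (C * A + C * (m + m) * B) + C * m * (C * B) + C * (C * m + C * (m + m)) * B
          + C * C * A := by gcongr; exact hlip y' y
      _ = 2 * (C * C * A) + 6 * (C * C * m * B) := by ring
      _ ≤ C * K * A + 6 * (C * C * A) + (C * K * m * B + 6 * (C * C * m * B)) := by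
        have : 0 ≤ C * K * A := by positivity
        have : 0 ≤ C * C * A := by positivity
        have : 0 ≤ C * K * m * B := by positivity
        linarith
      _ = _ := by ring

theorem exists_smoothMap_common {N : ℕ} {σ : Fin N → Space n → ℝ → ℝ} {C ε : ℝ}
    (hσ : ∀ i, RegularField (σ i) C) (hε : 0 < ε) :
    ∃ D, 0 ≤ D ∧ (∀ i, SmoothMap (field (p := p) (σ i)) D) ∧
      ∀ i j, SmoothMap (fieldDeriv (p := p) ε (σ i) (σ j)) D := by
  obtain ⟨D₁, hD₁, h₁⟩ := exists_common_bound
    (P := fun i D => SmoothMap (field (p := p) (σ i)) D) (fun i a b hab h => h.mono hab)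
    (fun i => (hσ i).exists_smoothMap)
  obtain ⟨D₂, hD₂, h₂⟩ := exists_common_bound
    (P := fun (i : Fin N × Fin N) D => SmoothMap (fieldDeriv (p := p) ε (σ i.1) (σ i.2)) D)
    (fun i a b hab h => h.mono hab)
    (fun i => (hσ i.1).exists_smoothMap_fieldDeriv (hσ i.2) hε)
  exact ⟨D₁ + D₂, by positivity, fun i => (h₁ i).mono (by linarith),
    fun i j => (h₂ (i, j)).mono (by linarith)⟩

end SmoothMap

/-! ## The numerical scheme -/

section Scheme

variable {n p N : ℕ} {T : ℝ} [Fact (1 ≤ (p : ℝ≥0∞))]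

/-- The state `S_s ψ + S_ε z`. -/
noncomputable def state (ε : ℝ) (ψ : LpSpace n p) (s : Time T) (z : LpSpace n p) : LpSpace n p :=
  heatL (s : ℝ) ψ + heatL ε z

/-- The local expansion `X^{x,i}_{ts} f_i(y) + X^{xx,ij}_{ts} (S_ε f_j(y) · f_i'(y))`. -/
noncomputable def expansion (ε : ℝ) (X : Fin N → Time T → Time T → LpSpace n p →L[ℝ] LpSpace n p)
    (XX : Fin N → Fin N → Time T → Time T → LpSpace n p →L[ℝ] LpSpace n p)
    (σ : Fin N → Space n → ℝ → ℝ) (t s : Time T) (y : LpSpace n p) : LpSpace n p :=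
  ∑ i, X i t s (field (σ i) y) + ∑ i, ∑ j, XX i j t s (fieldDeriv ε (σ i) (σ j) y)

/-- One step of the scheme, in terms of the variable `z`. -/
noncomputable def scheme (ε : ℝ) (X : Fin N → Time T → Time T → LpSpace n p →L[ℝ] LpSpace n p)
    (XX : Fin N → Fin N → Time T → Time T → LpSpace n p →L[ℝ] LpSpace n p)
    (σ : Fin N → Space n → ℝ → ℝ) (ψ : LpSpace n p) (t s : Time T) (z : LpSpace n p) :
    LpSpace n p :=
  heatL ((t : ℝ) - s) z + expansion ε X XX σ t s (state ε ψ s z)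

/-- The increment `(δx^j)_{us} f_j(y)`. -/
noncomputable def noise (x : Fin N → Time T → ℝ) (σ : Fin N → Space n → ℝ → ℝ)
    (u s : Time T) (y : LpSpace n p) : LpSpace n p :=
  ∑ j, (x j u - x j s) • field (σ j) y

/-- The part of higher order in the increments of the state. -/
noncomputable def correction (ε : ℝ)
    (Xa : Fin N → Time T → Time T → LpSpace n p →L[ℝ] LpSpace n p)
    (XX : Fin N → Fin N → Time T → Time T → LpSpace n p →L[ℝ] LpSpace n p)
    (σ : Fin N → Space n → ℝ → ℝ) (u s : Time T) (y : LpSpace n p) : LpSpace n p :=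
  ∑ j, Xa j u s (heatL ε (field (σ j) y))
    + heatL ε (∑ i, ∑ j, XX i j u s (fieldDeriv ε (σ i) (σ j) y))

variable {κ ρ ε c C : ℝ} {x : Fin N → Time T → ℝ}
  {X Xa : Fin N → Time T → Time T → LpSpace n p →L[ℝ] LpSpace n p}
  {XX : Fin N → Fin N → Time T → Time T → LpSpace n p →L[ℝ] LpSpace n p}
  {σ : Fin N → Space n → ℝ → ℝ} {ψ : LpSpace n p}

theorem state_sub (s : Time T) (a b : LpSpace n p) :
    state ε ψ s a - state ε ψ s b = heatL ε (a - b) := by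
  rw [state, state, add_sub_add_left_eq_sub, map_sub]

theorem RoughBounds.heatL_expansion (h : RoughBounds κ ρ ε c x X Xa XX) {u s : Time T}
    (hsu : s ≤ u) (y : LpSpace n p) : heatL ε (expansion ε X XX σ u s y) =
      heatL ε (noise x σ u s y) + correction ε Xa XX σ u s y := by
  rw [expansion, noise, correction, map_add, ← add_assoc]
  congr 1
  simp only [map_sum, map_smul, ← Finset.sum_add_distrib]
  refine Finset.sum_congr rfl fun i _ => ?_
  rw [← h.comm_X i u s hsu, h.X_eq i u s hsu, add_comm]

/-- Along one step the state changes by S_ε((δx) f), the leading part, and by terms of higher order: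
S_{u-s} - id, the X^a part and the second order part. -/
theorem RoughBounds.state_scheme (h : RoughBounds κ ρ ε c x X Xa XX) (hε : 0 ≤ ε) {u s : Time T}
    (hsu : s ≤ u) (a : LpSpace n p) : state ε ψ u (scheme ε X XX σ ψ u s a) =
      state ε ψ s a + heatL ε (noise x σ u s (state ε ψ s a)) +
        (heatL ((u : ℝ) - s) (state ε ψ s a) - state ε ψ s a
          + correction ε Xa XX σ u s (state ε ψ s a)) := by
  have h1 : state ε ψ u (scheme ε X XX σ ψ u s a) = heatL ((u : ℝ) - s) (state ε ψ s a)
      + heatL ε (expansion ε X XX σ u s (state ε ψ s a)) := by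
    rw [scheme, state, map_add, state, map_add, ← add_assoc, heatL_heatL (sub_time_nonneg hsu) s.2.1,
      sub_add_cancel, heatL_comm hε (sub_time_nonneg hsu)]
  rw [h1, h.heatL_expansion hsu]
  abel

/-- X is additive up to the semigroup, while XX leaves (δx^j)_{us} X_{tu}. This last term supplies
exactly the derivative term that turns f(y') - f(y) into a first order Taylor remainder. The
identity holds for arbitrary y and y'. -/
theorem RoughBounds.expansion_defect (h : RoughBounds κ ρ ε c x X Xa XX)
    (hσ : ∀ i, RegularField (σ i) C) {t u s : Time T} (hsu : s ≤ u) (hut : u ≤ t)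
    (y y' : LpSpace n p) :
    heatL ((t : ℝ) - u) (expansion ε X XX σ u s y) + expansion ε X XX σ t u y'
        - expansion ε X XX σ t s y =
      ∑ i, X i t u (field (σ i) y' - field (σ i) y
        - mulDeriv (σ i) (heatL ε (noise x σ u s y)) y) +
      ∑ i, ∑ j, XX i j t u (fieldDeriv ε (σ i) (σ j) y' - fieldDeriv ε (σ i) (σ j) y) := by
  have h1 : ∀ i, mulDeriv (σ i) (heatL ε (noise x σ u s y)) y =
      ∑ j, (x j u - x j s) • fieldDeriv ε (σ i) (σ j) y := by
    intro i
    rw [noise, map_sum, (hσ i).mulDeriv_sum]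
    refine Finset.sum_congr rfl fun j _ => ?_
    rw [map_smul, (hσ i).mulDeriv_smul, fieldDeriv]
  simp only [expansion, map_add, map_sum, h1, map_sub, map_smul, h.X_split _ t u s hsu hut,
    h.XX_split _ _ t u s hsu hut, Finset.sum_add_distrib, Finset.sum_sub_distrib]
  abel

theorem RoughBounds.scheme_defect (h : RoughBounds κ ρ ε c x X Xa XX)
    (hσ : ∀ i, RegularField (σ i) C) {t u s : Time T} (hsu : s ≤ u) (hut : u ≤ t)
    (a : LpSpace n p) :
    scheme ε X XX σ ψ t u (scheme ε X XX σ ψ u s a) - scheme ε X XX σ ψ t s a =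
      ∑ i, X i t u (field (σ i) (state ε ψ u (scheme ε X XX σ ψ u s a))
          - field (σ i) (state ε ψ s a)
          - mulDeriv (σ i) (heatL ε (noise x σ u s (state ε ψ s a))) (state ε ψ s a)) +
      ∑ i, ∑ j, XX i j t u (fieldDeriv ε (σ i) (σ j) (state ε ψ u (scheme ε X XX σ ψ u s a))
        - fieldDeriv ε (σ i) (σ j) (state ε ψ s a)) := by
  rw [← h.expansion_defect hσ hsu hut]
  set y' := state ε ψ u (scheme ε X XX σ ψ u s a) with hy'
  rw [scheme, scheme, scheme, map_add, heatL_heatL (sub_time_nonneg hut) (sub_time_nonneg hsu),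
    sub_add_sub_cancel, ← scheme, ← hy']
  abel

end Scheme

/-! ### Size of the increments of the state -/

section SchemeBounds

variable {n p N : ℕ} {T : ℝ} [Fact (1 ≤ (p : ℝ≥0∞))]

/-- The leading part of the increments of the state. -/
noncomputable def lead (ε : ℝ) (x : Fin N → Time T → ℝ) (σ : Fin N → Space n → ℝ → ℝ)
    (u s : Time T) (y : LpSpace n p) : LpSpace n p :=
  heatL ε (noise x σ u s y)

/-- The remaining part of the increments of the state. -/
noncomputable def rest (ε : ℝ)
    (Xa : Fin N → Time T → Time T → LpSpace n p →L[ℝ] LpSpace n p)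
    (XX : Fin N → Fin N → Time T → Time T → LpSpace n p →L[ℝ] LpSpace n p)
    (σ : Fin N → Space n → ℝ → ℝ) (u s : Time T) (y : LpSpace n p) : LpSpace n p :=
  heatL ((u : ℝ) - s) y - y + correction ε Xa XX σ u s y

variable {κ ρ ε c C : ℝ} {x : Fin N → Time T → ℝ}
  {X Xa : Fin N → Time T → Time T → LpSpace n p →L[ℝ] LpSpace n p}
  {XX : Fin N → Fin N → Time T → Time T → LpSpace n p →L[ℝ] LpSpace n p}
  {σ : Fin N → Space n → ℝ → ℝ} {ψ : LpSpace n p}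

theorem RoughBounds.exists_smoothMap_expansion (h : RoughBounds κ ρ ε c x X Xa XX)
    (hσ : ∀ i, RegularField (σ i) C) (hε : 0 < ε) (hT : 0 ≤ T) (hκ : 0 < κ) (hκρ : κ ≤ ρ) :
    ∃ K, 0 ≤ K ∧ ∀ t s : Time T, s ≤ t →
      SmoothMap (expansion ε X XX σ t s) (K * ((t : ℝ) - s) ^ κ) := by
  obtain ⟨D, hD, h₁, h₂⟩ := exists_smoothMap_common (p := p) hσ hε
  have hc := h.nonneg
  refine ⟨N * (c * D) + N * (N * (c * T ^ (ρ - κ) * D)), by positivity, fun t s hst => ?_⟩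
  have h0 := sub_time_nonneg hst
  refine ((SmoothMap.sum Finset.univ fun i => (h₁ i).clm (by positivity) (h.X_le i t s hst)).add
    (SmoothMap.sum Finset.univ fun i => SmoothMap.sum Finset.univ fun j =>
      (h₂ i j).clm (b := c * (T ^ (ρ - κ) * ((t : ℝ) - s) ^ κ)) (by positivity) fun φ =>
        (h.XX_le i j t s hst φ).trans ?_)).mono (le_of_eq ?_)
  · have := rpow_le_mul_rpow h0 (sub_time_le t s) hκ hκρ
    gcongr
  · simp
    ring

theorem RoughBounds.exists_smoothMap_noise (h : RoughBounds κ ρ ε c x X Xa XX)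
    (hσ : ∀ i, RegularField (σ i) C) (hε : 0 < ε) :
    ∃ K, 0 ≤ K ∧ ∀ t s : Time T, s ≤ t →
      SmoothMap (noise (p := p) x σ t s) (K * ((t : ℝ) - s) ^ κ) := by
  obtain ⟨D, hD, h₁, -⟩ := exists_smoothMap_common (p := p) hσ hε
  have hc := h.nonneg
  refine ⟨N * (c * D), by positivity, fun t s hst => ?_⟩
  have h0 := sub_time_nonneg hst
  refine (SmoothMap.sum Finset.univ fun i => (h₁ i).clm (b := c * ((t : ℝ) - s) ^ κ)
    (O := (x i t - x i s) • ContinuousLinearMap.id ℝ _) (by positivity) fun φ => ?_).mono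
      (le_of_eq ?_)
  · simp only [_root_.smul_apply, ContinuousLinearMap.id_apply, norm_smul,
      Real.norm_eq_abs]
    have := h.x_le i t s hst
    gcongr
  · simp
    ring

theorem RoughBounds.exists_smoothMap_correction (h : RoughBounds κ ρ ε c x X Xa XX)
    (hσ : ∀ i, RegularField (σ i) C) (hε : 0 < ε) :
    ∃ K, 0 ≤ K ∧ ∀ t s : Time T, s ≤ t →
      SmoothMap (correction ε Xa XX σ t s) (K * ((t : ℝ) - s) ^ ρ) := by
  obtain ⟨D, hD, h₁, h₂⟩ := exists_smoothMap_common (p := p) hσ hε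
  have hc := h.nonneg
  refine ⟨N * (c * D) + N * (N * (c * D)), by positivity, fun t s hst => ?_⟩
  have h0 := sub_time_nonneg hst
  refine ((SmoothMap.sum Finset.univ fun i => (h₁ i).clm (b := c * ((t : ℝ) - s) ^ ρ)
    (O := (Xa i t s).comp (heatL ε)) (by positivity) (h.Xa_le i t s hst)).add
    (SmoothMap.heatL (SmoothMap.sum Finset.univ fun i => SmoothMap.sum Finset.univ fun j =>
      (h₂ i j).clm (by positivity) (h.XX_le i j t s hst)) ε)).mono (le_of_eq ?_)
  simp
  ring

/-- The noise term is of order κ in L^p, and S_ε carries this over to the sup norm, both for the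
values and for the differences. -/
theorem RoughBounds.exists_lead_le (h : RoughBounds κ ρ ε c x X Xa XX)
    (hσ : ∀ i, RegularField (σ i) C) (hε : 0 < ε) :
    ∃ K, 0 ≤ K ∧ ∀ u s : Time T, s ≤ u → ∀ y w : LpSpace n p,
      ‖lead ε x σ u s y‖ ≤ K * ((u : ℝ) - s) ^ κ ∧
      (∀ᵐ ξ, |lead ε x σ u s y ξ| ≤ K * ((u : ℝ) - s) ^ κ) ∧
      ‖lead ε x σ u s y - lead ε x σ u s w‖ ≤ K * ((u : ℝ) - s) ^ κ * ‖y - w‖ ∧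
      ∀ᵐ ξ, |(lead ε x σ u s y - lead ε x σ u s w) ξ| ≤ K * ((u : ℝ) - s) ^ κ * ‖y - w‖ := by
  obtain ⟨K, hK, hn⟩ := h.exists_smoothMap_noise hσ hε
  obtain ⟨L, hL, hs⟩ := exists_sup_heatL_le (n := n) (p := p) hε
  refine ⟨K * (1 + L), by positivity, fun u s hsu y w => ?_⟩
  have h0 := Real.rpow_nonneg (sub_time_nonneg hsu) κ
  have hb := (hn u s hsu).bound y
  have hl := (hn u s hsu).lip y w
  have e : lead ε x σ u s y - lead ε x σ u s w = heatL ε (noise x σ u s y - noise x σ u s w) := by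
    rw [lead, lead, map_sub]
  rw [e]
  have h1 : K * ((u : ℝ) - s) ^ κ ≤ K * (1 + L) * ((u : ℝ) - s) ^ κ := by
    gcongr
    exact le_mul_of_one_le_right hK (by linarith)
  have h2 : ∀ r, 0 ≤ r → L * (K * ((u : ℝ) - s) ^ κ * r) ≤ K * (1 + L) * ((u : ℝ) - s) ^ κ * r := by
    intro r hr
    have : 0 ≤ K * ((u : ℝ) - s) ^ κ * r := by positivity
    linarith
  refine ⟨((norm_heatL_le _ _).trans hb).trans h1, ?_,
    ((norm_heatL_le _ _).trans hl).trans (by gcongr), ?_⟩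
  · filter_upwards [hs (noise x σ u s y)] with ξ hξ
    have := h2 1 zero_le_one
    rw [mul_one, mul_one] at this
    exact (hξ.trans (mul_le_mul_of_nonneg_left hb hL)).trans this
  · filter_upwards [hs (noise x σ u s y - noise x σ u s w)] with ξ hξ
    exact (hξ.trans (mul_le_mul_of_nonneg_left hl hL)).trans (h2 _ (norm_nonneg _))

/-- S_τ - id costs a factor τ on the Bessel space, which contains S_s ψ since ψ belongs to it, and
S_ε a by smoothing. In the difference of two states ψ cancels. -/
theorem exists_norm_heatL_state_sub_le (hψ : besselNorm ψ ≠ ∞) (hε : 0 < ε) :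
    ∃ K, 0 ≤ K ∧ ∀ (s : Time T) (a b : LpSpace n p) (τ : ℝ), 0 ≤ τ →
      ‖heatL τ (state ε ψ s a) - state ε ψ s a‖ ≤ K * (1 + ‖a‖) * τ ∧
      ‖heatL τ (heatL ε (a - b)) - heatL ε (a - b)‖ ≤ K * ‖a - b‖ * τ := by
  obtain ⟨L, hL⟩ := exists_besselNorm_heatL_le (n := n) (p := p) hε
  have htop : ∀ φ : LpSpace n p, (L : ℝ≥0∞) * ‖φ‖ₑ ≠ ∞ := fun φ =>
    ENNReal.mul_ne_top ENNReal.coe_ne_top enorm_ne_top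
  have hdiff : ∀ φ : LpSpace n p, ∀ τ, 0 ≤ τ →
      ‖heatL τ (heatL ε φ) - heatL ε φ‖ ≤ L * ‖φ‖ * τ := by
    intro φ τ hτ
    refine (norm_heatL_sub_le_besselNorm (ne_top_of_le_ne_top (htop φ) (hL φ)) hτ).trans ?_
    have := ENNReal.toReal_mono (htop φ) (hL φ)
    rw [ENNReal.toReal_mul, ENNReal.coe_toReal, toReal_enorm] at this
    rw [mul_comm]
    gcongr
  have hM : 0 ≤ (besselNorm ψ).toReal := ENNReal.toReal_nonneg
  refine ⟨(besselNorm ψ).toReal + L, by positivity, fun s a b τ hτ => ⟨?_, ?_⟩⟩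
  · have h1 : ‖heatL τ (heatL (s : ℝ) ψ) - heatL (s : ℝ) ψ‖ ≤ τ * (besselNorm ψ).toReal :=
      (norm_heatL_sub_le_besselNorm (ne_top_of_le_ne_top hψ (besselNorm_heatL_le _ _)) hτ).trans
        (mul_le_mul_of_nonneg_left (ENNReal.toReal_mono hψ (besselNorm_heatL_le _ _)) hτ)
    have h2 := hdiff a τ hτ
    rw [state, map_add, add_sub_add_comm]
    refine (norm_add_le_of_le h1 h2).trans ?_
    have h3 : 0 ≤ (besselNorm ψ).toReal * ‖a‖ * τ := by positivity
    have h4 : 0 ≤ L * τ := by positivity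
    linarith
  · refine (hdiff (a - b) τ hτ).trans ?_
    gcongr
    linarith

theorem RoughBounds.exists_rest_le (h : RoughBounds κ ρ ε c x X Xa XX)
    (hσ : ∀ i, RegularField (σ i) C) (hψ : besselNorm ψ ≠ ∞) (hε : 0 < ε) (hT : 0 ≤ T)
    (hρ : 0 < ρ) (hρ1 : ρ ≤ 1) :
    ∃ K, 0 ≤ K ∧ ∀ u s : Time T, s ≤ u → ∀ a b : LpSpace n p,
      ‖rest ε Xa XX σ u s (state ε ψ s a)‖ ≤ K * (1 + ‖a‖) * ((u : ℝ) - s) ^ ρ ∧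
      ‖rest ε Xa XX σ u s (state ε ψ s a) - rest ε Xa XX σ u s (state ε ψ s b)‖ ≤
        K * ‖a - b‖ * ((u : ℝ) - s) ^ ρ := by
  obtain ⟨K, hK, hc⟩ := h.exists_smoothMap_correction hσ hε
  obtain ⟨L, hL, hs⟩ := exists_norm_heatL_state_sub_le (T := T) hψ hε
  refine ⟨L * T ^ (1 - ρ) + K, by positivity, fun u s hsu a b => ?_⟩
  have h0 := sub_time_nonneg hsu
  have h1 : (u : ℝ) - s ≤ T ^ (1 - ρ) * ((u : ℝ) - s) ^ ρ := by
    simpa using rpow_le_mul_rpow h0 (sub_time_le u s) hρ hρ1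
  have hr := Real.rpow_nonneg h0 ρ
  obtain ⟨g1, g2⟩ := hs s a b _ h0
  constructor
  · rw [rest]
    refine (norm_add_le_of_le g1 ((hc u s hsu).bound _)).trans ?_
    calc _ ≤ L * (1 + ‖a‖) * (T ^ (1 - ρ) * ((u : ℝ) - s) ^ ρ)
          + K * (1 + ‖a‖) * ((u : ℝ) - s) ^ ρ := by
          gcongr
          exact le_mul_of_one_le_right hK (by linarith [norm_nonneg a])
      _ = _ := by ring
  · have e : rest ε Xa XX σ u s (state ε ψ s a) - rest ε Xa XX σ u s (state ε ψ s b) =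
        (heatL ((u : ℝ) - s) (heatL ε (a - b)) - heatL ε (a - b)) +
        (correction ε Xa XX σ u s (state ε ψ s a) - correction ε Xa XX σ u s (state ε ψ s b)) := by
      rw [rest, rest, ← state_sub (ψ := ψ) s a b, map_sub]
      abel
    rw [e]
    refine (norm_add_le_of_le g2 ((hc u s hsu).lip _ _)).trans ?_
    rw [state_sub]
    have := norm_heatL_le ε (a - b)
    calc _ ≤ L * ‖a - b‖ * (T ^ (1 - ρ) * ((u : ℝ) - s) ^ ρ)
          + K * ((u : ℝ) - s) ^ ρ * ‖a - b‖ := by gcongr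
      _ = _ := by ring

/-- Complementary exponents: X has order κ and meets terms of order ρ, XX has order ρ and meets
terms of order κ. -/
theorem RoughBounds.norm_expansion_le (h : RoughBounds κ ρ ε c x X Xa XX) (hκ : 0 < κ)
    (hρ : 0 < ρ) {t u s : Time T} (hsu : s ≤ u) (hut : u ≤ t) {B : Fin N → LpSpace n p}
    {H : Fin N → Fin N → LpSpace n p} {β : ℝ} (hβ : 0 ≤ β)
    (hB : ∀ i, ‖B i‖ ≤ β * ((u : ℝ) - s) ^ ρ) (hH : ∀ i j, ‖H i j‖ ≤ β * ((u : ℝ) - s) ^ κ) :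
    ‖∑ i, X i t u (B i) + ∑ i, ∑ j, XX i j t u (H i j)‖ ≤
      (N * c + N * (N * c)) * β * ((t : ℝ) - s) ^ (κ + ρ) := by
  have hc := h.nonneg
  have h0 := sub_time_nonneg hsu
  have h1 := sub_time_nonneg hut
  have e : (t : ℝ) - u + (u - s) = t - s := by ring
  have k1 : ∀ i, ‖X i t u (B i)‖ ≤ c * β * ((t : ℝ) - s) ^ (κ + ρ) := fun i => by
    have := rpow_mul_rpow_le h1 h0 hκ hρ
    rw [e] at this
    calc _ ≤ c * ((t : ℝ) - u) ^ κ * (β * ((u : ℝ) - s) ^ ρ) :=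
          (h.X_le i t u hut _).trans (by gcongr; exact hB i)
      _ = c * β * (((t : ℝ) - u) ^ κ * ((u : ℝ) - s) ^ ρ) := by ring
      _ ≤ _ := by gcongr
  have k2 : ∀ i j, ‖XX i j t u (H i j)‖ ≤ c * β * ((t : ℝ) - s) ^ (κ + ρ) := fun i j => by
    have := rpow_mul_rpow_le h1 h0 hρ hκ
    rw [e, add_comm ρ] at this
    calc _ ≤ c * ((t : ℝ) - u) ^ ρ * (β * ((u : ℝ) - s) ^ κ) :=
          (h.XX_le i j t u hut _).trans (by gcongr; exact hH i j)
      _ = c * β * (((t : ℝ) - u) ^ ρ * ((u : ℝ) - s) ^ κ) := by ring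
      _ ≤ _ := by gcongr
  refine (norm_add_le_of_le (norm_sum_le_of_le _ fun i _ => k1 i)
    (norm_sum_le_of_le _ fun i _ => norm_sum_le_of_le _ fun j _ => k2 i j)).trans_eq ?_
  simp
  ring

end SchemeBounds

/-! ### The scheme is an almost flow -/

section SchemeFlow

variable {n p N : ℕ} {T : ℝ} [Fact (1 ≤ (p : ℝ≥0∞))]

variable {κ ρ ε c C : ℝ} {x : Fin N → Time T → ℝ}
  {X Xa : Fin N → Time T → Time T → LpSpace n p →L[ℝ] LpSpace n p}
  {XX : Fin N → Fin N → Time T → Time T → LpSpace n p →L[ℝ] LpSpace n p}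
  {σ : Fin N → Space n → ℝ → ℝ} {ψ : LpSpace n p}

theorem RoughBounds.state_scheme_eq (h : RoughBounds κ ρ ε c x X Xa XX) (hε : 0 ≤ ε)
    {u s : Time T} (hsu : s ≤ u) (a : LpSpace n p) : state ε ψ u (scheme ε X XX σ ψ u s a) =
      state ε ψ s a + lead ε x σ u s (state ε ψ s a) + rest ε Xa XX σ u s (state ε ψ s a) :=
  h.state_scheme hε hsu a

theorem RoughBounds.exists_state_step_le (h : RoughBounds κ ρ ε c x X Xa XX)
    (hσ : ∀ i, RegularField (σ i) C) (hψ : besselNorm ψ ≠ ∞) (hε : 0 < ε) (hT : 0 ≤ T)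
    (hκ : 0 < κ) (hκρ : κ ≤ ρ) (hρ1 : ρ ≤ 1) :
    ∃ K, 0 ≤ K ∧ ∀ u s : Time T, s ≤ u → ∀ a b : LpSpace n p,
      ‖state ε ψ u (scheme ε X XX σ ψ u s a) - state ε ψ s a‖ ≤
        K * (1 + ‖a‖) * ((u : ℝ) - s) ^ κ ∧
      ‖state ε ψ u (scheme ε X XX σ ψ u s a) - state ε ψ s a
        - (state ε ψ u (scheme ε X XX σ ψ u s b) - state ε ψ s b)‖ ≤
        K * ‖a - b‖ * ((u : ℝ) - s) ^ κ := by
  obtain ⟨K₁, hK₁, hl⟩ := h.exists_lead_le (p := p) hσ hε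
  obtain ⟨K₂, hK₂, hr⟩ := h.exists_rest_le hσ hψ hε hT (hκ.trans_le hκρ) hρ1
  refine ⟨K₁ + K₂ * T ^ (ρ - κ), by positivity, fun u s hsu a b => ?_⟩
  have h0 := sub_time_nonneg hsu
  have hq := Real.rpow_nonneg h0 κ
  have hρκ := rpow_le_mul_rpow h0 (sub_time_le u s) hκ hκρ
  obtain ⟨l1, -, l3, -⟩ := hl u s hsu (state ε ψ s a) (state ε ψ s b)
  obtain ⟨r1, r2⟩ := hr u s hsu a b
  have hd : ‖state ε ψ s a - state ε ψ s b‖ ≤ ‖a - b‖ := by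
    rw [state_sub]
    exact norm_heatL_le _ _
  rw [h.state_scheme_eq hε.le hsu, h.state_scheme_eq hε.le hsu]
  set y := state ε ψ s a
  set w := state ε ψ s b
  have e1 : y + lead ε x σ u s y + rest ε Xa XX σ u s y - y =
      lead ε x σ u s y + rest ε Xa XX σ u s y := by abel
  have e2 : w + lead ε x σ u s w + rest ε Xa XX σ u s w - w =
      lead ε x σ u s w + rest ε Xa XX σ u s w := by abel
  rw [e1, e2, add_sub_add_comm]
  constructor
  · refine (norm_add_le_of_le l1 r1).trans ?_
    calc _ ≤ K₁ * (1 + ‖a‖) * ((u : ℝ) - s) ^ κ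
          + K₂ * (1 + ‖a‖) * (T ^ (ρ - κ) * ((u : ℝ) - s) ^ κ) := by
          gcongr
          exact le_mul_of_one_le_right hK₁ (by linarith [norm_nonneg a])
      _ = _ := by ring
  · refine (norm_add_le_of_le l3 r2).trans ?_
    calc _ ≤ K₁ * ((u : ℝ) - s) ^ κ * ‖a - b‖
          + K₂ * ‖a - b‖ * (T ^ (ρ - κ) * ((u : ℝ) - s) ^ κ) := by gcongr
      _ = _ := by ring

/-- `rest` contributes linearly at order ρ and `lead` quadratically at order 2κ ≥ ρ. Only `rest`
grows with a, and it does so linearly, which gives the single factor 1 + ‖a‖. -/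
theorem RoughBounds.exists_field_step_le (h : RoughBounds κ ρ ε c x X Xa XX)
    (hσ : ∀ i, RegularField (σ i) C) (hψ : besselNorm ψ ≠ ∞) (hε : 0 < ε) (hT : 0 ≤ T)
    (hC : 0 ≤ C) (hκ : 0 < κ) (hκρ : κ ≤ ρ) (hρ1 : ρ ≤ 1) (hρκ : ρ ≤ κ + κ) :
    ∃ K, 0 ≤ K ∧ ∀ i, ∀ u s : Time T, s ≤ u → ∀ a b : LpSpace n p,
      ‖field (σ i) (state ε ψ u (scheme ε X XX σ ψ u s a)) - field (σ i) (state ε ψ s a)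
          - mulDeriv (σ i) (lead ε x σ u s (state ε ψ s a)) (state ε ψ s a)‖ ≤
        K * (1 + ‖a‖) * ((u : ℝ) - s) ^ ρ ∧
      ‖(field (σ i) (state ε ψ u (scheme ε X XX σ ψ u s a)) - field (σ i) (state ε ψ s a)
          - mulDeriv (σ i) (lead ε x σ u s (state ε ψ s a)) (state ε ψ s a))
        - (field (σ i) (state ε ψ u (scheme ε X XX σ ψ u s b)) - field (σ i) (state ε ψ s b)
          - mulDeriv (σ i) (lead ε x σ u s (state ε ψ s b)) (state ε ψ s b))‖ ≤
        K * (1 + ‖a‖) * ‖a - b‖ * ((u : ℝ) - s) ^ ρ := by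
  have hρ := hκ.trans_le hκρ
  obtain ⟨K₁, hK₁, hl⟩ := h.exists_lead_le (p := p) hσ hε
  obtain ⟨K₂, hK₂, hr⟩ := h.exists_rest_le hσ hψ hε hT hρ hρ1
  obtain ⟨K₃, hK₃, hs⟩ := exists_sup_heatL_le (n := n) (p := p) hε
  obtain ⟨A, hA, hx⟩ := h.exists_smoothMap_expansion (p := p) hσ hε hT hκ hκρ
  set E : ℝ := T ^ (κ + κ - ρ)
  set F : ℝ := T ^ κ
  have hE : 0 ≤ E := by positivity
  have hF : 0 ≤ F := by positivity
  -- The Lipschitz constant, from L^p to the sup norm, of the state after one step.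
  set K₄ : ℝ := K₃ * (1 + A * F)
  have hK₄ : 0 ≤ K₄ := by positivity
  refine ⟨C * K₂ + C * (K₄ + (K₃ + K₁ * F)) * K₂ + 2 * (C * K₁ * K₁ * E)
    + C * (2 * K₃ + K₁ * F) * K₁ * K₁ * E, by positivity, fun i u s hsu a b => ?_⟩
  have h0 := sub_time_nonneg hsu
  have hq : 0 ≤ ((u : ℝ) - s) ^ κ := Real.rpow_nonneg h0 κ
  have hr0 : 0 ≤ ((u : ℝ) - s) ^ ρ := Real.rpow_nonneg h0 ρ
  have hqq : ((u : ℝ) - s) ^ κ * ((u : ℝ) - s) ^ κ ≤ E * ((u : ℝ) - s) ^ ρ := by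
    rw [← Real.rpow_add_of_nonneg h0 hκ.le hκ.le]
    exact rpow_le_mul_rpow h0 (sub_time_le u s) hρ hρκ
  have hqF : ((u : ℝ) - s) ^ κ ≤ F := Real.rpow_le_rpow h0 (sub_time_le u s) hκ.le
  obtain ⟨l1, l2, l3, l4⟩ := hl u s hsu (state ε ψ s a) (state ε ψ s b)
  obtain ⟨-, l2', -, -⟩ := hl u s hsu (state ε ψ s b) (state ε ψ s b)
  obtain ⟨r1, r2⟩ := hr u s hsu a b
  have hd : ‖state ε ψ s a - state ε ψ s b‖ ≤ ‖a - b‖ := by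
    rw [state_sub]
    exact norm_heatL_le _ _
  have hm : ∀ᵐ ξ, |(state ε ψ s a - state ε ψ s b) ξ| ≤ K₃ * ‖a - b‖ := by
    rw [state_sub]
    exact hs _
  have hm' : ∀ᵐ ξ, |(state ε ψ u (scheme ε X XX σ ψ u s a)
      - state ε ψ u (scheme ε X XX σ ψ u s b)) ξ| ≤ K₄ * ‖a - b‖ := by
    rw [state_sub]
    filter_upwards [hs (scheme ε X XX σ ψ u s a - scheme ε X XX σ ψ u s b)] with ξ hξ
    refine hξ.trans ?_
    have : ‖scheme ε X XX σ ψ u s a - scheme ε X XX σ ψ u s b‖ ≤ (1 + A * F) * ‖a - b‖ := by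
      rw [scheme, scheme, add_sub_add_comm, ← map_sub]
      refine (norm_add_le_of_le (norm_heatL_le _ _) ((hx u s hsu).lip _ _)).trans ?_
      calc _ ≤ ‖a - b‖ + A * F * ‖a - b‖ := by gcongr
        _ = _ := by ring
    rw [mul_assoc]
    gcongr
  rw [h.state_scheme_eq hε.le hsu, h.state_scheme_eq hε.le hsu] at hm' ⊢
  set y := state ε ψ s a
  set w := state ε ψ s b
  set q := ((u : ℝ) - s) ^ κ
  set r := ((u : ℝ) - s) ^ ρ
  set α := 1 + ‖a‖ with hα
  have hα1 : 1 ≤ α := by linarith [norm_nonneg a]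
  have hα0 : 0 ≤ α := by linarith
  set d := ‖a - b‖
  have hd0 : 0 ≤ d := norm_nonneg _
  have hqr : q * q ≤ E * (α * r) := hqq.trans (by gcongr; exact le_mul_of_one_le_left hr0 hα1)
  constructor
  · refine ((hσ i).norm_field_expansion_le l2).trans ?_
    calc _ ≤ C * (K₂ * α * r) + C * (K₁ * q) * (K₁ * q) := by gcongr
      _ = C * K₂ * (α * r) + C * K₁ * K₁ * (q * q) := by ring
      _ ≤ C * K₂ * (α * r) + C * K₁ * K₁ * (E * (α * r)) := by gcongr
      _ ≤ C * K₂ * (α * r) + C * K₁ * K₁ * (E * (α * r))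
          + (C * (K₄ + (K₃ + K₁ * F)) * K₂ + C * K₁ * K₁ * E
            + C * (2 * K₃ + K₁ * F) * K₁ * K₁ * E) * (α * r) :=
        le_add_of_nonneg_right (by positivity)
      _ = _ := by ring
  · have hm₂ : ∀ᵐ ξ, |(lead ε x σ u s y - lead ε x σ u s w) ξ| ≤ K₁ * F * d := by
      filter_upwards [l4] with ξ hξ
      exact hξ.trans (by gcongr)
    refine ((hσ i).norm_field_expansion_sub_le hm' hm hm₂ l2 l2').trans ?_
    calc _ ≤ C * (K₂ * d * r) + C * (K₄ * d + (K₃ * d + K₁ * F * d)) * (K₂ * α * r)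
          + C * (K₁ * q + K₁ * q) * (K₁ * q * d)
          + C * (2 * (K₃ * d) + K₁ * F * d) * (K₁ * q) * (K₁ * q) := by
          gcongr
          exact l3.trans (by gcongr)
      _ = C * K₂ * (1 * (d * r)) + C * (K₄ + (K₃ + K₁ * F)) * K₂ * (α * d * r)
          + 2 * (C * K₁ * K₁) * (d * (q * q))
          + C * (2 * K₃ + K₁ * F) * K₁ * K₁ * (d * (q * q)) := by ring
      _ ≤ C * K₂ * (α * (d * r)) + C * (K₄ + (K₃ + K₁ * F)) * K₂ * (α * d * r)
          + 2 * (C * K₁ * K₁) * (d * (E * (α * r)))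
          + C * (2 * K₃ + K₁ * F) * K₁ * K₁ * (d * (E * (α * r))) := by gcongr
      _ = _ := by ring

theorem RoughBounds.exists_fieldDeriv_step_le (h : RoughBounds κ ρ ε c x X Xa XX)
    (hσ : ∀ i, RegularField (σ i) C) (hψ : besselNorm ψ ≠ ∞) (hε : 0 < ε) (hT : 0 ≤ T)
    (hκ : 0 < κ) (hκρ : κ ≤ ρ) (hρ1 : ρ ≤ 1) :
    ∃ K, 0 ≤ K ∧ ∀ i j, ∀ u s : Time T, s ≤ u → ∀ a b : LpSpace n p,
      ‖fieldDeriv ε (σ i) (σ j) (state ε ψ u (scheme ε X XX σ ψ u s a))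
          - fieldDeriv ε (σ i) (σ j) (state ε ψ s a)‖ ≤ K * (1 + ‖a‖) * ((u : ℝ) - s) ^ κ ∧
      ‖(fieldDeriv ε (σ i) (σ j) (state ε ψ u (scheme ε X XX σ ψ u s a))
          - fieldDeriv ε (σ i) (σ j) (state ε ψ s a))
        - (fieldDeriv ε (σ i) (σ j) (state ε ψ u (scheme ε X XX σ ψ u s b))
          - fieldDeriv ε (σ i) (σ j) (state ε ψ s b))‖ ≤
        K * (1 + ‖a‖) * ‖a - b‖ * ((u : ℝ) - s) ^ κ := by
  obtain ⟨D, hD, -, hG⟩ := exists_smoothMap_common (p := p) hσ hε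
  obtain ⟨K, hK, hst⟩ := h.exists_state_step_le hσ hψ hε hT hκ hκρ hρ1
  obtain ⟨K₃, hK₃, hs⟩ := exists_sup_heatL_le (n := n) (p := p) hε
  obtain ⟨A, hA, hx⟩ := h.exists_smoothMap_expansion (p := p) hσ hε hT hκ hκρ
  set F : ℝ := T ^ κ
  have hF : 0 ≤ F := by positivity
  set K₄ : ℝ := K₃ * (1 + A * F)
  have hK₄ : 0 ≤ K₄ := by positivity
  refine ⟨D * K + D * K₄ * K, by positivity, fun i j u s hsu a b => ?_⟩
  have h0 := sub_time_nonneg hsu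
  have hq : 0 ≤ ((u : ℝ) - s) ^ κ := Real.rpow_nonneg h0 κ
  have hqF : ((u : ℝ) - s) ^ κ ≤ F := Real.rpow_le_rpow h0 (sub_time_le u s) hκ.le
  obtain ⟨g1, g2⟩ := hst u s hsu a b
  have hm : ∀ᵐ ξ, |(state ε ψ s a - state ε ψ s b) ξ| ≤ K₄ * ‖a - b‖ := by
    rw [state_sub]
    filter_upwards [hs (a - b)] with ξ hξ
    refine hξ.trans ?_
    gcongr
    exact le_mul_of_one_le_right hK₃ (by linarith [mul_nonneg hA hF])
  have hm' : ∀ᵐ ξ, |(state ε ψ u (scheme ε X XX σ ψ u s a)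
      - state ε ψ u (scheme ε X XX σ ψ u s b)) ξ| ≤ K₄ * ‖a - b‖ := by
    rw [state_sub]
    filter_upwards [hs (scheme ε X XX σ ψ u s a - scheme ε X XX σ ψ u s b)] with ξ hξ
    refine hξ.trans ?_
    have hd : ‖state ε ψ s a - state ε ψ s b‖ ≤ ‖a - b‖ := by
      rw [state_sub]
      exact norm_heatL_le _ _
    have : ‖scheme ε X XX σ ψ u s a - scheme ε X XX σ ψ u s b‖ ≤ (1 + A * F) * ‖a - b‖ := by
      rw [scheme, scheme, add_sub_add_comm, ← map_sub]
      refine (norm_add_le_of_le (norm_heatL_le _ _) ((hx u s hsu).lip _ _)).trans ?_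
      calc _ ≤ ‖a - b‖ + A * F * ‖a - b‖ := by gcongr
        _ = _ := by ring
    rw [mul_assoc]
    gcongr
  have hα1 : 1 ≤ 1 + ‖a‖ := by linarith [norm_nonneg a]
  set α := 1 + ‖a‖
  set d := ‖a - b‖
  set q := ((u : ℝ) - s) ^ κ
  have hd0 : 0 ≤ d := norm_nonneg _
  have hα0 : 0 ≤ α := by linarith
  constructor
  · refine ((hG i j).lip _ _).trans ?_
    calc _ ≤ D * (K * α * q) := by gcongr
      _ ≤ D * (K * α * q) + D * K₄ * K * α * q := le_add_of_nonneg_right (by positivity)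
      _ = _ := by ring
  · refine ((hG i j).four _ _ _ _ _ hm' hm).trans ?_
    calc _ ≤ D * (K * d * q) + D * (K₄ * d) * (K * α * q) := by gcongr
      _ = D * K * (1 * (d * q)) + D * K₄ * K * α * d * q := by ring
      _ ≤ D * K * (α * (d * q)) + D * K₄ * K * α * d * q := by gcongr
      _ = _ := by ring

/-- The heat semigroup is a contraction and the expansion is a `SmoothMap` with constant of order (t
- s)^κ, which gives the Lipschitz, four-point and growth conditions. The defects come from
`scheme_defect` and the expansions of f and of the second order field along one step. -/
theorem RoughBounds.exists_almostFlow_scheme (h : RoughBounds κ ρ ε c x X Xa XX)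
    (hσ : ∀ i, RegularField (σ i) C) (hψ : besselNorm ψ ≠ ∞) (hε : 0 < ε) (hT : 0 ≤ T)
    (hC : 0 ≤ C) (hκ : 0 < κ) (hκρ : κ ≤ ρ) (hρ1 : ρ ≤ 1) (hρκ : ρ ≤ κ + κ) (hμ : 1 < κ + ρ) :
    ∃ K, AlmostFlow (scheme ε X XX σ ψ) κ (κ + ρ) K := by
  have hρ := hκ.trans_le hκρ
  have hc := h.nonneg
  obtain ⟨A, hA, hx⟩ := h.exists_smoothMap_expansion (p := p) hσ hε hT hκ hκρ
  obtain ⟨K₁, hK₁, h₁⟩ := h.exists_field_step_le hσ hψ hε hT hC hκ hκρ hρ1 hρκ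
  obtain ⟨K₂, hK₂, h₂⟩ := h.exists_fieldDeriv_step_le hσ hψ hε hT hκ hκρ hρ1
  obtain ⟨K₃, hK₃, hs⟩ := exists_sup_heatL_le (n := n) (p := p) hε
  set P : ℝ := (N * c + N * (N * c)) * (K₁ + K₂)
  have hP : 0 ≤ P := by positivity
  have hd : ∀ (s : Time T) (a b : LpSpace n p), ‖state ε ψ s a - state ε ψ s b‖ ≤ ‖a - b‖ := by
    intro s a b
    rw [state_sub]
    exact norm_heatL_le _ _
  have hAm : A ≤ A * (1 + K₃) + P := by
    have : 0 ≤ A * K₃ := by positivity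
    linarith
  refine ⟨A * (1 + K₃) + P, hκ, by linarith, hμ, by positivity, fun t a => ?_, fun t s hst a b => ?_,
    fun t s hst x x' w w' => ?_, fun t s hst a => ?_, fun t u s hsu hut a => ?_,
    fun t u s hsu hut a b => ?_⟩
  · have := (hx t t le_rfl).bound (state ε ψ t a)
    rw [sub_self, Real.zero_rpow hκ.ne', mul_zero, norm_le_zero_iff] at this
    rw [scheme, this, sub_self, heatL_zero, add_zero]
  · have hq := Real.rpow_nonneg (sub_time_nonneg hst) κ
    rw [scheme, scheme, add_sub_add_comm, ← map_sub]
    refine (norm_add_le_of_le (norm_heatL_le _ _) ((hx t s hst).lip _ _)).trans ?_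
    rw [add_mul, one_mul]
    have := hd s a b
    gcongr
  · have hq := Real.rpow_nonneg (sub_time_nonneg hst) κ
    have e : scheme ε X XX σ ψ t s x - scheme ε X XX σ ψ t s x'
        - (scheme ε X XX σ ψ t s w - scheme ε X XX σ ψ t s w') =
        heatL ((t : ℝ) - s) (x - x' - (w - w')) +
        (expansion ε X XX σ t s (state ε ψ s x) - expansion ε X XX σ t s (state ε ψ s x') -
        (expansion ε X XX σ t s (state ε ψ s w) - expansion ε X XX σ t s (state ε ψ s w'))) := by
      simp only [scheme, map_sub]
      abel
    have hsup : ∀ a b : LpSpace n p, ‖a - b‖ ≤ ‖x - w‖ + ‖x' - w'‖ →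
        ∀ᵐ ξ, |(state ε ψ s a - state ε ψ s b) ξ| ≤ K₃ * (‖x - w‖ + ‖x' - w'‖) := by
      intro a b hab
      rw [state_sub]
      filter_upwards [hs (a - b)] with ξ hξ
      exact hξ.trans (by gcongr)
    have h4 := (hx t s hst).four _ _ _ _ _
      (hsup x w (le_add_of_nonneg_right (norm_nonneg _)))
      (hsup x' w' (le_add_of_nonneg_left (norm_nonneg _)))
    have e2 : state ε ψ s x - state ε ψ s x' - (state ε ψ s w - state ε ψ s w') =
        heatL ε (x - x' - (w - w')) := by
      rw [state_sub, state_sub, ← map_sub]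
    rw [e2] at h4
    rw [e]
    refine (norm_add_le_of_le (norm_heatL_le _ _) h4).trans ?_
    have hd1 := hd s x x'
    have hd2 := norm_heatL_le ε (x - x' - (w - w'))
    have hm : 0 ≤ ‖x - w‖ + ‖x' - w'‖ := by positivity
    set m := ‖x - w‖ + ‖x' - w'‖
    set q := ((t : ℝ) - s) ^ κ
    have hAK : A * K₃ ≤ A * (1 + K₃) + P := by linarith
    calc _ ≤ ‖x - x' - (w - w')‖ + (A * q * ‖x - x' - (w - w')‖ + A * q * (K₃ * m) * ‖x - x'‖) := by
          gcongr
      _ = (1 + A * q) * ‖x - x' - (w - w')‖ + A * K₃ * q * m * ‖x - x'‖ := by ring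
      _ ≤ _ := by gcongr
  · have hq := Real.rpow_nonneg (sub_time_nonneg hst) κ
    rw [scheme]
    refine norm_add_le_of_le (norm_heatL_le _ _) (((hx t s hst).bound _).trans ?_)
    gcongr
  · have h0 : 0 ≤ ((t : ℝ) - s) ^ (κ + ρ) := Real.rpow_nonneg (sub_time_nonneg (hsu.trans hut)) _
    have hr0 : 0 ≤ ((u : ℝ) - s) ^ ρ := Real.rpow_nonneg (sub_time_nonneg hsu) _
    have hq0 : 0 ≤ ((u : ℝ) - s) ^ κ := Real.rpow_nonneg (sub_time_nonneg hsu) _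
    rw [h.scheme_defect hσ hsu hut]
    refine (h.norm_expansion_le hκ hρ hsu hut (β := (K₁ + K₂) * (1 + ‖a‖)) (by positivity)
      (fun i => (h₁ i u s hsu a a).1.trans ?_) (fun i j => (h₂ i j u s hsu a a).1.trans ?_)).trans ?_
    · gcongr; linarith
    · gcongr; linarith
    · calc _ = P * (1 + ‖a‖) * ((t : ℝ) - s) ^ (κ + ρ) := by ring
        _ ≤ _ := by
          gcongr
          have : 0 ≤ A * (1 + K₃) := by positivity
          linarith
  · have h0 : 0 ≤ ((t : ℝ) - s) ^ (κ + ρ) := Real.rpow_nonneg (sub_time_nonneg (hsu.trans hut)) _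
    have hr0 : 0 ≤ ((u : ℝ) - s) ^ ρ := Real.rpow_nonneg (sub_time_nonneg hsu) _
    have hq0 : 0 ≤ ((u : ℝ) - s) ^ κ := Real.rpow_nonneg (sub_time_nonneg hsu) _
    rw [h.scheme_defect hσ hsu hut, h.scheme_defect hσ hsu hut, add_sub_add_comm]
    simp only [← Finset.sum_sub_distrib, ← map_sub]
    refine (h.norm_expansion_le hκ hρ hsu hut (β := (K₁ + K₂) * (1 + ‖a‖) * ‖a - b‖) (by positivity)
      (fun i => (h₁ i u s hsu a b).2.trans ?_) (fun i j => (h₂ i j u s hsu a b).2.trans ?_)).trans ?_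
    · gcongr; linarith
    · gcongr; linarith
    · calc _ = P * (1 + ‖a‖) * ‖a - b‖ * ((t : ℝ) - s) ^ (κ + ρ) := by ring
        _ ≤ _ := by
          have : 0 ≤ A * (1 + K₃) := by positivity
          refine mul_le_mul_of_nonneg_right (mul_le_mul_of_nonneg_right (mul_le_mul (by linarith)
            (le_add_of_nonneg_right (norm_nonneg _)) (by positivity) (by positivity))
            (norm_nonneg _)) h0

end SchemeFlow

/-! ## Continuity -/

theorem continuous_of_holder {E : Type*} [SeminormedAddCommGroup E] {T c κ : ℝ} (hκ : 0 < κ)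
    {g : Time T → E} (h : ∀ t s : Time T, s ≤ t → ‖g t - g s‖ ≤ c * ((t : ℝ) - s) ^ κ) :
    Continuous g := by
  have h' : ∀ t s : Time T, ‖g t - g s‖ ≤ c * |(t : ℝ) - s| ^ κ := by
    intro t s
    rcases le_total s t with hst | hst
    · rw [abs_of_nonneg (sub_time_nonneg hst)]
      exact h t s hst
    · rw [norm_sub_rev, abs_sub_comm, abs_of_nonneg (sub_time_nonneg hst)]
      exact h s t hst
  refine continuous_iff_continuousAt.2 fun s => ?_
  rw [ContinuousAt, tendsto_iff_norm_sub_tendsto_zero]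
  have h1 : Continuous fun t : Time T => c * |(t : ℝ) - s| ^ κ :=
    continuous_const.mul (((continuous_subtype_val.sub continuous_const).abs).rpow_const
      fun _ => Or.inr hκ.le)
  refine squeeze_zero (fun _ => norm_nonneg _) (fun t => h' t s) ?_
  have := h1.tendsto s
  simpa [Real.zero_rpow hκ.ne'] using this

section Controlled

variable {n p N : ℕ} {T : ℝ} [Fact (1 ≤ (p : ℝ≥0∞))]

theorem ContIn.continuousOn {α : Type} [TopologicalSpace α] {A : Set α} {g : α → LpSpace n p}
    (h : ContIn besselNorm A g) : ContinuousOn g A := by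
  intro a ha
  rw [ContinuousWithinAt, tendsto_iff_edist_tendsto_0]
  refine tendsto_of_tendsto_of_tendsto_of_le_of_le tendsto_const_nhds (h a ha).2
    (fun _ => zero_le) fun b => ?_
  rw [edist_eq_enorm_sub]
  exact enorm_le_besselNorm _

/-- Strong continuity in time together with the uniform contraction bound gives joint continuity. -/
theorem continuousOn_heatL_comp {α : Type*} [TopologicalSpace α] {A : Set α} {τ : α → ℝ}
    {f : α → LpSpace n p} (hτ : ContinuousOn τ A) (hf : ContinuousOn f A) :
    ContinuousOn (fun a => heatL (τ a) (f a)) A := by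
  intro a ha
  rw [ContinuousWithinAt, tendsto_iff_norm_sub_tendsto_zero]
  have h1 := tendsto_iff_norm_sub_tendsto_zero.1 (hf a ha)
  have h2 := tendsto_iff_norm_sub_tendsto_zero.1
    (((continuous_heatL (f a)).tendsto (τ a)).comp (hτ a ha))
  refine squeeze_zero (fun _ => norm_nonneg _) (fun b => ?_) (by simpa using h1.add h2)
  have e : heatL (τ b) (f b) - heatL (τ a) (f a) =
      heatL (τ b) (f b - f a) + (heatL (τ b) (f a) - heatL (τ a) (f a)) := by
    rw [map_sub]
    abel
  rw [e]
  exact norm_add_le_of_le (norm_heatL_le _ _) le_rfl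

theorem SmoothMap.continuous {Φ : LpSpace n p → LpSpace n p} {D : ℝ} (h : SmoothMap Φ D) :
    Continuous Φ :=
  (LipschitzWith.of_dist_le_mul (K := ⟨D, h.nonneg⟩) fun y w => by
    rw [dist_eq_norm, dist_eq_norm]
    exact h.lip y w).continuous

/-! ## The integrand along a controlled process -/

variable {γ κ ρ ε c C : ℝ} {x : Fin N → Time T → ℝ}
  {X Xa : Fin N → Time T → Time T → LpSpace n p →L[ℝ] LpSpace n p}
  {XX : Fin N → Fin N → Time T → Time T → LpSpace n p →L[ℝ] LpSpace n p}
  {σ : Fin N → Space n → ℝ → ℝ} {ψ : LpSpace n p}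
  {y : Time T → LpSpace n p} {yx : Fin N → Time T → LpSpace n p}

theorem RoughBounds.continuous_x (h : RoughBounds κ ρ ε c x X Xa XX) (hκ : 0 < κ) (i : Fin N) :
    Continuous (x i) :=
  continuous_of_holder hκ (h.x_le i)

theorem lead_eq_sum (hyx : ∀ i s, yx i s = heatL ε (field (σ i) (y s))) (u s : Time T) :
    lead ε x σ u s (y s) = ∑ j, (x j u - x j s) • yx j s := by
  rw [lead, noise, map_sum]
  simp only [map_smul, hyx]

theorem RoughBounds.controlled_increment (h : RoughBounds κ ρ ε c x X Xa XX)
    (hyx : ∀ i s, yx i s = heatL ε (field (σ i) (y s))) {u s : Time T} (hsu : s ≤ u) :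
    y u = y s + lead ε x σ u s (y s)
      + (heatL ((u : ℝ) - s) (y s) - y s + ∑ j, Xa j u s (yx j s) + sharp X y yx u s) := by
  rw [sharp, deltaHat1_eq y hsu, lead_eq_sum hyx]
  simp only [h.X_eq _ u s hsu, Finset.sum_add_distrib]
  abel

/-- The increment of y is the leading part plus the three arguments paired with f' in f(y)^♯. Adding
the Taylor remainder leaves the expansion of f around the leading part alone, as for the scheme. -/
theorem RoughBounds.fieldSharp_eq (h : RoughBounds κ ρ ε c x X Xa XX)
    (hσ : ∀ i, RegularField (σ i) C) (hyx : ∀ i s, yx i s = heatL ε (field (σ i) (y s)))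
    (i : Fin N) {u s : Time T} (hsu : s ≤ u) :
    fieldSharp X Xa (σ i) y yx u s =
      field (σ i) (y u) - field (σ i) (y s) - mulDeriv (σ i) (lead ε x σ u s (y s)) (y s) := by
  have h1 := h.controlled_increment hyx hsu
  have e : y u - y s = lead ε x σ u s (y s)
      + (aOp u s (y s) + ∑ j, Xa j u s (yx j s) + sharp X y yx u s) := by
    rw [aOp_eq hsu]
    nth_rewrite 1 [h1]
    abel
  rw [fieldSharp, (hσ i).taylorRem_eq, add_sub_cancel, ← (hσ i).mulDeriv_sum]
  rw [e]
  simp only [(hσ i).mulDeriv_add]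
  abel

/-- Commutation with S_ε identifies the argument of Λ̂ with the smoothed defect of the expansions
along y. -/
theorem RoughBounds.lambdaArg_eq (h : RoughBounds κ ρ ε c x X Xa XX)
    (hσ : ∀ i, RegularField (σ i) C) (hε : 0 ≤ ε)
    (hyx : ∀ i s, yx i s = heatL ε (field (σ i) (y s))) {t u s : Time T} (hsu : s ≤ u)
    (hut : u ≤ t) :
    lambdaArg ε X Xa XX σ y yx t u s =
      heatL ε (heatL ((t : ℝ) - u) (expansion ε X XX σ u s (y s)) + expansion ε X XX σ t u (y u)
        - expansion ε X XX σ t s (y s)) := by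
  rw [h.expansion_defect hσ hsu hut, map_add, map_sum, map_sum, lambdaArg]
  congr 1
  · refine Finset.sum_congr rfl fun i _ => ?_
    rw [heat_eq_heatL hε, h.comm_X i t u hut, h.fieldSharp_eq hσ hyx i hsu, lead]
  · refine Finset.sum_congr rfl fun i _ => ?_
    rw [map_sum]
    refine Finset.sum_congr rfl fun j _ => ?_
    rw [heat_eq_heatL hε, h.comm_XX i j t u hut, hyx, hyx, fieldDeriv, fieldDeriv]

theorem RoughBounds.heatL_expansion_eq (h : RoughBounds κ ρ ε c x X Xa XX) (hε : 0 ≤ ε)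
    (hyx : ∀ i s, yx i s = heatL ε (field (σ i) (y s))) {t s : Time T} (hst : s ≤ t) :
    ∑ i, X i t s (heat ε (field (σ i) (y s)))
        + ∑ i, ∑ j, XX i j t s (heat ε (mulDeriv (σ i) (yx j s) (y s))) =
      heatL ε (expansion ε X XX σ t s (y s)) := by
  rw [expansion, map_add, map_sum, map_sum]
  congr 1
  · refine Finset.sum_congr rfl fun i _ => ?_
    rw [heat_eq_heatL hε, h.comm_X i t s hst]
  · refine Finset.sum_congr rfl fun i _ => ?_
    rw [map_sum]
    refine Finset.sum_congr rfl fun j _ => ?_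
    rw [heat_eq_heatL hε, h.comm_XX i j t s hst, hyx, fieldDeriv]

theorem IsControlled.exists_besselNorm_le (h : IsControlled γ κ X y yx) (hT : 0 ≤ T)
    (hγ : 0 ≤ γ) : ∃ B : ℝ≥0, ∀ s, besselNorm (y s) ≤ B := by
  obtain ⟨hcont, Cγ, hC⟩ := h.path
  have h0 := (hcont ⟨0, le_rfl, hT⟩ (mem_univ _)).1
  refine ⟨Cγ * (T ^ γ).toNNReal + (besselNorm (y ⟨0, le_rfl, hT⟩)).toNNReal, fun s => ?_⟩
  rw [ENNReal.coe_add, ENNReal.coe_mul, ENNReal.coe_toNNReal h0]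
  rcases (show (⟨0, le_rfl, hT⟩ : Time T) ≤ s from s.2.1).eq_or_lt with e | hlt
  · rw [← e]
    exact le_add_self
  · have h1 := hC s _ hlt
    rw [deltaHat1_eq y hlt.le] at h1
    have e : y s = (y s - heatL ((s : ℝ) - (⟨0, le_rfl, hT⟩ : Time T)) (y ⟨0, le_rfl, hT⟩))
      + heatL ((s : ℝ) - (⟨0, le_rfl, hT⟩ : Time T)) (y ⟨0, le_rfl, hT⟩) := by abel
    rw [e]
    refine (besselNorm_add_le _ _).trans (add_le_add (h1.trans ?_) (besselNorm_heatL_le _ _))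
    gcongr
    refine ENNReal.ofReal_le_ofReal (Real.rpow_le_rpow (sub_time_nonneg hlt.le) ?_ hγ)
    exact sub_time_le _ _

/-- An arbitrary controlled process with the right derivative obeys the same increment bounds as the
scheme: its deviation from the leading part is of order ρ, by the bound on y in the Bessel space for
S - id and by the order 2κ of y^♯. -/
theorem RoughBounds.exists_controlled_le (h : RoughBounds κ ρ ε c x X Xa XX)
    (hσ : ∀ i, RegularField (σ i) C) (hy : IsControlled γ κ X y yx)
    (hyx : ∀ i s, yx i s = heatL ε (field (σ i) (y s)))
    (hε : 0 < ε) (hT : 0 ≤ T) (hC : 0 ≤ C) (hγ : 0 ≤ γ)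
    (hκ : 0 < κ) (hκρ : κ ≤ ρ) (hρ1 : ρ ≤ 1) (hρκ : ρ ≤ κ + κ) :
    ∃ K, 0 ≤ K ∧ ∀ u s : Time T, s ≤ u → ‖y u - y s‖ ≤ K * ((u : ℝ) - s) ^ κ ∧
      ∀ i, ‖field (σ i) (y u) - field (σ i) (y s) - mulDeriv (σ i) (lead ε x σ u s (y s)) (y s)‖ ≤
        K * ((u : ℝ) - s) ^ ρ := by
  have hρ := hκ.trans_le hκρ
  have hc := h.nonneg
  obtain ⟨D, hD, hF, -⟩ := exists_smoothMap_common (p := p) hσ hε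
  obtain ⟨K₁, hK₁, hl⟩ := h.exists_lead_le (p := p) hσ hε
  obtain ⟨B, hB⟩ := hy.exists_besselNorm_le hT hγ
  obtain ⟨-, R, hR⟩ := hy.remainder
  set E : ℝ := T ^ (κ + κ - ρ)
  have hE : 0 ≤ E := by positivity
  set K₂ : ℝ := B * T ^ (1 - ρ) + N * (c * D) + R * E
  have hK₂ : 0 ≤ K₂ := by positivity
  have hrest : ∀ u s : Time T, s < u →
      ‖heatL ((u : ℝ) - s) (y s) - y s + ∑ j, Xa j u s (yx j s) + sharp X y yx u s‖ ≤
        K₂ * ((u : ℝ) - s) ^ ρ := by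
    intro u s hsu
    have h0 := sub_time_nonneg hsu.le
    have hr := Real.rpow_nonneg h0 ρ
    have b1 : ‖heatL ((u : ℝ) - s) (y s) - y s‖ ≤ B * T ^ (1 - ρ) * ((u : ℝ) - s) ^ ρ := by
      refine (norm_heatL_sub_le_besselNorm (ne_top_of_le_ne_top ENNReal.coe_ne_top (hB s))
        h0).trans ?_
      have h1 := rpow_le_mul_rpow h0 (sub_time_le u s) hρ hρ1
      rw [Real.rpow_one] at h1
      have h2 : (besselNorm (y s)).toReal ≤ B := by
        simpa using ENNReal.toReal_mono ENNReal.coe_ne_top (hB s)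
      calc _ ≤ T ^ (1 - ρ) * ((u : ℝ) - s) ^ ρ * B := by gcongr
        _ = _ := by ring
    have b2 : ‖∑ j, Xa j u s (yx j s)‖ ≤ N * (c * D) * ((u : ℝ) - s) ^ ρ := by
      refine (norm_sum_le_of_le _ (f := fun j => Xa j u s (yx j s))
        (n := fun _ => c * ((u : ℝ) - s) ^ ρ * D) fun j _ => ?_).trans_eq ?_
      · rw [hyx]
        refine (h.Xa_le j u s hsu.le _).trans ?_
        have := (hF j).bound (y s)
        gcongr
      · simp
        ring
    have b3 : ‖sharp X y yx u s‖ ≤ R * E * ((u : ℝ) - s) ^ ρ := by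
      have h1 := (enorm_le_besselNorm _).trans (hR u s hsu)
      have h2 := ENNReal.toReal_mono
        (ENNReal.mul_ne_top ENNReal.coe_ne_top ENNReal.ofReal_ne_top) h1
      rw [toReal_enorm, ENNReal.toReal_mul, ENNReal.coe_toReal,
        ENNReal.toReal_ofReal (Real.rpow_nonneg h0 _), two_mul] at h2
      refine h2.trans ?_
      rw [mul_assoc]
      exact mul_le_mul_of_nonneg_left (rpow_le_mul_rpow h0 (sub_time_le u s) hρ hρκ) R.2
    refine (norm_add_le_of_le (norm_add_le_of_le b1 b2) b3).trans_eq ?_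
    ring
  refine ⟨K₁ + K₂ * T ^ (ρ - κ) + (C * K₂ + C * K₁ * K₁ * E), by positivity, fun u s hsu => ?_⟩
  rcases hsu.eq_or_lt with rfl | hlt
  · have e : lead ε x σ s s (y s) = 0 := by
      rw [lead_eq_sum hyx]
      simp
    have e2 : ∀ i, mulDeriv (σ i) 0 (y s) = 0 := fun i => map_zero ((hσ i).mulDerivₗ (y s))
    simp [e, e2, Real.zero_rpow hκ.ne', Real.zero_rpow hρ.ne']
  · have h0 := sub_time_nonneg hsu
    have hq := Real.rpow_nonneg h0 κ
    have hr := Real.rpow_nonneg h0 ρ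
    have hρκ' := rpow_le_mul_rpow h0 (sub_time_le u s) hκ hκρ
    have hqq : ((u : ℝ) - s) ^ κ * ((u : ℝ) - s) ^ κ ≤ E * ((u : ℝ) - s) ^ ρ := by
      rw [← Real.rpow_add_of_nonneg h0 hκ.le hκ.le]
      exact rpow_le_mul_rpow h0 (sub_time_le u s) hρ hρκ
    obtain ⟨l1, l2, -, -⟩ := hl u s hsu (y s) (y s)
    have hre := hrest u s hlt
    have hinc := h.controlled_increment hyx hsu
    set r := heatL ((u : ℝ) - s) (y s) - y s + ∑ j, Xa j u s (yx j s) + sharp X y yx u s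
    rw [hinc]
    constructor
    · rw [add_assoc, add_sub_cancel_left]
      refine (norm_add_le_of_le l1 hre).trans ?_
      calc _ ≤ K₁ * ((u : ℝ) - s) ^ κ + K₂ * (T ^ (ρ - κ) * ((u : ℝ) - s) ^ κ)
            + (C * K₂ + C * K₁ * K₁ * E) * ((u : ℝ) - s) ^ κ := by
            refine le_add_of_le_of_nonneg ?_ (by positivity)
            gcongr
        _ = _ := by ring
    · intro i
      refine ((hσ i).norm_field_expansion_le l2).trans ?_
      calc _ ≤ C * (K₂ * ((u : ℝ) - s) ^ ρ)
            + C * (K₁ * ((u : ℝ) - s) ^ κ) * (K₁ * ((u : ℝ) - s) ^ κ) := by gcongr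
        _ = C * K₂ * ((u : ℝ) - s) ^ ρ
            + C * K₁ * K₁ * (((u : ℝ) - s) ^ κ * ((u : ℝ) - s) ^ κ) := by ring
        _ ≤ C * K₂ * ((u : ℝ) - s) ^ ρ + C * K₁ * K₁ * (E * ((u : ℝ) - s) ^ ρ)
            + (K₁ + K₂ * T ^ (ρ - κ)) * ((u : ℝ) - s) ^ ρ := by
            refine le_add_of_le_of_nonneg ?_ (by positivity)
            gcongr
        _ = _ := by ring

end Controlled

/-! ## Existence -/

section Existence

variable {n p N : ℕ} {T : ℝ} [Fact (1 ≤ (p : ℝ≥0∞))]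

theorem besselNorm_heatL_le_of_norm_le {ε : ℝ} {L : ℝ≥0}
    (hL : ∀ φ : LpSpace n p, besselNorm (heatL ε φ) ≤ L * ‖φ‖ₑ) {φ : LpSpace n p} {K r : ℝ}
    (hK : 0 ≤ K) (h : ‖φ‖ ≤ K * r) :
    besselNorm (heatL ε φ) ≤ ((L * K.toNNReal : ℝ≥0) : ℝ≥0∞) * ENNReal.ofReal r := by
  refine (hL φ).trans ?_
  rw [ENNReal.coe_mul, mul_assoc, ← ofReal_norm]
  gcongr
  refine (ENNReal.ofReal_le_ofReal h).trans_eq ?_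
  rw [ENNReal.ofReal_mul hK]
  rfl

/-- The size of g is read off from F, smoothed by S_ε. Continuity uses the other half of the
smoothing: G stands for S_{ε/2} F, which is continuous without continuity of F being required. -/
theorem memC2_heatL {ε a K : ℝ} (hε : 0 < ε) (hK : 0 ≤ K) {g G F : Time T → Time T → LpSpace n p}
    (hG : ContinuousOn (fun q : Time T × Time T => G q.1 q.2) (simplex2 T))
    (hgG : ∀ t s, s ≤ t → g t s = heatL (ε / 2) (G t s))
    (hgF : ∀ t s, s ≤ t → g t s = heatL ε (F t s))
    (hF : ∀ t s : Time T, s ≤ t → ‖F t s‖ ≤ K * ((t : ℝ) - s) ^ a) : MemC2 besselNorm a g := by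
  obtain ⟨L, hL⟩ := exists_besselNorm_heatL_le (n := n) (p := p) hε
  refine ⟨contIn_heatL (half_pos hε) (fun q hq => hgG q.1 q.2 hq) hG, L * K.toNNReal,
    fun t s hst => ?_⟩
  rw [hgF t s hst.le]
  exact besselNorm_heatL_le_of_norm_le hL hK (hF t s hst.le)

variable {γ κ ρ ε c C : ℝ} {x : Fin N → Time T → ℝ}
  {X Xa : Fin N → Time T → Time T → LpSpace n p →L[ℝ] LpSpace n p}
  {XX : Fin N → Fin N → Time T → Time T → LpSpace n p →L[ℝ] LpSpace n p}
  {σ : Fin N → Space n → ℝ → ℝ} {ψ : LpSpace n p}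
  {y : Time T → LpSpace n p} {yx : Fin N → Time T → LpSpace n p} {z : Time T → LpSpace n p}

theorem AlmostFlow.exists_norm_trajectory_le {E : Type*} [NormedAddCommGroup E]
    {m : Time T → Time T → E → E} {κ μ c C₀ : ℝ} (hm : AlmostFlow m κ μ c) (hT : 0 ≤ T)
    (hC₀ : 0 ≤ C₀) {z : Time T → E}
    (hz : ∀ t s, s ≤ t → ‖z t - m t s (z s)‖ ≤ C₀ * ((t : ℝ) - s) ^ μ) :
    ∃ M, 0 ≤ M ∧ ∀ t, ‖z t‖ ≤ M := by
  have hc := hm.nonneg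
  refine ⟨C₀ * T ^ μ + (‖z ⟨0, le_rfl, hT⟩‖ + c * T ^ κ), by positivity, fun t => ?_⟩
  have h0 : (⟨0, le_rfl, hT⟩ : Time T) ≤ t := t.2.1
  have e : z t = (z t - m t ⟨0, le_rfl, hT⟩ (z ⟨0, le_rfl, hT⟩))
    + m t ⟨0, le_rfl, hT⟩ (z ⟨0, le_rfl, hT⟩) := by abel
  rw [e]
  have h1 := sub_time_nonneg h0
  have h2 := sub_time_le t ⟨0, le_rfl, hT⟩
  have k1 := Real.rpow_le_rpow h1 h2 hm.exp_pos.le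
  have k2 := Real.rpow_le_rpow h1 h2 (hm.exp_pos.le.trans hm.exp_le)
  exact norm_add_le_of_le ((hz t _ h0).trans (by gcongr)) ((hm.growth t _ h0 _).trans (by gcongr))

/-- A trajectory controls z_t - S_{t-s} z_s, while S_{t-s} z_s - z_s has no rate in L^p; after
smoothing by S_δ it is of order t - s. -/
theorem RoughBounds.continuous_heatL_trajectory (h : RoughBounds κ ρ ε c x X Xa XX)
    (hσ : ∀ i, RegularField (σ i) C) (hε : 0 < ε) (hT : 0 ≤ T)
    (hκ : 0 < κ) (hκρ : κ ≤ ρ) (hκ1 : κ ≤ 1) {C₀ M : ℝ} (hC₀ : 0 ≤ C₀)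
    (hz : ∀ t s, s ≤ t → ‖z t - scheme ε X XX σ ψ t s (z s)‖ ≤ C₀ * ((t : ℝ) - s) ^ (κ + ρ))
    (hM : ∀ t, ‖z t‖ ≤ M) {δ : ℝ} (hδ : 0 < δ) : Continuous fun t => heatL δ (z t) := by
  obtain ⟨A, hA, hx⟩ := h.exists_smoothMap_expansion (p := p) hσ hε hT hκ hκρ
  -- The estimate on states is reused for its second half only, with δ in place of ε, so any ψ will
  -- do and 0 is taken.
  have hψ0 : besselNorm (0 : LpSpace n p) ≠ ∞ := by
    rw [besselNorm_zero]
    exact ENNReal.zero_ne_top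
  obtain ⟨K, hK, hd⟩ := exists_norm_heatL_state_sub_le (T := T) hψ0 hδ
  refine continuous_of_holder (c := K * M * T ^ (1 - κ) + A + C₀ * T ^ (κ + ρ - κ)) hκ
    fun t s hst => ?_
  have h0 := sub_time_nonneg hst
  have e : heatL δ (z t) - heatL δ (z s) =
      (heatL ((t : ℝ) - s) (heatL δ (z s - 0)) - heatL δ (z s - 0))
      + heatL δ (expansion ε X XX σ t s (state ε ψ s (z s)))
      + heatL δ (z t - scheme ε X XX σ ψ t s (z s)) := by
    rw [sub_zero, heatL_comm h0 hδ.le, scheme, map_sub, map_add]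
    abel
  rw [e]
  have h1 := (hd s (z s) 0 _ h0).2
  have h2 := rpow_le_mul_rpow h0 (sub_time_le t s) hκ hκ1
  have h3 := rpow_le_mul_rpow h0 (sub_time_le t s) hκ (by linarith : κ ≤ κ + ρ)
  rw [Real.rpow_one] at h2
  refine (norm_add_le_of_le (norm_add_le_of_le h1 ((norm_heatL_le _ _).trans
    ((hx t s hst).bound _))) ((norm_heatL_le _ _).trans (hz t s hst))).trans ?_
  rw [sub_zero]
  have h4 := hM s
  have hM0 : 0 ≤ M := (norm_nonneg _).trans h4
  calc _ ≤ K * M * (T ^ (1 - κ) * ((t : ℝ) - s) ^ κ) + A * ((t : ℝ) - s) ^ κ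
        + C₀ * (T ^ (κ + ρ - κ) * ((t : ℝ) - s) ^ κ) := by gcongr
    _ = _ := by ring

theorem continuousOn_expansion
    (hX : ∀ i, ContinuousOn (fun q : Time T × Time T => X i q.1 q.2) (simplex2 T))
    (hXX : ∀ i j, ContinuousOn (fun q : Time T × Time T => XX i j q.1 q.2) (simplex2 T))
    (hF : ∀ i, Continuous fun s => field (σ i) (y s))
    (hG : ∀ i j, Continuous fun s => fieldDeriv ε (σ i) (σ j) (y s)) :
    ContinuousOn (fun q : Time T × Time T => expansion ε X XX σ q.1 q.2 (y q.2))
      (simplex2 T) := by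
  refine ContinuousOn.add (continuousOn_finsetSum _ fun i _ => ?_)
    (continuousOn_finsetSum _ fun i _ => continuousOn_finsetSum _ fun j _ => ?_)
  · exact (hX i).clm_apply ((hF i).comp continuous_snd).continuousOn
  · exact (hXX i j).clm_apply ((hG i j).comp continuous_snd).continuousOn

theorem RoughBounds.memC3_lambdaArg (h : RoughBounds κ ρ ε c x X Xa XX)
    (hσ : ∀ i, RegularField (σ i) C)
    (hyx : ∀ i s, yx i s = heatL ε (field (σ i) (y s))) (hε : 0 < ε)
    (hκ : 0 < κ) (hρ : 0 < ρ) (hycont : Continuous y)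
    (hX : ∀ i, ContinuousOn (fun q : Time T × Time T => X i q.1 q.2) (simplex2 T))
    (hXX : ∀ i j, ContinuousOn (fun q : Time T × Time T => XX i j q.1 q.2) (simplex2 T))
    {K : ℝ} (hK : 0 ≤ K) (hy : ∀ u s : Time T, s ≤ u → ‖y u - y s‖ ≤ K * ((u : ℝ) - s) ^ κ ∧
      ∀ i, ‖field (σ i) (y u) - field (σ i) (y s) - mulDeriv (σ i) (lead ε x σ u s (y s)) (y s)‖ ≤
        K * ((u : ℝ) - s) ^ ρ) :
    MemC3 besselNorm (κ + ρ) (lambdaArg ε X Xa XX σ y yx) := by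
  obtain ⟨L, hL⟩ := exists_besselNorm_heatL_le (n := n) (p := p) hε
  obtain ⟨D, hD, hF, hG⟩ := exists_smoothMap_common (p := p) hσ hε
  have hc := h.nonneg
  have hFc : ∀ i, Continuous fun s => field (σ i) (y s) := fun i => (hF i).continuous.comp hycont
  have hGc : ∀ i j, Continuous fun s => fieldDeriv ε (σ i) (σ j) (y s) :=
    fun i j => (hG i j).continuous.comp hycont
  have hpair : ∀ {α β : ℝ} {g G : Time T → Time T → Time T → LpSpace n p} {P : ℝ}, 0 ≤ P →
      ContinuousOn (fun q : Time T × Time T × Time T => G q.1 q.2.1 q.2.2) (simplex3 T) →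
      (∀ t u s, s ≤ u → u ≤ t → g t u s = heatL ε (G t u s)) →
      (∀ t u s : Time T, s ≤ u → u ≤ t →
        ‖G t u s‖ ≤ P * (((t : ℝ) - u) ^ α * ((u : ℝ) - s) ^ β)) →
      MemC3Pair besselNorm α β g := by
    intro α β g G P hP hc he hb
    refine ⟨contIn_heatL hε (fun q hq => he q.1 q.2.1 q.2.2 hq.1 hq.2) hc, L * P.toNNReal,
      fun t u s hsu hut => ?_⟩
    rw [he t u s hsu.le hut.le, mul_assoc,
      ← ENNReal.ofReal_mul (Real.rpow_nonneg (sub_time_nonneg hut.le) _)]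
    exact besselNorm_heatL_le_of_norm_le hL hP (hb t u s hsu.le hut.le)
  have hmaps : MapsTo (fun q : Time T × Time T × Time T => (q.1, q.2.1)) (simplex3 T)
    (simplex2 T) := fun q hq => hq.2
  have hmc : ContinuousOn (fun q : Time T × Time T × Time T => (q.1, q.2.1)) (simplex3 T) :=
    (continuous_fst.prodMk (continuous_fst.comp continuous_snd)).continuousOn
  -- The X terms have exponents (κ, ρ) and the XX terms have exponents (ρ, κ).
  refine ⟨2, ![κ, ρ], ![fun t u s => ∑ i, X i t u (heat ε (fieldSharp X Xa (σ i) y yx u s)),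
    fun t u s => ∑ i, ∑ j, XX i j t u
      (heat ε (mulDeriv (σ i) (yx j u) (y u) - mulDeriv (σ i) (yx j s) (y s)))], ?_, ?_⟩
  · intro k
    fin_cases k
    · refine ⟨hκ, by simp [hρ], ?_⟩
      simp only [Fin.zero_eta, Matrix.cons_val_zero, add_sub_cancel_left]
      refine hpair (G := fun t u s => ∑ i, X i t u (field (σ i) (y u) - field (σ i) (y s)
        - ∑ j, (x j u - x j s) • fieldDeriv ε (σ i) (σ j) (y s))) (P := N * (c * K))
        (by positivity) ?_ ?_ ?_
      · refine continuousOn_finsetSum _ fun i _ => ((hX i).comp hmc hmaps).clm_apply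
          (Continuous.continuousOn ?_)
        refine (((hFc i).comp (continuous_fst.comp continuous_snd)).sub
          ((hFc i).comp (continuous_snd.comp continuous_snd))).sub
          (continuous_finsetSum _ fun j _ => ?_)
        have c1 : Continuous fun q : Time T × Time T × Time T => x j q.2.1 - x j q.2.2 :=
          ((h.continuous_x hκ j).comp (continuous_fst.comp continuous_snd)).sub
            ((h.continuous_x hκ j).comp (continuous_snd.comp continuous_snd))
        have c2 : Continuous fun q : Time T × Time T × Time T =>
            fieldDeriv ε (σ i) (σ j) (y q.2.2) :=
          (hGc i j).comp (continuous_snd.comp continuous_snd)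
        exact c1.smul c2
      · intro t u s hsu hut
        rw [map_sum]
        refine Finset.sum_congr rfl fun i _ => ?_
        rw [heat_eq_heatL hε.le, h.comm_X i t u hut, h.fieldSharp_eq hσ hyx i hsu,
          lead_eq_sum hyx, (hσ i).mulDeriv_sum]
        simp only [(hσ i).mulDeriv_smul, hyx, fieldDeriv]
      · intro t u s hsu hut
        refine (norm_sum_le_of_le _ (n := fun _ => c * K * (((t : ℝ) - u) ^ κ *
          ((u : ℝ) - s) ^ ρ)) fun i _ => ?_).trans_eq ?_
        · refine (h.X_le i t u hut _).trans ?_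
          have h1 := (hy u s hsu).2 i
          rw [lead_eq_sum hyx, (hσ i).mulDeriv_sum] at h1
          simp only [(hσ i).mulDeriv_smul, hyx] at h1
          have h2 := Real.rpow_nonneg (sub_time_nonneg hut) κ
          calc _ ≤ c * ((t : ℝ) - u) ^ κ * (K * ((u : ℝ) - s) ^ ρ) := by
                refine mul_le_mul_of_nonneg_left h1 (by positivity)
            _ = _ := by ring
        · simp
          ring
    · refine ⟨hρ, by simp [hκ], ?_⟩
      simp only [Fin.mk_one, Matrix.cons_val_one, Matrix.cons_val_fin_one, add_sub_cancel_right]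
      refine hpair (G := fun t u s => ∑ i, ∑ j, XX i j t u (fieldDeriv ε (σ i) (σ j) (y u)
        - fieldDeriv ε (σ i) (σ j) (y s))) (P := N * (N * (c * (D * K))))
        (by positivity) ?_ ?_ ?_
      · refine continuousOn_finsetSum _ fun i _ => continuousOn_finsetSum _ fun j _ =>
          ((hXX i j).comp hmc hmaps).clm_apply (Continuous.continuousOn ?_)
        exact ((hGc i j).comp (continuous_fst.comp continuous_snd)).sub
          ((hGc i j).comp (continuous_snd.comp continuous_snd))
      · intro t u s hsu hut
        rw [map_sum]
        refine Finset.sum_congr rfl fun i _ => ?_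
        rw [map_sum]
        refine Finset.sum_congr rfl fun j _ => ?_
        rw [heat_eq_heatL hε.le, h.comm_XX i j t u hut, hyx, hyx, fieldDeriv, fieldDeriv]
      · intro t u s hsu hut
        refine (norm_sum_le_of_le _ (n := fun _ => N * (c * (D * K)) * (((t : ℝ) - u) ^ ρ *
          ((u : ℝ) - s) ^ κ)) fun i _ => (norm_sum_le_of_le _ (n := fun _ => c * (D * K) *
          (((t : ℝ) - u) ^ ρ * ((u : ℝ) - s) ^ κ)) fun j _ => ?_).trans_eq ?_).trans_eq ?_
        · refine (h.XX_le i j t u hut _).trans ?_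
          have h1 := (hy u s hsu).1
          have h2 := Real.rpow_nonneg (sub_time_nonneg hut) ρ
          calc _ ≤ c * ((t : ℝ) - u) ^ ρ * (D * (K * ((u : ℝ) - s) ^ κ)) := by
                refine mul_le_mul_of_nonneg_left (((hG i j).lip _ _).trans ?_) (by positivity)
                gcongr
            _ = _ := by ring
        · simp
          ring
        · simp
          ring
  · intro t u s _ _
    rw [Fin.sum_univ_two]
    rfl

end Existence

/-! ### From a trajectory of the scheme to a solution -/

section ExistenceSolution

variable {n p N : ℕ} {T : ℝ} [Fact (1 ≤ (p : ℝ≥0∞))]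

variable {γ κ ρ ε c C : ℝ} {x : Fin N → Time T → ℝ}
  {X Xa : Fin N → Time T → Time T → LpSpace n p →L[ℝ] LpSpace n p}
  {XX : Fin N → Fin N → Time T → Time T → LpSpace n p →L[ℝ] LpSpace n p}
  {σ : Fin N → Space n → ℝ → ℝ} {ψ : LpSpace n p}
  {y : Time T → LpSpace n p} {yx : Fin N → Time T → LpSpace n p} {z : Time T → LpSpace n p}

/-- The remainder y^♯ must have the full order 2κ, while `RoughBounds` records only ρ, which may be
capped at 1. -/
theorem HeatRoughPath.exists_norm_sum_XX_le (hX : HeatRoughPath γ ε x X Xa XX)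
    (hσ : ∀ i, RegularField (σ i) C) (hε : 0 < ε) (hT : 0 ≤ T) (hκ : 0 < κ) (hκγ : κ ≤ γ) :
    ∃ K, 0 ≤ K ∧ ∀ t s : Time T, s ≤ t → ∀ y,
      ‖∑ i, ∑ j, XX i j t s (fieldDeriv ε (σ i) (σ j) y)‖ ≤ K * ((t : ℝ) - s) ^ (2 * κ) := by
  obtain ⟨D, hD, -, hG⟩ := exists_smoothMap_common (p := p) hσ hε
  obtain ⟨c, hc, h⟩ := exists_common_bound
    (P := fun (i : Fin N × Fin N) c => ∀ t s : Time T, s ≤ t → ∀ φ,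
      ‖XX i.1 i.2 t s φ‖ ≤ c * ((t : ℝ) - s) ^ (2 * κ) * ‖φ‖)
    (fun i a b hab H t s hst φ => (H t s hst φ).trans
      (mul_le_mul_of_nonneg_right (mul_le_mul_of_nonneg_right hab
        (Real.rpow_nonneg (sub_time_nonneg hst) _)) (norm_nonneg _)))
    (fun i => (hX.XX_leb i.1 i.2).exists_norm_le (hX.XX_self i.1 i.2) hT
      (by linarith : 0 < 2 * κ) (by linarith))
  refine ⟨N * (N * (c * D)), by positivity, fun t s hst y => ?_⟩
  refine ((SmoothMap.sum Finset.univ fun i => SmoothMap.sum Finset.univ fun j =>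
    (hG i j).clm (mul_nonneg hc (Real.rpow_nonneg (sub_time_nonneg hst) _))
      (h (i, j) t s hst)).bound y).trans_eq ?_
  simp
  ring

/-- S_t ψ is an exact orbit of the heat flow, so it drops out of δ̂y and only z remains. -/
theorem state_sub_heatL (hε : 0 ≤ ε) {t s : Time T} (hst : s ≤ t) (a b : LpSpace n p) :
    state ε ψ t a - heatL ((t : ℝ) - s) (state ε ψ s b) =
      heatL ε (a - heatL ((t : ℝ) - s) b) := by
  rw [state, state, map_add, heatL_heatL (sub_time_nonneg hst) s.2.1, sub_add_cancel, map_sub,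
    heatL_comm hε (sub_time_nonneg hst)]
  abel

theorem contIn_state (hψ : besselNorm ψ ≠ ∞) (hε : 0 < ε)
    (hz : Continuous fun t => heatL (ε / 2) (z t)) :
    ContIn besselNorm univ fun t : Time T => state ε ψ t (z t) := by
  refine (contIn_heatL_time hψ).add (contIn_heatL (half_pos hε)
    (G := fun t => heatL (ε / 2) (z t)) (fun t _ => ?_) hz.continuousOn)
  rw [heatL_heatL (half_pos hε).le (half_pos hε).le, add_halves]

theorem HeatRoughPath.isControlled_trajectory (hX : HeatRoughPath γ ε x X Xa XX)
    (hσ : ∀ i, RegularField (σ i) C) (hψ : besselNorm ψ ≠ ∞) (hε : 0 < ε) (hT : 0 ≤ T)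
    (hκ : 0 < κ) (hκγ : κ ≤ γ) (hγ1 : γ ≤ 1)
    (h : RoughBounds κ ρ ε c x X Xa XX)
    (hκρ : κ ≤ ρ) (hρ1 : ρ ≤ 1) (hμ : 1 < κ + ρ) {C₀ M : ℝ} (hC₀ : 0 ≤ C₀)
    (hz : ∀ t s, s ≤ t → ‖z t - scheme ε X XX σ ψ t s (z s)‖ ≤ C₀ * ((t : ℝ) - s) ^ (κ + ρ))
    (hM : ∀ t, ‖z t‖ ≤ M) :
    IsControlled γ κ X (fun t => state ε ψ t (z t))
      (fun i t => heatL ε (field (σ i) (state ε ψ t (z t)))) := by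
  have hγ : 0 < γ := hκ.trans_le hκγ
  have hε2 := half_pos hε
  have hM0 : 0 ≤ M := (norm_nonneg _).trans (hM ⟨0, le_rfl, hT⟩)
  obtain ⟨D, hD, hF, -⟩ := exists_smoothMap_common (p := p) hσ hε
  -- A second set of bounds with γ in place of κ, because the path itself has to be Hölder of order
  -- γ.
  obtain ⟨c', h'⟩ := hX.exists_roughBounds hT hε hγ le_rfl (ρ := min 1 (2 * γ))
    (lt_min one_pos (by linarith)) (min_le_left _ _) (min_le_right _ _)
  obtain ⟨A, hA, hx⟩ := h'.exists_smoothMap_expansion (p := p) hσ hε hT hγ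
    (le_min hγ1 (by linarith))
  obtain ⟨K, hK, hst⟩ := h.exists_state_step_le hσ hψ hε hT hκ hκρ hρ1
  obtain ⟨L, hL⟩ := exists_besselNorm_heatL_le (n := n) (p := p) hε
  obtain ⟨K₂, hK₂, hxx⟩ := hX.exists_norm_sum_XX_le hσ hε hT hκ hκγ
  have hzc := h.continuous_heatL_trajectory hσ hε hT hκ hκρ (hκρ.trans hρ1) hC₀ hz hM hε2
  have hyc := contIn_state hψ hε hzc
  have hy : Continuous fun t : Time T => state ε ψ t (z t) := continuousOn_univ.1 hyc.continuousOn
  have hFc : ∀ i, Continuous fun s => field (σ i) (state ε ψ s (z s)) :=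
    fun i => (hF i).continuous.comp hy
  have hyx : ∀ i, ContIn besselNorm univ fun t : Time T =>
      heatL ε (field (σ i) (state ε ψ t (z t))) := fun i =>
    contIn_heatL hε (fun _ _ => rfl) (hFc i).continuousOn
  have hzE : ∀ t s : Time T, z t - heatL ((t : ℝ) - s) (z s) =
      expansion ε X XX σ t s (state ε ψ s (z s)) + (z t - scheme ε X XX σ ψ t s (z s)) := by
    intro t s
    rw [scheme]
    abel
  refine ⟨⟨hyc, ?_⟩, fun i => ⟨hyx i, ?_⟩, fun i => ⟨hyx i, ?_⟩, ?_⟩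
  · refine ⟨L * (A + C₀ * T ^ (κ + ρ - γ)).toNNReal, fun t s hlt => ?_⟩
    have h0 := sub_time_nonneg hlt.le
    rw [deltaHat1_eq _ hlt.le, state_sub_heatL hε.le hlt.le, hzE]
    refine besselNorm_heatL_le_of_norm_le hL (by positivity) ?_
    refine (norm_add_le_of_le ((hx t s hlt.le).bound _) (hz t s hlt.le)).trans ?_
    have := rpow_le_mul_rpow h0 (sub_time_le t s) hγ (by linarith : γ ≤ κ + ρ)
    calc _ ≤ A * ((t : ℝ) - s) ^ γ + C₀ * (T ^ (κ + ρ - γ) * ((t : ℝ) - s) ^ γ) := by gcongr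
      _ = _ := by ring
  · refine ⟨L * D.toNNReal, fun t => ?_⟩
    have := besselNorm_heatL_le_of_norm_le hL (r := 1) hD
      (((hF i).bound (state ε ψ t (z t))).trans_eq (mul_one D).symm)
    simpa using this
  · refine ⟨L * (D * (K * (1 + M) + C₀ * T ^ (κ + ρ - κ))).toNNReal, fun t s hlt => ?_⟩
    have h0 := sub_time_nonneg hlt.le
    rw [← map_sub]
    refine besselNorm_heatL_le_of_norm_le hL (by positivity) (((hF i).lip _ _).trans ?_)
    rw [mul_assoc]
    refine mul_le_mul_of_nonneg_left ?_ hD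
    have e : state ε ψ t (z t) - state ε ψ s (z s) =
        (state ε ψ t (scheme ε X XX σ ψ t s (z s)) - state ε ψ s (z s))
        + (state ε ψ t (z t) - state ε ψ t (scheme ε X XX σ ψ t s (z s))) := by abel
    rw [e, state_sub t]
    have h1 := rpow_le_mul_rpow h0 (sub_time_le t s) hκ (by linarith : κ ≤ κ + ρ)
    have h2 := hM s
    refine (norm_add_le_of_le (hst t s hlt.le (z s) (z s)).1
      ((norm_heatL_le _ _).trans (hz t s hlt.le))).trans ?_
    have h3 := Real.rpow_nonneg h0 κ
    calc _ ≤ K * (1 + M) * ((t : ℝ) - s) ^ κ + C₀ * (T ^ (κ + ρ - κ) * ((t : ℝ) - s) ^ κ) := by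
          gcongr
      _ = _ := by ring
  · have hs : ∀ t s : Time T, s ≤ t → sharp X (fun t => state ε ψ t (z t))
        (fun i t => heatL ε (field (σ i) (state ε ψ t (z t)))) t s =
        heatL ε (z t - heatL ((t : ℝ) - s) (z s)
          - ∑ i, X i t s (field (σ i) (state ε ψ s (z s)))) := by
      intro t s hle
      rw [sharp, deltaHat1_eq _ hle, state_sub_heatL hε.le hle, map_sub (heatL ε) (_ - _), map_sum]
      congr 1
      exact Finset.sum_congr rfl fun i _ => h.comm_X i t s hle _
    refine memC2_heatL hε (K := K₂ + C₀ * T ^ (κ + ρ - 2 * κ)) (by positivity)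
      (G := fun t s => heatL (ε / 2) (z t) - heatL ((t : ℝ) - s) (heatL (ε / 2) (z s))
        - heatL (ε / 2) (∑ i, X i t s (field (σ i) (state ε ψ s (z s))))) ?_ ?_ hs ?_
    · refine ((hzc.comp continuous_fst).continuousOn.sub (continuousOn_heatL_comp
        (τ := fun q : Time T × Time T => (q.1 : ℝ) - q.2) (by fun_prop)
        (hzc.comp continuous_snd).continuousOn)).sub
        ((heatL (ε / 2)).continuous.comp_continuousOn (continuousOn_finsetSum _ fun i _ =>
          (hX.X_leb i).continuousOn.clm_apply ((hFc i).comp continuous_snd).continuousOn))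
    · intro t s hle
      rw [hs t s hle, ← heatL_comm hε2.le (sub_time_nonneg hle), ← map_sub, ← map_sub,
        heatL_heatL hε2.le hε2.le, add_halves]
    · intro t s hle
      have h0 := sub_time_nonneg hle
      have e : z t - heatL ((t : ℝ) - s) (z s) - ∑ i, X i t s (field (σ i) (state ε ψ s (z s))) =
          ∑ i, ∑ j, XX i j t s (fieldDeriv ε (σ i) (σ j) (state ε ψ s (z s)))
          + (z t - scheme ε X XX σ ψ t s (z s)) := by
        rw [hzE, expansion]
        abel
      rw [e]
      refine (norm_add_le_of_le (hxx t s hle _) (hz t s hle)).trans ?_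
      have h1 := rpow_le_mul_rpow h0 (sub_time_le t s) (by linarith : 0 < 2 * κ)
        (by linarith : 2 * κ ≤ κ + ρ)
      calc _ ≤ K₂ * ((t : ℝ) - s) ^ (2 * κ)
            + C₀ * (T ^ (κ + ρ - 2 * κ) * ((t : ℝ) - s) ^ (2 * κ)) := by gcongr
        _ = _ := by ring

/-- The semigroup law makes δ̂ ∘ δ̂ = 0: the argument of Λ̂ is closed because it is already a
coboundary. -/
theorem deltaHat3_deltaHat2 {R : Time T → Time T → LpSpace n p}
    {g : Time T → Time T → Time T → LpSpace n p}
    (h : ∀ t u s : Time T, s ≤ u → u ≤ t → deltaHat2 R t u s = g t u s)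
    {t u v s : Time T} (hsv : s ≤ v) (hvu : v ≤ u) (hut : u ≤ t) : deltaHat3 g t u v s = 0 := by
  rw [deltaHat3, aOp_eq hut, ← h u v s hsv hvu, ← h t v s hsv (hvu.trans hut),
    ← h t u s (hsv.trans hvu) hut, ← h t u v hvu hut, deltaHat2_eq _ hvu,
    deltaHat2_eq _ (hvu.trans hut), deltaHat2_eq _ hut, deltaHat2_eq _ hut, map_sub, map_sub,
    heatL_heatL (sub_time_nonneg hut) (sub_time_nonneg hvu), sub_add_sub_cancel]
  abel

theorem HeatRoughPath.exists_isSolution (hX : HeatRoughPath γ ε x X Xa XX)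
    (hσ : ∀ i, RegularField (σ i) C) (hC : 0 ≤ C) (hψ : besselNorm ψ ≠ ∞) (hε : 0 < ε)
    (hT : 0 < T) (hκ : 1 / 3 < κ) (hκγ : κ < γ) (hγ1 : γ ≤ 1) :
    ∃ (y : Time T → LpSpace n p) (yx : Fin N → Time T → LpSpace n p),
      IsSolution hT.le γ κ ε X Xa XX σ ψ y yx := by
  -- The order of `rest`: S_τ - id gives 1 and XX gives 2κ. As κ > 1/3, both κ + 1 and 3κ exceed 1.
  obtain ⟨ρ, hρdef⟩ : ∃ ρ, ρ = min 1 (2 * κ) := ⟨_, rfl⟩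
  have hκ0 : 0 < κ := by linarith
  have hρ1 : ρ ≤ 1 := hρdef ▸ min_le_left _ _
  have hρκ : ρ ≤ 2 * κ := hρdef ▸ min_le_right _ _
  have hκρ : κ ≤ ρ := hρdef ▸ le_min (by linarith) (by linarith)
  have hρ : 0 < ρ := hκ0.trans_le hκρ
  have hμ : 1 < κ + ρ := by
    rw [hρdef, ← min_add_add_left]
    exact lt_min (by linarith) (by linarith)
  have hε2 := half_pos hε
  obtain ⟨c, h⟩ := hX.exists_roughBounds hT.le hε hκ0 hκγ.le hρ hρ1 hρκ
  obtain ⟨K, hflow⟩ := h.exists_almostFlow_scheme hσ hψ hε hT.le hC hκ0 hκρ hρ1 (by linarith) hμ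
  -- The trajectory starts at 0, since the initial datum is carried by S_t ψ.
  obtain ⟨z, hz0, C₀, hC₀, hz⟩ := hflow.exists_trajectory hT (0 : LpSpace n p)
  obtain ⟨M, hM, hzM⟩ := hflow.exists_norm_trajectory_le hT.le hC₀ hz
  have hcon := hX.isControlled_trajectory hσ hψ hε hT.le hκ0 hκγ.le hγ1 h hκρ hρ1 hμ hC₀ hz hzM
  have hzc := h.continuous_heatL_trajectory hσ hε hT.le hκ0 hκρ (hκρ.trans hρ1) hC₀ hz hzM hε2
  set y : Time T → LpSpace n p := fun t => state ε ψ t (z t) with hy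
  set yx : Fin N → Time T → LpSpace n p := fun i t => heatL ε (field (σ i) (y t))
  have hyx : ∀ i s, yx i s = heatL ε (field (σ i) (y s)) := fun _ _ => rfl
  have hyc : Continuous y := continuousOn_univ.1 hcon.path.1.continuousOn
  obtain ⟨D, hD, hF, hG⟩ := exists_smoothMap_common (p := p) hσ hε
  obtain ⟨K₁, hK₁, hb⟩ := h.exists_controlled_le hσ hcon hyx hε hT.le hC (by linarith) hκ0 hκρ hρ1
    (by linarith)
  have hXc := fun i => (hX.X_leb i).continuousOn
  have hXXc := fun i j => (hX.XX_leb i j).continuousOn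
  have hexp : ContinuousOn (fun q : Time T × Time T => expansion ε X XX σ q.1 q.2 (y q.2))
      (simplex2 T) := continuousOn_expansion hXc hXXc (fun i => (hF i).continuous.comp hyc)
        (fun i j => (hG i j).continuous.comp hyc)
  -- The smoothed error of the trajectory serves as Λ̂ of the argument, so no separate sewing map is
  -- constructed.
  let R : Time T → Time T → LpSpace n p := fun t s => heatL ε (z t - scheme ε X XX σ ψ t s (z s))
  have hR2 : ∀ t u s : Time T, s ≤ u → u ≤ t →
      deltaHat2 R t u s = lambdaArg ε X Xa XX σ y yx t u s := by
    intro t u s hsu hut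
    rw [h.lambdaArg_eq hσ hε.le hyx hsu hut, deltaHat2_eq _ hut]
    simp only [R]
    rw [← heatL_comm hε.le (sub_time_nonneg hut), ← map_sub, ← map_sub]
    congr 1
    simp only [scheme, map_sub, map_add]
    rw [heatL_heatL (sub_time_nonneg hut) (sub_time_nonneg hsu), sub_add_sub_cancel]
    abel
  refine ⟨y, yx, hcon, ?_, fun i s => (heat_eq_heatL hε.le _).symm, deltaHat1 y, ⟨R, ⟨κ + ρ, hμ,
    h.memC3_lambdaArg hσ hyx hε hκ0 hρ hyc hXc hXXc hK₁ hb,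
    fun t u v s hsv hvu hut => deltaHat3_deltaHat2 hR2 hsv hvu hut, ?_, hR2⟩, ?_⟩, fun _ _ _ => rfl⟩
  · rw [hy]
    simp only [hz0, state, heatL_zero, map_zero, add_zero]
  · refine memC2_heatL hε hC₀ (G := fun t s => heatL (ε / 2) (z t)
      - heatL ((t : ℝ) - s) (heatL (ε / 2) (z s))
      - heatL (ε / 2) (expansion ε X XX σ t s (y s))) ?_ ?_ (fun _ _ _ => rfl) hz
    · exact ((hzc.comp continuous_fst).continuousOn.sub (continuousOn_heatL_comp
        (τ := fun q : Time T × Time T => (q.1 : ℝ) - q.2) (by fun_prop)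
        (hzc.comp continuous_snd).continuousOn)).sub
        ((heatL (ε / 2)).continuous.comp_continuousOn hexp)
    · intro t s hst
      simp only [R]
      rw [← heatL_comm hε2.le (sub_time_nonneg hst), ← map_sub, ← map_sub,
        heatL_heatL hε2.le hε2.le, add_halves, scheme, sub_sub]
  · intro t s hst
    rw [h.heatL_expansion_eq hε.le hyx hst, deltaHat1_eq y hst, hy,
      state_sub_heatL hε.le hst, ← map_add]
    congr 1
    simp only [scheme]
    abel

end ExistenceSolution

/-! ## Uniqueness -/

section Uniqueness

variable {n p N : ℕ} {T : ℝ} [Fact (1 ≤ (p : ℝ≥0∞))]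

/-- Sewing of the affine flow `a ↦ S_{t-s} a + w_{ts}`. -/
theorem exists_heat_sewing {κ μ K : ℝ} {w : Time T → Time T → LpSpace n p} (hT : 0 < T)
    (hκ : 0 < κ) (hκμ : κ ≤ μ) (hμ : 1 < μ) (hK : 0 ≤ K)
    (hw : ∀ t s : Time T, s ≤ t → ‖w t s‖ ≤ K * ((t : ℝ) - s) ^ κ)
    (hd : ∀ t u s : Time T, s ≤ u → u ≤ t →
      ‖heatL ((t : ℝ) - u) (w u s) + w t u - w t s‖ ≤ K * ((t : ℝ) - s) ^ μ) :
    ∃ z : Time T → LpSpace n p, z ⟨0, le_refl 0, hT.le⟩ = 0 ∧ ∃ C₀, 0 ≤ C₀ ∧ ∀ t s, s ≤ t →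
      ‖z t - (heatL ((t : ℝ) - s) (z s) + w t s)‖ ≤ C₀ * ((t : ℝ) - s) ^ μ := by
  have hflow : AlmostFlow (fun t s a => heatL ((t : ℝ) - s) a + w t s) κ μ K := by
    have hq : ∀ t s : Time T, s ≤ t → 0 ≤ K * ((t : ℝ) - s) ^ κ := fun t s hst =>
      mul_nonneg hK (Real.rpow_nonneg (sub_time_nonneg hst) _)
    have hdef : ∀ t u s : Time T, s ≤ u → u ≤ t → ∀ a : LpSpace n p,
        heatL ((t : ℝ) - u) (heatL ((u : ℝ) - s) a + w u s) + w t u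
          - (heatL ((t : ℝ) - s) a + w t s) =
        heatL ((t : ℝ) - u) (w u s) + w t u - w t s := by
      intro t u s hsu hut a
      rw [map_add, heatL_heatL (sub_time_nonneg hut) (sub_time_nonneg hsu), sub_add_sub_cancel]
      abel
    refine ⟨hκ, hκμ, hμ, hK, fun t a => ?_, fun t s hst a b => ?_, fun t s hst x x' v v' => ?_,
      fun t s hst a => norm_add_le_of_le (norm_heatL_le _ _) (hw t s hst),
      fun t u s hsu hut a => ?_, fun t u s hsu hut a b => ?_⟩
    · have := hw t t le_rfl
      rw [sub_self, Real.zero_rpow hκ.ne', mul_zero, norm_le_zero_iff] at this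
      simp [this, heatL_zero]
    · rw [add_sub_add_right_eq_sub, ← map_sub]
      refine (norm_heatL_le _ _).trans (le_mul_of_one_le_left (norm_nonneg _) ?_)
      linarith [hq t s hst]
    · have h0 := hq t s hst
      rw [add_sub_add_right_eq_sub, add_sub_add_right_eq_sub, ← map_sub, ← map_sub, ← map_sub]
      refine le_add_of_le_of_nonneg ((norm_heatL_le _ _).trans
        (le_mul_of_one_le_left (norm_nonneg _) (by linarith))) (by positivity)
    · rw [hdef t u s hsu hut]
      refine (hd t u s hsu hut).trans ?_
      have := Real.rpow_nonneg (sub_time_nonneg (hsu.trans hut)) μ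
      gcongr
      exact le_mul_of_one_le_right hK (by linarith [norm_nonneg a])
    · rw [hdef t u s hsu hut, hdef t u s hsu hut, sub_self, norm_zero]
      have := Real.rpow_nonneg (sub_time_nonneg (hsu.trans hut)) μ
      positivity
  exact hflow.exists_trajectory hT 0

/-- The heat flow is an exact flow, hence an almost flow with constant 0, and the zero path is its
trajectory from 0; uniqueness of trajectories concludes. -/
theorem eq_zero_of_heat_trajectory {ν K : ℝ} {v : Time T → LpSpace n p} (hT : 0 ≤ T)
    (hν : 1 < ν) (h0 : v ⟨0, le_refl 0, hT⟩ = 0)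
    (hv : ∀ t s : Time T, s ≤ t → ‖v t - heatL ((t : ℝ) - s) (v s)‖ ≤ K * ((t : ℝ) - s) ^ ν) :
    v = 0 := by
  have hflow : AlmostFlow (fun (t s : Time T) (a : LpSpace n p) => heatL ((t : ℝ) - s) a)
      1 2 0 := by
    refine ⟨one_pos, one_le_two, one_lt_two, le_rfl, fun t a => by simp [heatL_zero],
      fun t s _ a b => ?_, fun t s _ x x' w w' => ?_, fun t s _ a => ?_,
      fun t u s hsu hut a => ?_, fun t u s hsu hut a b => ?_⟩
    · simpa [← map_sub] using norm_heatL_le _ _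
    · simpa only [zero_mul, add_zero, one_mul, map_sub] using
        norm_heatL_le ((t : ℝ) - s) (x - x' - (w - w'))
    · simpa using norm_heatL_le _ _
    · simp [heatL_heatL (sub_time_nonneg hut) (sub_time_nonneg hsu)]
    · simp [heatL_heatL (sub_time_nonneg hut) (sub_time_nonneg hsu)]
  refine hflow.trajectory_unique hT hν hν hv (z' := 0) (C' := 0) (fun t s _ => by simp) ?_
  simpa using h0

variable {γ κ ρ ε c C : ℝ} {x : Fin N → Time T → ℝ}
  {X Xa : Fin N → Time T → Time T → LpSpace n p →L[ℝ] LpSpace n p}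
  {XX : Fin N → Fin N → Time T → Time T → LpSpace n p →L[ℝ] LpSpace n p}
  {σ : Fin N → Space n → ℝ → ℝ} {ψ : LpSpace n p}
  {y : Time T → LpSpace n p} {yx : Fin N → Time T → LpSpace n p}

/-- Every solution comes from a trajectory of the scheme. -/
theorem RoughBounds.exists_trajectory_of_isSolution (h : RoughBounds κ ρ ε c x X Xa XX)
    (hσ : ∀ i, RegularField (σ i) C) (hT : 0 < T) (hε : 0 < ε) (hC : 0 ≤ C) (hγ : 0 ≤ γ)
    (hκ : 0 < κ) (hκρ : κ ≤ ρ) (hρ1 : ρ ≤ 1) (hρκ : ρ ≤ κ + κ) (hμ : 1 < κ + ρ)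
    (hy : IsSolution hT.le γ κ ε X Xa XX σ ψ y yx) :
    ∃ z : Time T → LpSpace n p, z ⟨0, le_refl 0, hT.le⟩ = 0 ∧ (∀ t, y t = state ε ψ t (z t)) ∧
      ∃ C₀, ∀ t s, s ≤ t →
        ‖z t - scheme ε X XX σ ψ t s (z s)‖ ≤ C₀ * ((t : ℝ) - s) ^ (κ + ρ) := by
  have hρ := hκ.trans_le hκρ
  have hc := h.nonneg
  have hyx : ∀ i s, yx i s = heatL ε (field (σ i) (y s)) := fun i s => by
    rw [hy.deriv_eq, heat_eq_heatL hε.le]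
  obtain ⟨J, ⟨R, ⟨μ, hμ1, -, -, ⟨-, CR, hCR⟩, -⟩, hJ⟩, hyJ⟩ := hy.equation
  obtain ⟨D, hD, -, hG⟩ := exists_smoothMap_common (p := p) hσ hε
  obtain ⟨A, hA, hx⟩ := h.exists_smoothMap_expansion (p := p) hσ hε hT.le hκ hκρ
  obtain ⟨K, hK, hb⟩ := h.exists_controlled_le hσ hy.controlled hyx hε hT.le hC hγ hκ hκρ hρ1 hρκ
  have hdef : ∀ t u s : Time T, s ≤ u → u ≤ t →
      ‖heatL ((t : ℝ) - u) (expansion ε X XX σ u s (y s)) + expansion ε X XX σ t u (y u)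
        - expansion ε X XX σ t s (y s)‖ ≤
      (N * c + N * (N * c)) * (K + D * K) * ((t : ℝ) - s) ^ (κ + ρ) := by
    intro t u s hsu hut
    have hr0 := Real.rpow_nonneg (sub_time_nonneg hsu) ρ
    have hq0 := Real.rpow_nonneg (sub_time_nonneg hsu) κ
    rw [h.expansion_defect hσ hsu hut]
    refine h.norm_expansion_le hκ hρ hsu hut (by positivity) (fun i => ?_) (fun i j => ?_)
    · refine ((hb u s hsu).2 i).trans ?_
      gcongr
      exact le_add_of_nonneg_right (by positivity)
    · refine ((hG i j).lip _ _).trans ?_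
      calc _ ≤ D * (K * ((u : ℝ) - s) ^ κ) := by
            gcongr
            exact (hb u s hsu).1
        _ ≤ D * (K * ((u : ℝ) - s) ^ κ) + K * ((u : ℝ) - s) ^ κ :=
            le_add_of_nonneg_right (by positivity)
        _ = _ := by ring
  -- The solution y is frozen here: its expansions are sewn as prescribed data, which produces a
  -- candidate z before y is known to equal the state of z.
  obtain ⟨z, hz0, C₀, hC₀, hz⟩ := exists_heat_sewing (w := fun t s => expansion ε X XX σ t s (y s))
    hT hκ (by linarith) hμ (K := A + (N * c + N * (N * c)) * (K + D * K)) (by positivity)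
    (fun t s hst => ((hx t s hst).bound _).trans (mul_le_mul_of_nonneg_right
      (le_add_of_nonneg_right (by positivity)) (Real.rpow_nonneg (sub_time_nonneg hst) _)))
    (fun t u s hsu hut => (hdef t u s hsu hut).trans (mul_le_mul_of_nonneg_right
      (le_add_of_nonneg_left hA) (Real.rpow_nonneg (sub_time_nonneg (hsu.trans hut)) _)))
  have hRle : ∀ t s : Time T, s < t → ‖R t s‖ ≤ CR * ((t : ℝ) - s) ^ μ := by
    intro t s hst
    have h2 := ENNReal.toReal_mono
      (ENNReal.mul_ne_top ENNReal.coe_ne_top ENNReal.ofReal_ne_top)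
      ((enorm_le_besselNorm _).trans (hCR t s hst))
    rwa [toReal_enorm, ENNReal.toReal_mul, ENNReal.coe_toReal,
      ENNReal.toReal_ofReal (Real.rpow_nonneg (sub_time_nonneg hst.le) _)] at h2
  -- The exponent μ of the given Λ̂ term need not be κ + ρ; any exponent above 1 suffices for the
  -- comparison.
  have hν : 1 < min μ (κ + ρ) := lt_min hμ1 hμ
  have hv : (fun t => y t - state ε ψ t (z t)) = 0 := by
    refine eq_zero_of_heat_trajectory hT.le hν
      (K := CR * T ^ (μ - min μ (κ + ρ)) + C₀ * T ^ (κ + ρ - min μ (κ + ρ))) ?_ ?_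
    · simp only [hy.init, hz0, state, heatL_zero, map_zero, add_zero, sub_self]
    · intro t s hst
      rcases hst.eq_or_lt with rfl | hlt
      · rw [sub_self, heatL_zero, sub_self, norm_zero, Real.zero_rpow (by linarith), mul_zero]
      have h0 := sub_time_nonneg hst
      have e1 : y t - heatL ((t : ℝ) - s) (y s) =
          heatL ε (expansion ε X XX σ t s (y s)) + R t s := by
        rw [← deltaHat1_eq y hst, hyJ t s hst, hJ t s hst, h.heatL_expansion_eq hε.le hyx hst]
      have e : (y t - state ε ψ t (z t)) - heatL ((t : ℝ) - s) (y s - state ε ψ s (z s)) =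
          R t s - heatL ε (z t - (heatL ((t : ℝ) - s) (z s) + expansion ε X XX σ t s (y s))) := by
        have e2 := state_sub_heatL (ψ := ψ) hε.le hst (z t) (z s)
        calc _ = (y t - heatL ((t : ℝ) - s) (y s))
              - (state ε ψ t (z t) - heatL ((t : ℝ) - s) (state ε ψ s (z s))) := by
              rw [map_sub]
              abel
          _ = _ := by
              rw [e1, e2, ← sub_sub, map_sub (heatL ε) (z t - _)]
              abel
      rw [e]
      have h1 := rpow_le_mul_rpow h0 (sub_time_le t s) (by linarith) (min_le_left μ (κ + ρ))
      have h2 := rpow_le_mul_rpow h0 (sub_time_le t s) (by linarith) (min_le_right μ (κ + ρ))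
      refine (norm_sub_le_of_le (hRle t s hlt) ((norm_heatL_le _ _).trans (hz t s hst))).trans ?_
      calc _ ≤ CR * (T ^ (μ - min μ (κ + ρ)) * ((t : ℝ) - s) ^ min μ (κ + ρ))
            + C₀ * (T ^ (κ + ρ - min μ (κ + ρ)) * ((t : ℝ) - s) ^ min μ (κ + ρ)) := by gcongr
        _ = _ := by ring
  have hys : ∀ t, y t = state ε ψ t (z t) := fun t => sub_eq_zero.1 (congrFun hv t)
  refine ⟨z, hz0, hys, C₀, fun t s hst => ?_⟩
  have := hz t s hst
  rwa [hys s] at this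

/-- Both solutions are states of trajectories of the same almost flow issued from 0; these
trajectories coincide, and y determines its derivative. -/
theorem HeatRoughPath.isSolution_unique (hX : HeatRoughPath γ ε x X Xa XX)
    (hσ : ∀ i, RegularField (σ i) C) (hC : 0 ≤ C) (hψ : besselNorm ψ ≠ ∞) (hε : 0 < ε)
    (hT : 0 < T) (hκ : 1 / 3 < κ) (hκγ : κ < γ) (hγ1 : γ ≤ 1)
    {y' : Time T → LpSpace n p} {yx' : Fin N → Time T → LpSpace n p}
    (hy : IsSolution hT.le γ κ ε X Xa XX σ ψ y yx)
    (hy' : IsSolution hT.le γ κ ε X Xa XX σ ψ y' yx') : y = y' ∧ yx = yx' := by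
  obtain ⟨ρ, hρdef⟩ : ∃ ρ, ρ = min 1 (2 * κ) := ⟨_, rfl⟩
  have hκ0 : 0 < κ := by linarith
  have hρ1 : ρ ≤ 1 := hρdef ▸ min_le_left _ _
  have hρκ : ρ ≤ 2 * κ := hρdef ▸ min_le_right _ _
  have hκρ : κ ≤ ρ := hρdef ▸ le_min (by linarith) (by linarith)
  have hρ : 0 < ρ := hκ0.trans_le hκρ
  have hμ : 1 < κ + ρ := by
    rw [hρdef, ← min_add_add_left]
    exact lt_min (by linarith) (by linarith)
  obtain ⟨c, h⟩ := hX.exists_roughBounds hT.le hε hκ0 hκγ.le hρ hρ1 hρκ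
  obtain ⟨K, hflow⟩ := h.exists_almostFlow_scheme hσ hψ hε hT.le hC hκ0 hκρ hρ1 (by linarith) hμ
  obtain ⟨z, hz0, hyz, C₀, hz⟩ := h.exists_trajectory_of_isSolution hσ hT hε hC (by linarith)
    hκ0 hκρ hρ1 (by linarith) hμ hy
  obtain ⟨z', hz0', hyz', C₀', hz'⟩ := h.exists_trajectory_of_isSolution hσ hT hε hC (by linarith)
    hκ0 hκρ hρ1 (by linarith) hμ hy'
  have hzz : z = z' := hflow.trajectory_unique hT.le hμ hμ hz hz' (hz0.trans hz0'.symm)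
  have hyy : y = y' := funext fun t => by rw [hyz, hyz', hzz]
  refine ⟨hyy, funext fun i => funext fun s => ?_⟩
  rw [hy.deriv_eq, hy'.deriv_eq, hyy]

end Uniqueness

end RoughHeat

/-! ### Existence and uniqueness of the global solution -/

theorem mainTheorem6 (n N p : ℕ) (hn : 0 < n) [Fact (1 ≤ (p : ℝ≥0∞))]
    (γ κ ε T : ℝ) (hγ : γ ≤ 1) (hκ : 1 / 3 < κ) (hκγ : κ < γ)
    (hp : (n : ℝ) / (2 * p) < γ - κ) (hε : 0 < ε) (hT : 0 < T)
    (x : Fin N → RoughHeat.Time T → ℝ)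
    (X Xa : Fin N → RoughHeat.Time T → RoughHeat.Time T →
      RoughHeat.LpSpace n p →L[ℝ] RoughHeat.LpSpace n p)
    (XX : Fin N → Fin N → RoughHeat.Time T → RoughHeat.Time T →
      RoughHeat.LpSpace n p →L[ℝ] RoughHeat.LpSpace n p)
    (hX : RoughHeat.HeatRoughPath γ ε x X Xa XX)
    (σ : Fin N → RoughHeat.Space n → ℝ → ℝ) (hσ : ∀ i, RoughHeat.ClassX 3 (σ i))
    (ψ : RoughHeat.LpSpace n p) (hψ : RoughHeat.besselNorm ψ ≠ ∞) :
    ∃! Y : (RoughHeat.Time T → RoughHeat.LpSpace n p) ×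
        (Fin N → RoughHeat.Time T → RoughHeat.LpSpace n p),
      RoughHeat.IsSolution hT.le γ κ ε X Xa XX σ ψ Y.1 Y.2 := by
  obtain ⟨C, hC, hσ'⟩ := RoughHeat.exists_common_bound
    (P := fun i C => RoughHeat.RegularField (σ i) C) (fun _ _ _ hab h => h.mono hab)
    (fun i => (hσ i).exists_regularField.imp fun _ h => ⟨h.nonneg, h⟩)
  obtain ⟨y, yx, hy⟩ := hX.exists_isSolution hσ' hC hψ hε hT hκ hκγ hγ
  refine ⟨(y, yx), hy, fun Y hY => ?_⟩
  obtain ⟨h₁, h₂⟩ := hX.isSolution_unique hσ' hC hψ hε hT hκ hκγ hγ hY hy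
  exact Prod.ext h₁ h₂
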